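/- **Conventions.** Let $R$ be a commutative unital ring. For a graded module $X$ and homogeneous $x\in X$ write $|\underline x|=|x|-1$ for its shifted degree. A map $\varphi$ of $n$ arguments is replaced by its shift $\underline\varphi(\underline{x_1},\dots,\underline{x_n})=(-1)^{\sum_i|\underline{x_i}|(n-i)}\,\varphi(x_1,\dots,x_n)$. All formulas below are in terms of the shifted maps, and signs are Koszul signs with respect to shifted degrees. An *$A_\infty$ algebra* is a graded $R$-module $A=\bigoplus_{d\ge 0}A_d$ with maps $\mu_k:A^{\otimes k}\to A$ ($k\ge1$) of degree $2-k$ such that $$\sum\underline{\mu_k}\circ(\mathrm{id}^{\otimes i}\otimes\underline{\mu_l}\otimes \mathrm{id}^{\otimes j})=0$$ in each arity. A *morphism* $f:A\to B$ consists of maps $f_k:A^{\otimes k}\to B$ of degree $1-k$ with $\sum \underline{f_k}(\mathrm{id}^{\otimes i}\otimes\underline{\mu_l}\otimes \mathrm{id}^{\otimes j})=\sum\underline{\nu_k}(\underline{f_{l_1}}\otimes\dots\otimes\underline{f_{l_k}})$. An *$A_\infty$ module* over $A$ is a ($\mathbb Z$-)graded module $M$ with maps $\beta_{k,\ell}:A^{\otimes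 k}\otimes M\otimes A^{\otimes \ell}\to M$ of degree $1-k-\ell$ such that $\beta\circ\beta=0$; here $\Phi\circ\beta$, for a family $\Phi_{k,\ell}$ of maps on $A^{\otimes k}\otimes M\otimes A^{\otimes\ell}$, is the sum of all ways of first applying one $\underline\mu$ or one $\underline\beta$ to consecutive arguments and then $\underline\Phi$. A *morphism of modules* $F:M\to N$ of degree $|F|$ over $f$ consists of maps $F_{k,\ell}:A^{\otimes k}\otimes M\otimes A^{\otimes \ell}\to N$ of degree $|F|-k-\ell$ with $F\circ\beta=(-1)^{|F|}\sum\underline{\gamma_{i,j}}(\underline f\otimes\dots\otimes\underline f\otimes\underline F\otimes\underline f\otimes\dots\otimes\underline f)$, where $\gamma$ is the module structure of $N$. The dual $M^*=\mathrm{Hom}(M,R)$ has the structure maps $$\underline{\beta'_{k,\ell}}(\underline{a_1},\dots,\underline{a_k},\underline{m^*},\underline{b_1},\dots,\underline{b_\ell})(\underline n)=-(-1)^{\varepsilon}\,\underline{m^*}\big(\underline{\beta_{\ell,k}}(\underline{b_1},\dots,\underline{b_\ell},\underline n,\underline{a_1},\dots,\underline{a_k})\big),$$ $\varepsilon=(\sum|\underline{a_i}|)(|\underline{m^*}|+\sum|\underline{b_j}|+|\underline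 n|)+|\underline{m^*}|$. For a family $G_{k,\ell}:A^{\otimes k}\otimes M\otimes A^{\otimes \ell}\to M^*$ of degrees $|G|-k-\ell$ put $\delta(G)=G\circ\beta-(-1)^{|G|}\beta'\circ G$. An *$A_\infty$ inner product* on $M$ is such a family $I$, of some degree, with $\delta(I)=0$. Given $f:A\to B$, $F:M\to N$ over $f$ and an inner product $J$ on $N$, the pullback $F^\sharp(J)$ is the family $$(\underline{a_1},\dots,\underline{a_k},\underline m,\underline{b_1},\dots,\underline{b_\ell})(\underline n)\mapsto\sum\pm\,\underline J\big(\underline f(\dots),\dots,\underline F(\dots,\underline m,\dots),\dots,\underline f(\dots)\big)\big(\underline F(\dots,\underline{b_\ell},\underline n,\underline{a_1},\dots)\big),$$ summed over all ways to distribute the cyclically ordered arguments over the $\underline f$'s and the two $\underline F$'s. **Formality.** Let $(A,M,I)$ denote an $A_\infty$ algebra $A$ with an $A_\infty$ module $M$ and an $A_\infty$ inner product $I$ on $M$. A *morphism* $(A,M,I)\to(B,N,J)$ is a pair $(f,F)$ such that $F^\sharp(J)-I=\delta(G)$ for some $G$. Two triples are *equivalent* if there are morphisms $(f,F)$ and $(g,H)$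 between them in the two directions such that $f_1,g_1$ induce inverse maps between $H(A)$ and $H(B)$ (cohomology of $\mu_1,\nu_1$), and $F_{0,0},H_{0,0}$ induce inverse maps between $H(M)$ and $H(N)$ (cohomology of $\beta_{0,0},\gamma_{0,0}$). A triple is *formal* if it is equivalent to one in which all structure maps other than $\mu_2,\beta_{1,0},\beta_{0,1},I_{0,0}$ vanish. **Massey inner products.** Let $k,\ell\ge0$ with $k+\ell\ge1$, $N=k+\ell+2$, and let $(x_{1,1},\dots,x_{N,N})\in A^{\times k}\times M\times A^{\times\ell}\times M$ be homogeneous. A *cyclic defining system* for it consists of two families $\{x_{i,j}\}_{1\le i\le j\le N-1}$ and $\{x'_{i,j}\}_{k+2\le i\le j\le N+k}$ of homogeneous elements, where the index $N+i$ stands for $i$ ($1\le i\le k$), such that: $x_{i,j}$ (resp. $x'_{i,j}$) lies in $M$ if the position $k+1$ (resp. $N$) is among $i,\dots,j$, and in $A$ otherwise; the diagonal entries are the given elements; the two families agree on the entries in $A$ which they share; $|\underline{x_{i,j}}|=\sum_{t=i}^j|\underline{x_{t,t}}|$, and likewise for $x'$; and for **all** $i\le j$ $$d(x_{i,j})=-\sum_{r\ge2}\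 \sum_{i=j_0\le j_1<\dots<j_r=j}\underline{\mu_r}\text{ or }\underline{\beta_{s,t}}\ (s+t+1=r)\ \text{applied to}\ (\underline{x_{j_0,j_1}},\underline{x_{j_1+1,j_2}},\dots,\underline{x_{j_{r-1}+1,j_r}}),$$ and likewise for $x'$; here $d$ is $\mu_1$ or $\beta_{0,0}$. Its *staircase inner product* is $$\mathcal I=\sum(-1)^\varepsilon\,\underline{I_{r,s}}\big(\underline{x_{i_0,i_1}},\underline{x_{i_1+1,i_2}},\dots,\underline{x_{i_r+1,j_0}},\underline{x_{j_0+1,j_1}},\dots,\underline{x_{j_{s-1}+1,j_s}}\big)\big(\underline{x'_{j_s+1,\,N+i_0-1}}\big)\in R,$$ the sum over all cyclic staircases, i.e. over all ways to cut the cyclically ordered positions $1,\dots,N$ into consecutive non-empty blocks, one containing $k+1$ but not $N$ (the $M$-argument, with $r$ blocks before and $s$ blocks after it), another one containing $N$ (the last argument); $i_0$ is the first position after the block of $N$, if that block ends at $i_0-1\in\{0,\dots,k\}$, where $0$ stands for $N$; $(-1)^\varepsilon$ is the Koszul sign for moving $\underline{x_{1,1}},\dots,\underline{x_{i_0-1,i_0-1}}$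 to the end. The *Massey inner product* $\langle x_{1,1},\dots,x_{N,N}\rangle_I\subseteq R$ is the set of all $\mathcal I$ for cyclic defining systems for $(x_{1,1},\dots,x_{N,N})$. **Corollary.** If $(A,M,I)$ is formal, then all its Massey inner products are trivial: for all $k,\ell\ge0$ with $k+\ell\ge1$ and all homogeneous $(x_{1,1},\dots,x_{N,N})\in A^{\times k}\times M\times A^{\times\ell}\times M$, the set $\langle x_{1,1},\dots,x_{N,N}\rangle_I$ is empty or contains $0$. -/

import Mathlib

universe u v w y z

/-! ## Graded modules and sums over decompositions of lists -/

/-- A `ℤ`-graded module over `R`. -/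
structure GrModule (R : Type u) [CommRing R] where
  carrier : Type v
  [addCommGroup : AddCommGroup carrier]
  [module : Module R carrier]
  gr : ℤ → Submodule R carrier
  isInternal : DirectSum.IsInternal gr

namespace GrModule

instance {R : Type*} [CommRing R] : CoeSort (GrModule R) (Type _) := ⟨GrModule.carrier⟩

instance {R : Type*} [CommRing R] (X : GrModule R) : AddCommGroup X := X.addCommGroup

instance {R : Type*} [CommRing R] (X : GrModule R) : Module R X := X.module

end GrModule

/-- A homogeneous element of a graded module, together with its degree. -/
@[ext]
structure HElt {R : Type*} [CommRing R] (X : GrModule R) where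
  deg : ℤ
  val : X
  mem : val ∈ X.gr deg

/-- The degree after shifting the module down by one. -/
def HElt.sdeg {R : Type*} [CommRing R] {X : GrModule R} (x : HElt X) : ℤ := x.deg - 1

/-- The sum of the shifted degrees of the members of a list. -/
def sdegs {R : Type*} [CommRing R] {X : GrModule R} (l : List (HElt X)) : ℤ :=
  (l.map HElt.sdeg).sum

/-- For a list of shifted degrees `d₁, …, dₙ`, the exponent `d₁ (n - 1) + d₂ (n - 2) + ⋯ + dₙ₋₁`
of the sign that relates a map of `n` arguments to its shift. -/
def shiftExp : List ℤ → ℤ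
  | [] => 0
  | d :: ds => d * ds.length + shiftExp ds

/-- The sum of `g u v` over all ways to write `l = u ++ v`, with `u` and `v` possibly empty. -/
def sumSplit {α G : Type*} [AddCommMonoid G] (l : List α) (g : List α → List α → G) : G :=
  ∑ i ∈ Finset.range (l.length + 1), g (l.take i) (l.drop i)

/-- The list of all ways `[w₁, …, wᵣ]` to write `l = w₁ ++ ⋯ ++ wᵣ` with all `wᵢ` non-empty (for
empty `l`, only `r = 0` occurs): the first member of `l` either forms a block of its own or joins
the first block of the others. -/
def parts {α : Type*} : List α → List (List (List α))
  | [] => [[]]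
  | a :: l => (parts l).flatMap fun ws =>
      match ws with
      | [] => [[[a]]]
      | w :: ws => [[a] :: w :: ws, (a :: w) :: ws]

/-- The sum of `g [w₁, …, wᵣ]` over all ways to write `l = w₁ ++ ⋯ ++ wᵣ` with all `wᵢ`
non-empty. -/
def sumParts {α G : Type*} [AddCommMonoid G] (l : List α) (g : List (List α) → G) : G :=
  ((parts l).map g).sum

/-! ## Families of multilinear maps and their shifts -/

/-- A family of maps `X^{⊗ n} → Y` for `n ≥ 1`, the `n`-th one of degree `e - n`. The component
for `n = 0` is `0` by convention. -/
structure Ops {R : Type*} [CommRing R] (X Y : GrModule R) (e : ℤ) where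
  map : ∀ n : ℕ, MultilinearMap R (fun _ : Fin n => X) Y
  map_zero : map 0 = 0
  map_mem : ∀ (n : ℕ) (x : Fin n → HElt X),
    map n (fun i => (x i).val) ∈ Y.gr (e - n + ∑ i, (x i).deg)

theorem sdegs_eq_sum {R : Type*} [CommRing R] {X : GrModule R} (l : List (HElt X)) :
    ∑ i : Fin l.length, (l.get i).deg = sdegs l + l.length := by
  induction l with
  | nil => simp [sdegs]
  | cons a l ih =>
    simp only [List.length_cons, Fin.sum_univ_succ]
    have : ∑ i : Fin l.length, ((a :: l).get i.succ).deg = sdegs l + l.length := ih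
    rw [this]
    simp [sdegs, HElt.sdeg]
    ring

/-- The shifted map
`φ̲ₙ(a̲₁, …, a̲ₙ) = (-1)^{|a̲₁| (n - 1) + ⋯ + |a̲ₙ₋₁|} φₙ(a₁, …, aₙ)` on homogeneous elements. -/
def Ops.shifted {R : Type*} [CommRing R] {X Y : GrModule R} {e : ℤ} (φ : Ops X Y e)
    (l : List (HElt X)) : HElt Y where
  deg := e + sdegs l
  val := (shiftExp (l.map HElt.sdeg)).negOnePow • φ.map l.length (fun i => (l.get i).val)
  mem := by
    have h := φ.map_mem l.length l.get
    rw [sdegs_eq_sum, show e - (l.length : ℤ) + (sdegs l + l.length) = e + sdegs l by ring] at h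
    exact zsmul_mem h _

/-- A family of maps `A^{⊗ k} ⊗ M ⊗ A^{⊗ ℓ} → N` for `k, ℓ ≥ 0`, of degrees `e - k - ℓ`. -/
structure BiOps {R : Type*} [CommRing R] (A M N : GrModule R) (e : ℤ) where
  map : ∀ k ℓ : ℕ, MultilinearMap R (fun _ : Fin k => A)
    (M →ₗ[R] MultilinearMap R (fun _ : Fin ℓ => A) N)
  map_mem : ∀ (k ℓ : ℕ) (a : Fin k → HElt A) (m : HElt M) (b : Fin ℓ → HElt A),
    map k ℓ (fun i => (a i).val) m.val (fun i => (b i).val) ∈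
      N.gr (e - k - ℓ + (∑ i, (a i).deg + m.deg + ∑ i, (b i).deg))

/-- The shifted maps, with the same sign rule as `Ops.shifted` for the `k + 1 + ℓ` arguments. -/
def BiOps.shifted {R : Type*} [CommRing R] {A M N : GrModule R} {e : ℤ} (Φ : BiOps A M N e)
    (u : List (HElt A)) (m : HElt M) (v : List (HElt A)) : HElt N where
  deg := e + sdegs u + m.deg + sdegs v
  val := (shiftExp (u.map HElt.sdeg ++ m.sdeg :: v.map HElt.sdeg)).negOnePow •
    Φ.map u.length v.length (fun i => (u.get i).val) m.val (fun i => (v.get i).val)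
  mem := by
    have h := Φ.map_mem u.length v.length u.get m v.get
    rw [sdegs_eq_sum, sdegs_eq_sum, show e - (u.length : ℤ) - v.length +
      (sdegs u + u.length + m.deg + (sdegs v + v.length)) = e + sdegs u + m.deg + sdegs v by
        ring] at h
    exact zsmul_mem h _

/-- A family of maps `A^{⊗ k} ⊗ M ⊗ A^{⊗ ℓ} → M^*` for `k, ℓ ≥ 0`, of degrees `e - k - ℓ`. A
functional on `M` has degree `d` if it vanishes on all homogeneous elements of degree `≠ -d`. -/
structure PairOps {R : Type*} [CommRing R] (A M : GrModule R) (e : ℤ) where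
  map : ∀ k ℓ : ℕ, MultilinearMap R (fun _ : Fin k => A)
    (M →ₗ[R] MultilinearMap R (fun _ : Fin ℓ => A) (Module.Dual R M))
  map_degree : ∀ (k ℓ : ℕ) (a : Fin k → HElt A) (m : HElt M) (b : Fin ℓ → HElt A) (n : HElt M),
    n.deg ≠ -(e - k - ℓ + (∑ i, (a i).deg + m.deg + ∑ i, (b i).deg)) →
      map k ℓ (fun i => (a i).val) m.val (fun i => (b i).val) n.val = 0

/-- The shifted maps, evaluated at a homogeneous element `n` of `M`. The sign rule is the one of
`BiOps.shifted`, and a shifted functional is evaluated by `m̲^*(n̲) = (-1)^{|m^*|} m^*(n)`, where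
`|m^*| = -|n|` unless `m^*(n) = 0`. -/
def PairOps.shifted {R : Type*} [CommRing R] {A M : GrModule R} {e : ℤ} (I : PairOps A M e)
    (u : List (HElt A)) (m : HElt M) (v : List (HElt A)) (n : HElt M) : R :=
  (shiftExp (u.map HElt.sdeg ++ m.sdeg :: v.map HElt.sdeg) + n.deg).negOnePow •
    I.map u.length v.length (fun i => (u.get i).val) m.val (fun i => (v.get i).val) n.val

/-! ## Algebras, modules and inner products up to homotopy -/

/-- An `A_∞` algebra `(A, μ₁, μ₂, …)` over `R` with `A = ⨁_{d ≥ 0} A_d` and `|μₖ| = 2 - k`. -/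
structure AInfAlgebra (R : Type u) [CommRing R] where
  A : GrModule.{u, v} R
  nonneg : ∀ d < 0, A.gr d = ⊥
  μ : Ops A A 2
  rel : ∀ l : List (HElt A),
    (sumSplit l fun u r => sumSplit r fun v w =>
      (sdegs u).negOnePow • (μ.shifted (u ++ μ.shifted v :: w)).val) = 0

/-- A morphism of `A_∞` algebras: maps `fₖ : A^{⊗ k} → B` of degree `1 - k` with
`f ∘ μ = ν ∘ f`. -/
structure AInfMorphism {R : Type*} [CommRing R] (𝔸 𝔹 : AInfAlgebra R) where
  f : Ops 𝔸.A 𝔹.A 1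
  rel : ∀ l : List (HElt 𝔸.A),
    (sumSplit l fun u r => sumSplit r fun v w =>
      (sdegs u).negOnePow • (f.shifted (u ++ 𝔸.μ.shifted v :: w)).val) =
    sumParts l fun ws => (𝔹.μ.shifted (ws.map f.shifted)).val

/-- For `g` defined on `A̲^{⊗ k} ⊗ M̲ ⊗ A̲^{⊗ ℓ}` (all `k, ℓ`), the composition `g ∘ β` of `g` with
the operator which applies one of the `μ`'s or `β`'s to consecutive arguments in all possible
ways, with Koszul signs. -/
def precomp {R : Type*} [CommRing R] {A M : GrModule R} {G : Type*} [AddCommGroup G]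
    (μ : Ops A A 2) (β : BiOps A M M 1)
    (g : List (HElt A) → HElt M → List (HElt A) → G)
    (u : List (HElt A)) (m : HElt M) (v : List (HElt A)) : G :=
  (sumSplit u fun u₁ r => sumSplit r fun p u₂ =>
    (sdegs u₁).negOnePow • g (u₁ ++ μ.shifted p :: u₂) m v) +
  (sumSplit u fun u₁ u₂ => sumSplit v fun v₁ v₂ =>
    (sdegs u₁).negOnePow • g u₁ (β.shifted u₂ m v₁) v₂) +
  (sumSplit v fun v₁ r => sumSplit r fun p v₂ =>
    (sdegs u + m.sdeg + sdegs v₁).negOnePow • g u m (v₁ ++ μ.shifted p :: v₂))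

/-- An `A_∞` module `M` over an `A_∞` algebra, with structure maps
`β_{k,ℓ} : A^{⊗ k} ⊗ M ⊗ A^{⊗ ℓ} → M` of degree `1 - k - ℓ`. -/
structure AInfModule {R : Type u} [CommRing R] (𝔸 : AInfAlgebra.{u, v} R) where
  M : GrModule.{u, w} R
  β : BiOps 𝔸.A M M 1
  rel : ∀ (u : List (HElt 𝔸.A)) (m : HElt M) (v : List (HElt 𝔸.A)),
    precomp 𝔸.μ β (fun u m v => (β.shifted u m v).val) u m v = 0

/-- A morphism `F : M → N` of `A_∞` modules, of some degree, over a morphism `f` of `A_∞`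
algebras. -/
structure AInfModuleMorphism {R : Type*} [CommRing R] {𝔸 𝔹 : AInfAlgebra R}
    (f : AInfMorphism 𝔸 𝔹) (𝕄 : AInfModule 𝔸) (𝕃 : AInfModule 𝔹) where
  deg : ℤ
  F : BiOps 𝔸.A 𝕄.M 𝕃.M deg
  rel : ∀ (u : List (HElt 𝔸.A)) (m : HElt 𝕄.M) (v : List (HElt 𝔸.A)),
    precomp 𝔸.μ 𝕄.β (fun u m v => (F.shifted u m v).val) u m v =
    deg.negOnePow •
      sumSplit u fun u₁ u₂ => sumSplit v fun v₁ v₂ =>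
        sumParts u₁ fun ws => sumParts v₂ fun zs =>
          (deg * sdegs u₁).negOnePow •
            (𝕃.β.shifted (ws.map f.f.shifted) (F.shifted u₂ m v₁) (zs.map f.f.shifted)).val

namespace AInfModule

/-- The shifted structure maps of the dual module `M^*`, evaluated at `n`:
`β̲'(u, φ, v)(n) = -(-1)^{|u| (|φ| + |v| + |n|) + |φ|} φ(β̲(v, n, u))`, where `d` is the shifted
degree `|φ|` of the functional `φ`. -/
def dualOp {R : Type*} [CommRing R] {𝔸 : AInfAlgebra R} (𝕄 : AInfModule 𝔸)
    (u : List (HElt 𝔸.A)) (d : ℤ) (φ : HElt 𝕄.M → R) (v : List (HElt 𝔸.A)) (n : HElt 𝕄.M) : R :=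
  -((sdegs u * (d + sdegs v + n.sdeg) + d).negOnePow • φ (𝕄.β.shifted v n u))

/-- The differential `δ(G) = G ∘ β - (-1)^{|G|} β' ∘ G` of a family of maps
`G_{k,ℓ} : A^{⊗ k} ⊗ M ⊗ A^{⊗ ℓ} → M^*` of degree `|G| = e`, evaluated at homogeneous elements. -/
def delta {R : Type*} [CommRing R] {𝔸 : AInfAlgebra R} (𝕄 : AInfModule 𝔸) {e : ℤ}
    (G : PairOps 𝔸.A 𝕄.M e)
    (u : List (HElt 𝔸.A)) (m : HElt 𝕄.M) (v : List (HElt 𝔸.A)) (n : HElt 𝕄.M) : R :=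
  precomp 𝔸.μ 𝕄.β (fun u m v => G.shifted u m v n) u m v -
  e.negOnePow •
    sumSplit u fun u₁ u₂ => sumSplit v fun v₁ v₂ =>
      (e * sdegs u₁).negOnePow •
        𝕄.dualOp u₁ (e + sdegs u₂ + m.sdeg + sdegs v₁) (G.shifted u₂ m v₁) v₂ n

end AInfModule

/-- An `A_∞` inner product on `M`: a morphism of `A_∞` modules `I : M → M^*` over the identity
of `A`, i.e. a family of maps with `δ(I) = 0`. -/
structure AInfInnerProduct {R : Type*} [CommRing R] {𝔸 : AInfAlgebra R} (𝕄 : AInfModule 𝔸) where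
  deg : ℤ
  I : PairOps 𝔸.A 𝕄.M deg
  rel : ∀ (u : List (HElt 𝔸.A)) (m : HElt 𝕄.M) (v : List (HElt 𝔸.A)) (n : HElt 𝕄.M),
    𝕄.delta I u m v n = 0

/-- The pulled back inner product `F^♯(J)` on `M`, in shifted form, evaluated at homogeneous
elements. The sign is the Koszul sign for moving `u₀` to the end and for applying
`f ⊗ ⋯ ⊗ f ⊗ F ⊗ f ⊗ ⋯ ⊗ f ⊗ F`. -/
def AInfModuleMorphism.pullback {R : Type*} [CommRing R] {𝔸 𝔹 : AInfAlgebra R}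
    {f : AInfMorphism 𝔸 𝔹} {𝕄 : AInfModule 𝔸} {𝕃 : AInfModule 𝔹}
    (F : AInfModuleMorphism f 𝕄 𝕃) (J : AInfInnerProduct 𝕃)
    (u : List (HElt 𝔸.A)) (m : HElt 𝕄.M) (v : List (HElt 𝔸.A)) (n : HElt 𝕄.M) : R :=
  sumSplit u fun u₀ u' => sumSplit u' fun u₁ u₂ =>
    sumSplit v fun v' v₀ => sumSplit v' fun v₁ v₂ =>
      sumParts u₁ fun ws => sumParts v₂ fun zs =>
        (sdegs u₀ * (sdegs u' + m.sdeg + sdegs v + n.sdeg) +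
          F.deg * sdegs u₁ + F.deg * (sdegs u' + m.sdeg + sdegs v')).negOnePow •
        J.I.shifted (ws.map f.f.shifted) (F.F.shifted u₂ m v₁) (zs.map f.f.shifted)
          (F.F.shifted v₀ n u₀)

/-- An `A_∞` algebra with an `A_∞` module and an `A_∞` inner product on it. -/
structure AInfTriple (R : Type u) [CommRing R] where
  alg : AInfAlgebra.{u, v} R
  mod : AInfModule.{u, v, w} alg
  ip : AInfInnerProduct mod

/-- A morphism `(A, M, I) → (B, N, J)`: a pair `(f, F)` such that `F^♯(J) - I` is exact, i.e.
equal to `δ(G)` for some family of maps `G`. -/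
structure AInfTripleMorphism {R : Type*} [CommRing R] (X Y : AInfTriple R) where
  f : AInfMorphism X.alg Y.alg
  F : AInfModuleMorphism f X.mod Y.mod
  exact : ∃ (e : ℤ) (G : PairOps X.alg.A X.mod.M e), ∀ u m v n,
    F.pullback Y.ip u m v n - X.ip.I.shifted u m v n = X.mod.delta G u m v n

/-- The differential `μ₁` of an `A_∞` algebra. -/
def AInfAlgebra.d {R : Type*} [CommRing R] (𝔸 : AInfAlgebra R) (a : 𝔸.A) : 𝔸.A :=
  𝔸.μ.map 1 ![a]

/-- The differential `β_{0,0}` of an `A_∞` module. -/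
def AInfModule.d {R : Type*} [CommRing R] {𝔸 : AInfAlgebra R} (𝕄 : AInfModule 𝔸) (m : 𝕄.M) :
    𝕄.M :=
  𝕄.β.map 0 0 ![] m ![]

/-- The map `f₁ : A → B`. -/
def AInfTripleMorphism.algMap {R : Type*} [CommRing R] {X Y : AInfTriple R}
    (φ : AInfTripleMorphism X Y) (a : X.alg.A) : Y.alg.A :=
  φ.f.f.map 1 ![a]

/-- The map `F_{0,0} : M → N`. -/
def AInfTripleMorphism.modMap {R : Type*} [CommRing R] {X Y : AInfTriple R}
    (φ : AInfTripleMorphism X Y) (m : X.mod.M) : Y.mod.M :=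
  φ.F.F.map 0 0 ![] m ![]

/-- `ψ ∘ φ` is the identity on `H(A)` and on `H(M)`: every cocycle `x` is cohomologous to its
image. -/
def AInfTripleMorphism.IsLeftQuasiInverse {R : Type*} [CommRing R] {X Y : AInfTriple R}
    (ψ : AInfTripleMorphism Y X) (φ : AInfTripleMorphism X Y) : Prop :=
  (∀ a, X.alg.d a = 0 → ∃ z, ψ.algMap (φ.algMap a) - a = X.alg.d z) ∧
  (∀ m, X.mod.d m = 0 → ∃ z, ψ.modMap (φ.modMap m) - m = X.mod.d z)

namespace AInfTriple

/-- Two triples are equivalent if there are morphisms between them in both directions whose lowest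
components are inverse to each other on cohomology. -/
def Equivalent {R : Type*} [CommRing R] (X Y : AInfTriple R) : Prop :=
  ∃ (φ : AInfTripleMorphism X Y) (ψ : AInfTripleMorphism Y X),
    ψ.IsLeftQuasiInverse φ ∧ φ.IsLeftQuasiInverse ψ

/-- Only `μ₂`, `β_{1,0}`, `β_{0,1}` and `I_{0,0}` may be non-zero. -/
def OnlyBinary {R : Type*} [CommRing R] (X : AInfTriple R) : Prop :=
  (∀ n, n ≠ 2 → X.alg.μ.map n = 0) ∧
  (∀ k ℓ, (k, ℓ) ≠ (1, 0) → (k, ℓ) ≠ (0, 1) → X.mod.β.map k ℓ = 0) ∧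
  (∀ k ℓ, (k, ℓ) ≠ (0, 0) → X.ip.I.map k ℓ = 0)

/-- Formality. The equivalent triple may live in arbitrary universes. -/
def IsFormal {R : Type u} [CommRing R] (X : AInfTriple.{u, v, w} R) : Prop :=
  ∃ Y : AInfTriple.{u, y, z} R, X.Equivalent Y ∧ Y.OnlyBinary

end AInfTriple

/-! ## Defining systems and Massey inner products -/

/-- The entries of a triangular system with one module element on the diagonal, at position `K`:
`a i j` is the entry `x_{i,j}` if `i ≤ j < K` or `K < i ≤ j`, and `m i j` is the entry `x_{i,j}`
if `i ≤ K ≤ j`. Other values are irrelevant. -/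
structure ModSystem {R : Type*} [CommRing R] (A M : GrModule R) where
  a : ℕ → ℕ → HElt A
  m : ℕ → ℕ → HElt M

namespace ModSystem

/-- The entry `x_{i,j} ∈ A` for a non-empty list of consecutive indices `[i, i + 1, …, j]`. -/
def cell {R : Type*} [CommRing R] {A M : GrModule R} (x : ModSystem A M) (w : List ℕ) : HElt A :=
  x.a (w.headD 0) (w.getLastD 0)

/-- The degree condition for a triangular system on the indices `p, …, q` with the module element
at position `K`. -/
def IsTriangular {R : Type*} [CommRing R] {A M : GrModule R} (x : ModSystem A M)
    (p K q : ℕ) : Prop :=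
  (∀ i j, p ≤ i → i ≤ j → j ≤ q → (j < K ∨ K < i) →
    (x.a i j).sdeg = ∑ t ∈ Finset.Icc i j, (x.a t t).sdeg) ∧
  (∀ i j, p ≤ i → i ≤ K → K ≤ j → j ≤ q →
    (x.m i j).sdeg = ∑ t ∈ Finset.Ico i K, (x.a t t).sdeg + (x.m K K).sdeg +
      ∑ t ∈ Finset.Ioc K j, (x.a t t).sdeg)

/-- The staircase product over the indices `i, …, j` when these do not contain `K`. -/
def staircaseA {R : Type*} [CommRing R] {𝔸 : AInfAlgebra R} {𝕄 : AInfModule 𝔸}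
    (x : ModSystem 𝔸.A 𝕄.M) (i j : ℕ) : 𝔸.A :=
  sumParts (List.range' i (j + 1 - i)) fun ws =>
    if 2 ≤ ws.length then (𝔸.μ.shifted (ws.map x.cell)).val else 0

/-- The staircase product over the indices `i, …, j` when these contain `K`. -/
def staircaseM {R : Type*} [CommRing R] {𝔸 : AInfAlgebra R} {𝕄 : AInfModule 𝔸}
    (x : ModSystem 𝔸.A 𝕄.M) (K i j : ℕ) : 𝕄.M :=
  sumSplit (List.range' i (K - i)) fun u₁ u₂ => sumSplit (List.range' (K + 1) (j - K)) fun v₁ v₂ =>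
    sumParts u₁ fun ws => sumParts v₂ fun zs =>
      if 1 ≤ ws.length + zs.length then
        (𝕄.β.shifted (ws.map x.cell) (x.m (K - u₂.length) (K + v₁.length)) (zs.map x.cell)).val
      else 0

/-- `d(x_{i,j})` is minus the staircase product over `i, …, j` for all `p ≤ i ≤ j ≤ q`, including
`(i, j) = (p, q)`. -/
def IsDefining {R : Type*} [CommRing R] {𝔸 : AInfAlgebra R} {𝕄 : AInfModule 𝔸}
    (x : ModSystem 𝔸.A 𝕄.M) (p K q : ℕ) : Prop :=
  (∀ i j, p ≤ i → i ≤ j → j ≤ q → (j < K ∨ K < i) → 𝔸.d (x.a i j).val = -x.staircaseA i j) ∧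
  (∀ i j, p ≤ i → i ≤ K → K ≤ j → j ≤ q → 𝕄.d (x.m i j).val = -x.staircaseM K i j)

end ModSystem

namespace AInfTriple

/-- A cyclic defining system `x, x'` for `(a₁, …, aₖ, m, b₁, …, b_ℓ, n)`. These elements have the
positions `1, …, N = k + ℓ + 2`. The system `x` has the index range `1, …, k + ℓ + 1` with its
module element `m` at `k + 1`. The system `x'` has the index range `k + 2, …, N + k` with its
module element `n` at `N`, where the index `N + i` stands for the position `i` in cyclic order. -/
structure IsCyclicDefiningSystem {R : Type*} [CommRing R] (X : AInfTriple R) {k ℓ : ℕ}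
    (a : Fin k → HElt X.alg.A) (m : HElt X.mod.M) (b : Fin ℓ → HElt X.alg.A) (n : HElt X.mod.M)
    (x x' : ModSystem X.alg.A X.mod.M) : Prop where
  diag_a : ∀ i : Fin k, x.a (i + 1) (i + 1) = a i
  diag_m : x.m (k + 1) (k + 1) = m
  diag_b : ∀ i : Fin ℓ, x.a (k + 2 + i) (k + 2 + i) = b i
  diag_n : x'.m (k + ℓ + 2) (k + ℓ + 2) = n
  overlap_a : ∀ i j, 1 ≤ i → i ≤ j → j ≤ k → x'.a (k + ℓ + 2 + i) (k + ℓ + 2 + j) = x.a i j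
  overlap_b : ∀ i j, k + 2 ≤ i → i ≤ j → j ≤ k + ℓ + 1 → x'.a i j = x.a i j
  triangular : x.IsTriangular 1 (k + 1) (k + ℓ + 1)
  triangular' : x'.IsTriangular (k + 2) (k + ℓ + 2) (k + ℓ + 2 + k)
  defining : x.IsDefining 1 (k + 1) (k + ℓ + 1)
  defining' : x'.IsDefining (k + 2) (k + ℓ + 2) (k + ℓ + 2 + k)

/-- The staircase inner product: the sum over all cyclic staircases. Here `u₀` and `v₀` are the
positions to the right and to the left of `N` which are covered by the entry of `x'`, and `u₂` and
`v₁` are those to the left and to the right of `k + 1` which are covered by the module entry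
of `x`. -/
def staircaseInner {R : Type*} [CommRing R] (X : AInfTriple R) (k ℓ : ℕ)
    (x x' : ModSystem X.alg.A X.mod.M) : R :=
  sumSplit (List.range' 1 k) fun u₀ u' => sumSplit u' fun u₁ u₂ =>
    sumSplit (List.range' (k + 2) ℓ) fun v' v₀ => sumSplit v' fun v₁ v₂ =>
      sumParts u₁ fun ws => sumParts v₂ fun zs =>
        ((u₀.map fun t => (x.a t t).sdeg).sum *
          ((u'.map fun t => (x.a t t).sdeg).sum + (x.m (k + 1) (k + 1)).sdeg +
            (∑ t ∈ Finset.Icc (k + 2) (k + ℓ + 1), (x.a t t).sdeg) +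
            (x'.m (k + ℓ + 2) (k + ℓ + 2)).sdeg)).negOnePow •
        X.ip.I.shifted (ws.map x.cell) (x.m (k + 1 - u₂.length) (k + 1 + v₁.length))
          (zs.map x.cell) (x'.m (k + ℓ + 2 - v₀.length) (k + ℓ + 2 + u₀.length))

/-- The `(k, ℓ)`-th Massey inner product set of `(a₁, …, aₖ, m, b₁, …, b_ℓ, n)`. -/
def masseyInner {R : Type*} [CommRing R] (X : AInfTriple R) {k ℓ : ℕ}
    (a : Fin k → HElt X.alg.A) (m : HElt X.mod.M) (b : Fin ℓ → HElt X.alg.A)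
    (n : HElt X.mod.M) : Set R :=
  {r | ∃ x x', X.IsCyclicDefiningSystem a m b n x x' ∧ X.staircaseInner k ℓ x x' = r}

end AInfTriple

/-- A Massey inner product set is trivial if it is empty or contains `0`. -/
def IsTrivialMassey {R : Type*} [CommRing R] (S : Set R) : Prop := S = ∅ ∨ (0 : R) ∈ S

/-! ## Sums over decompositions of lists -/

section Decompositions

variable {α β G H : Type*} [AddCommMonoid G] [AddCommMonoid H]

/-! The idea is to transport only the diagonal of a cyclic defining system to the binary model,
where a defining system with zero staircase inner product is available for free, to push that system
back, and to repair its diagonal without changing the inner product.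

Let `Y` be the binary triple, with morphisms `φ : X → Y` and `ψ : Y → X`. If the Massey set is
non-empty, some defining system exists. Its diagonal entries are cocycles, and its entries of length
two make the product of any two neighbours exact. The differentials of `Y` vanish, so the images of
the diagonal under the lowest components of `φ` have neighbouring products which are zero, not just
exact (`AInfMorphism.product_eq_zero` and its two module analogues). All higher operations of `Y`
vanish as well, so every operation on a block of these images is zero
(`AInfTriple.OnlyBinary.product_eq_zero`, `AInfTriple.OnlyBinary.action_eq_zero`).

Now use the values of the components of `ψ` on blocks of such letters as entries. The morphism
equations say that this is a cyclic defining system in `X` (`CyclicCells.ofMorphism`). Its staircase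
inner product is, up to a global sign, the pulled back inner product on the letters. That differs
from the inner product of `Y` by some `δ(G)`. The latter vanishes since each of its terms contains a
zero product, and the former since `k + ℓ ≥ 1` while only `I_{0,0}` survives
(`CyclicCells.inner_ofMorphism`).

The new diagonal is only cohomologous to the given one. It is corrected one letter `i` at a time by
gauge moves. Call the sum of all operations over all cuts of a block its curvature; a defining
system is a family of cells with zero curvature. Take cells `a'` which agree with the old ones away
from `i`, have a primitive `z` at `i`, and vanish on larger blocks through `i`. Adding the signed
curvature of `a'` to the old cells changes the diagonal at `i` by `d z`. As `i` occurs once,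
everything is affine in the cells through `i`, and a staircase sum of `h` changes exactly by the sum
of `h ∘ (bar differential)` over the cells `a'` (`sumParts_gauge`, `stairM_gauge`, `stairI_gauge`).
For `h = μ, β, I` this is zero by the defining relations, so flatness and the inner product persist
(`CyclicCells.exists_gauge`). -/

theorem sumSplit_nil (g : List α → List α → G) : sumSplit [] g = g [] [] := by
  simp [sumSplit]

theorem sumSplit_cons (a : α) (l : List α) (g : List α → List α → G) :
    sumSplit (a :: l) g = g [] (a :: l) + sumSplit l fun u v => g (a :: u) v := by
  simp only [sumSplit, List.length_cons]
  rw [Finset.sum_range_succ']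
  simp [add_comm]

theorem sumSplit_congr {l : List α} {g g' : List α → List α → G}
    (h : ∀ u v, u ++ v = l → g u v = g' u v) : sumSplit l g = sumSplit l g' :=
  Finset.sum_congr rfl fun i _ => h _ _ (List.take_append_drop i l)

theorem sumSplit_zero (l : List α) : (sumSplit l fun _ _ => (0 : G)) = 0 := by
  simp [sumSplit]

theorem sumSplit_eq_zero {l : List α} {g : List α → List α → G}
    (h : ∀ u v, u ++ v = l → g u v = 0) : sumSplit l g = 0 :=
  (sumSplit_congr h).trans (sumSplit_zero l)

theorem sumSplit_add (l : List α) (g g' : List α → List α → G) :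
    (sumSplit l fun u v => g u v + g' u v) = sumSplit l g + sumSplit l g' :=
  Finset.sum_add_distrib

theorem map_sumSplit (L : G →+ H) (l : List α) (g : List α → List α → G) :
    L (sumSplit l g) = sumSplit l fun u v => L (g u v) :=
  map_sum L _ _

theorem sumSplit_map (f : α → β) (l : List α) (g : List β → List β → G) :
    sumSplit (l.map f) g = sumSplit l fun u v => g (u.map f) (v.map f) := by
  simp [sumSplit, List.map_take, List.map_drop]

/-- Both sides run over the cuts of `l` into three pieces, by choosing the later or the earlier cut
first. -/
theorem sumSplit_assoc (l : List α) (g : List α → List α → List α → G) :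
    (sumSplit l fun p r => sumSplit p fun u v => g u v r) =
      sumSplit l fun u r => sumSplit r fun v w => g u v w := by
  induction l generalizing g with
  | nil => simp [sumSplit_nil]
  | cons a l ih =>
    simp only [sumSplit_cons, sumSplit_nil, sumSplit_add]
    rw [ih fun u v w => g (a :: u) v w, add_assoc]

theorem sumSplit_comm (l : List α) (l' : List β) (g : List α → List α → List β → List β → G) :
    (sumSplit l fun u v => sumSplit l' fun u' v' => g u v u' v') =
      sumSplit l' fun u' v' => sumSplit l fun u v => g u v u' v' :=
  Finset.sum_comm

theorem sumSplit_left_nil (l : List α) (g : List α → List α → G)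
    (h : ∀ u v, u ≠ [] → g u v = 0) : sumSplit l g = g [] l := by
  cases l with
  | nil => exact sumSplit_nil g
  | cons a l =>
    rw [sumSplit_cons, sumSplit_eq_zero fun u v _ => h _ _ (by simp), add_zero]

theorem sumSplit_right_nil (l : List α) (g : List α → List α → G)
    (h : ∀ u v, v ≠ [] → g u v = 0) : sumSplit l g = g l [] := by
  induction l generalizing g with
  | nil => exact sumSplit_nil g
  | cons a l ih =>
    rw [sumSplit_cons, h _ _ (by simp), zero_add, ih _ fun u v => h _ _]

theorem sumParts_nil (g : List (List α) → G) : sumParts [] g = g [] := by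
  simp [sumParts, parts]

/-- The recursion behind `parts` only ever produces non-empty blocks which concatenate to `l`, so
summands may be rewritten under these two assumptions. -/
theorem sumParts_congr {l : List α} {g g' : List (List α) → G}
    (h : ∀ ws, ws.flatten = l → (∀ w ∈ ws, w ≠ []) → g ws = g' ws) :
    sumParts l g = sumParts l g' := by
  have key : ∀ l : List α, ∀ ws ∈ parts l, ws.flatten = l ∧ ∀ w ∈ ws, w ≠ [] := by
    intro l
    induction l with
    | nil => simp [parts]
    | cons a l ih =>
      intro ws hws
      simp only [parts, List.mem_flatMap] at hws
      obtain ⟨vs, hvs, h⟩ := hws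
      obtain ⟨h1, h2⟩ := ih vs hvs
      cases vs with
      | nil => simp at h h1; subst h; subst h1; simp
      | cons v vs =>
        simp only [List.mem_cons, List.not_mem_nil, or_false] at h
        rcases h with rfl | rfl
        · refine ⟨by simpa using h1, ?_⟩
          intro w hw
          rcases List.mem_cons.1 hw with rfl | hw
          · simp
          · exact h2 w hw
        · refine ⟨by simpa using h1, ?_⟩
          intro w hw
          rcases List.mem_cons.1 hw with rfl | hw
          · simp
          · exact h2 w (List.mem_cons_of_mem _ hw)
  unfold sumParts
  congr 1
  exact List.map_congr_left fun ws hws => h ws (key l ws hws).1 (key l ws hws).2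

theorem sumParts_zero (l : List α) : (sumParts l fun _ => (0 : G)) = 0 := by
  simp [sumParts]

theorem sumParts_eq_zero {l : List α} {g : List (List α) → G}
    (h : ∀ ws, ws.flatten = l → (∀ w ∈ ws, w ≠ []) → g ws = 0) : sumParts l g = 0 :=
  (sumParts_congr h).trans (sumParts_zero l)

theorem sumParts_add (l : List α) (g g' : List (List α) → G) :
    (sumParts l fun ws => g ws + g' ws) = sumParts l g + sumParts l g' :=
  List.sum_map_add

theorem map_sumParts (L : G →+ H) (l : List α) (g : List (List α) → G) :
    L (sumParts l g) = sumParts l fun ws => L (g ws) := by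
  simp [sumParts, map_list_sum, Function.comp_def]

theorem sumParts_comm (l : List α) (l' : List β) (g : List (List α) → List (List β) → G) :
    (sumParts l fun ws => sumParts l' fun zs => g ws zs) =
      sumParts l' fun zs => sumParts l fun ws => g ws zs := by
  unfold sumParts
  induction parts l with
  | nil => simp
  | cons a t ih => simp [ih, List.sum_map_add]

theorem sumParts_sumSplit_comm (l : List α) (l' : List β)
    (g : List (List α) → List β → List β → G) :
    (sumParts l fun ws => sumSplit l' fun u v => g ws u v) =
      sumSplit l' fun u v => sumParts l fun ws => g ws u v := by
  unfold sumParts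
  induction parts l with
  | nil => simp [sumSplit_zero]
  | cons a t ih => simp [ih, sumSplit_add]

theorem parts_map (f : α → β) (l : List α) :
    parts (l.map f) = (parts l).map (List.map (List.map f)) := by
  induction l with
  | nil => simp [parts]
  | cons a l ih =>
    simp only [List.map_cons, parts, ih, List.flatMap_map, List.map_flatMap]
    congr 1
    funext ws
    cases ws <;> simp

theorem sumParts_map (f : α → β) (l : List α) (g : List (List β) → G) :
    sumParts (l.map f) g = sumParts l fun ws => g (ws.map (List.map f)) := by
  simp [sumParts, parts_map, Function.comp_def]

/-- A cut is determined by its first block and a cut of the rest. The definition of `parts` instead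
decides whether `a` joins the next block, so the recursion is translated by induction on `l`. -/
theorem sumParts_cons (a : α) (l : List α) (g : List (List α) → G) :
    sumParts (a :: l) g = sumSplit l fun u v => sumParts v fun ws => g ((a :: u) :: ws) := by
  have step : ∀ (a : α) (l : List α) (g : List (List α) → G), sumParts (a :: l) g =
      sumParts l fun ws => match ws with
        | [] => g [[a]]
        | w :: ws => g ([a] :: w :: ws) + g ((a :: w) :: ws) := by
    intro a l g
    simp only [sumParts, parts, List.map_flatMap]
    induction parts l with
    | nil => simp
    | cons t ts ih => cases t <;> simp [ih, add_assoc]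
  induction l generalizing a g with
  | nil => rw [step, sumSplit_nil, sumParts_nil, sumParts_nil]
  | cons b l ih =>
    rw [step, ih, sumSplit_cons, ih]
    simp only [sumParts_add, sumSplit_add]

/-- Splitting a sequence of blocks in two is the same as splitting the word first and cutting both
halves. This is what lets a composition of operations be read as an operation on one subword. -/
theorem sumParts_sumSplit (l : List α) (g : List (List α) → List (List α) → G) :
    (sumParts l fun ws => sumSplit ws g) =
      sumSplit l fun u v => sumParts u fun us => sumParts v fun vs => g us vs := by
  induction hn : l.length using Nat.strong_induction_on generalizing l g with
  | _ n ih =>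
    cases l with
    | nil => simp [sumParts_nil, sumSplit_nil]
    | cons a l =>
      simp only [sumParts_cons, sumSplit_cons, sumSplit_add, sumParts_add, sumParts_nil]
      congr 1
      rw [sumSplit_assoc l fun u v w => sumParts v fun us => sumParts w fun vs =>
        g ((a :: u) :: us) vs]
      refine sumSplit_congr fun u v huv => ?_
      refine ih v.length ?_ v _ rfl
      subst huv
      simp at hn
      omega

/-- The value of `q` at the head and the tail of a list, and `0` for the empty list. -/
def headSum (q : α → List α → G) : List α → G
  | [] => 0
  | a :: l => q a l

/-- Used to single out the one block of a cut which contains a distinguished letter. The empty block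
never occurs on the left, which is why its contribution on the right has to be assumed zero. -/
theorem sumParts_headSum (l : List α) (g : List α → List (List α) → G)
    (h : ∀ ws, g [] ws = 0) :
    sumParts l (headSum g) = sumSplit l fun u v => sumParts v fun ws => g u ws := by
  cases l with
  | nil => simp [sumParts_nil, sumSplit_nil, h, headSum]
  | cons a l =>
    rw [sumParts_cons, sumSplit_cons, sumParts_eq_zero fun ws _ _ => h ws, zero_add]
    rfl

/-- Separates the differential of the whole block from the products of at least two blocks. -/
theorem sumParts_single_add (l : List α) (hl : l ≠ []) (g : List (List α) → G) :
    sumParts l g = g [l] + sumParts l fun ws => if 2 ≤ ws.length then g ws else 0 := by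
  obtain ⟨a, l, rfl⟩ := List.exists_cons_of_ne_nil hl
  have hsplit : ∀ ws : List (List α), g ws =
      (if ws.length < 2 then g ws else 0) + (if 2 ≤ ws.length then g ws else 0) := by
    intro ws
    rcases lt_or_ge ws.length 2 with h | h
    · rw [if_pos h, if_neg (not_le.2 h), add_zero]
    · rw [if_neg (not_lt.2 h), if_pos h, zero_add]
  conv_lhs => rw [show g = fun ws => (if ws.length < 2 then g ws else 0) +
    (if 2 ≤ ws.length then g ws else 0) from funext hsplit]
  rw [sumParts_add]
  congr 1
  rw [sumParts_cons, sumSplit_right_nil]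
  · simp [sumParts_nil]
  · intro u v hv
    refine sumParts_eq_zero fun ws hws _ => if_neg ?_
    rintro h
    simp only [List.length_cons] at h
    have : ws = [] := List.length_eq_zero_iff.1 (by omega)
    exact hv (by simpa [this] using hws.symm)

theorem sumSplit_smul {S : Type*} [DistribSMul S G] (c : S) (l : List α)
    (g : List α → List α → G) :
    c • sumSplit l g = sumSplit l fun u v => c • g u v :=
  map_sumSplit (DistribSMul.toAddMonoidHom G c) l g

theorem sumParts_smul {S : Type*} [DistribSMul S G] (c : S) (l : List α)
    (g : List (List α) → G) :
    c • sumParts l g = sumParts l fun ws => c • g ws :=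
  map_sumParts (DistribSMul.toAddMonoidHom G c) l g

end Decompositions

section

variable {α G : Type*} [AddCommGroup G]

theorem sumSplit_neg (l : List α) (g : List α → List α → G) :
    (sumSplit l fun u v => -g u v) = -sumSplit l g :=
  Finset.sum_neg_distrib _

theorem sumSplit_mem {R : Type*} [Ring R] [Module R G] (S : Submodule R G) (l : List α)
    (g : List α → List α → G) (h : ∀ u v, u ++ v = l → g u v ∈ S) : sumSplit l g ∈ S :=
  S.sum_mem fun i _ => h _ _ (List.take_append_drop i l)

theorem sumParts_mem {R : Type*} [Ring R] [Module R G] (S : Submodule R G) (l : List α)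
    (g : List (List α) → G) (h : ∀ ws, ws.flatten = l → g ws ∈ S) : sumParts l g ∈ S := by
  classical
  -- With this test built in, every listed summand lies in `S`, without having to know that it comes
  -- from a cut of `l`.
  have : sumParts l g = sumParts l fun ws => if g ws ∈ S then g ws else 0 :=
    sumParts_congr fun ws hws _ => (if_pos (h ws hws)).symm
  rw [this]
  refine S.toAddSubmonoid.list_sum_mem fun x hx => ?_
  obtain ⟨ws, _, rfl⟩ := List.mem_map.1 hx
  split_ifs with hm
  · exact hm
  · exact S.zero_mem

end

/-! ## Additivity of shifted maps -/

section Additivity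

variable {R : Type*} [CommRing R] {A M N X Y : GrModule R}

/-- A function of a homogeneous element which is additive on the elements of each degree. -/
def HAdditive {G : Type*} [AddCommGroup G] (g : HElt X → G) : Prop :=
  ∀ d, ∃ L : X →+ G, ∀ x : HElt X, x.deg = d → g x = L x.val

namespace HAdditive

variable {G H : Type*} [AddCommGroup G] [AddCommGroup H] {g : HElt X → G}

theorem eq_zero (hg : HAdditive g) {x : HElt X} (hx : x.val = 0) : g x = 0 := by
  obtain ⟨L, hL⟩ := hg x.deg
  rw [hL x rfl, hx, map_zero]

theorem add_smul (hg : HAdditive g) {x y z : HElt X} (hy : y.deg = x.deg) (hz : z.deg = x.deg)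
    (ε : ℤˣ) (h : z.val = x.val + ε • y.val) : g z = g x + ε • g y := by
  obtain ⟨L, hL⟩ := hg x.deg
  rw [hL x rfl, hL y hy, hL z hz, h, map_add]
  congr 1
  exact map_zsmul L _ _

theorem smul_val (hg : HAdditive g) {x y : HElt X} (hy : y.deg = x.deg) (ε : ℤˣ)
    (h : y.val = ε • x.val) : g y = ε • g x := by
  obtain ⟨L, hL⟩ := hg x.deg
  rw [hL x rfl, hL y hy, h]
  exact map_zsmul L _ _

/-- The sign in a shifted map depends on the degree of its argument, so a sum can be moved inside
only when all summands have the same degree. -/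
theorem sumParts {α : Type*} (hg : HAdditive g) (l : List α) (f : List (List α) → HElt X)
    (x : HElt X) (hd : ∀ ws, ws.flatten = l → (f ws).deg = x.deg)
    (hx : x.val = sumParts l fun ws => (f ws).val) : (_root_.sumParts l fun ws => g (f ws)) = g x := by
  obtain ⟨L, hL⟩ := hg x.deg
  rw [hL x rfl, hx, map_sumParts]
  exact sumParts_congr fun ws hws _ => hL _ (hd ws hws)

theorem comp (hg : HAdditive g) (L : G →+ H) : HAdditive fun x => L (g x) := fun d => by
  obtain ⟨K, hK⟩ := hg d
  exact ⟨L.comp K, fun x hx => by simp [hK x hx]⟩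

end HAdditive

/-- Multilinearity in one slot, in a form where the arity is the length of a list containing the
argument. A placeholder in that slot fixes the arity independently of `y`. -/
theorem exists_linear_slot {Z : Type*} [AddCommGroup Z] [Module R Z]
    (φ : ∀ n : ℕ, MultilinearMap R (fun _ : Fin n => X) Z) (us ws : List (HElt X)) :
    ∃ L : X →ₗ[R] Z, ∀ y : HElt X,
      φ (us ++ y :: ws).length (fun i => ((us ++ y :: ws).get i).val) = L y.val := by
  have cast : ∀ (l : List (HElt X)) (n : ℕ) (h : l.length = n),
      φ l.length (fun i => (l.get i).val) = φ n fun i => (l.get (i.cast h.symm)).val := by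
    rintro l _ rfl
    rfl
  let o : HElt X := ⟨0, 0, zero_mem _⟩
  let j : Fin (us ++ o :: ws).length := ⟨us.length, by simp⟩
  refine ⟨(φ (us ++ o :: ws).length).toLinearMap (fun i => ((us ++ o :: ws).get i).val) j,
    fun y => ?_⟩
  rw [cast (us ++ y :: ws) (us ++ o :: ws).length (by simp), MultilinearMap.toLinearMap_apply]
  congr 1
  funext i
  by_cases hi : i = j
  · subst hi
    simp [j]
  · rw [Function.update_of_ne hi]
    have hi' : (i : ℕ) ≠ us.length := fun h => hi (Fin.ext h)
    simp only [List.get_eq_getElem, Fin.val_cast, List.getElem_append]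
    split_ifs with h
    · rfl
    · have : ∃ p, (i : ℕ) - us.length = p + 1 := ⟨(i : ℕ) - us.length - 1, by omega⟩
      obtain ⟨p, hp⟩ := this
      simp [hp]

theorem HAdditive.of_linear {Z : Type*} [AddCommGroup Z] [Module R Z] {g : HElt X → Z}
    (L : X →ₗ[R] Z) (ε : ℤ → ℤ) (h : ∀ y, g y = (ε y.deg).negOnePow • L y.val) : HAdditive g := by
  intro d
  refine ⟨((ε d).negOnePow : ℤ) • L.toAddMonoidHom, ?_⟩
  rintro y rfl
  rw [h]
  rfl

theorem Ops.hAdditive {e : ℤ} (φ : Ops X Y e) (us ws : List (HElt X)) :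
    HAdditive fun y => (φ.shifted (us ++ y :: ws)).val := by
  obtain ⟨L, hL⟩ := exists_linear_slot φ.map us ws
  refine .of_linear L (fun d => shiftExp (us.map HElt.sdeg ++ (d - 1) :: ws.map HElt.sdeg))
    fun y => ?_
  simp only [Ops.shifted, hL, List.map_append, List.map_cons]
  rfl

/-- A function of `A^{⊗ k} ⊗ M ⊗ A^{⊗ ℓ}` which is additive in each argument. -/
structure TriAdditive {G : Type*} [AddCommGroup G]
    (g : List (HElt A) → HElt M → List (HElt A) → G) : Prop where
  left : ∀ us ws m v, HAdditive fun y => g (us ++ y :: ws) m v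
  mid : ∀ u v, HAdditive fun m => g u m v
  right : ∀ u m us ws, HAdditive fun y => g u m (us ++ y :: ws)

/-- Function-valued families on lists, with the signs of the shifted maps. -/
theorem TriAdditive.of_map {Z : Type*} [AddCommGroup Z] [Module R Z]
    (φ : ∀ k ℓ : ℕ, MultilinearMap R (fun _ : Fin k => A)
      (M →ₗ[R] MultilinearMap R (fun _ : Fin ℓ => A) Z))
    (g : List (HElt A) → HElt M → List (HElt A) → Z) (c : ℤ)
    (hg : ∀ u m v, g u m v =
      (shiftExp (u.map HElt.sdeg ++ m.sdeg :: v.map HElt.sdeg) + c).negOnePow •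
        φ u.length v.length (fun i => (u.get i).val) m.val (fun i => (v.get i).val)) :
    TriAdditive g where
  left us ws m v := by
    obtain ⟨L, hL⟩ := exists_linear_slot (fun n => φ n v.length) us ws
    refine .of_linear
      { toFun := fun y => L y m.val fun i => (v.get i).val
        map_add' := fun y z => by simp
        map_smul' := fun c y => by simp }
      (fun d => shiftExp ((us.map HElt.sdeg ++ (d - 1) :: ws.map HElt.sdeg) ++
        m.sdeg :: v.map HElt.sdeg) + c) fun y => ?_
    rw [hg, hL]
    simp [HElt.sdeg]
  mid u v := by
    refine .of_linear
      { toFun := fun y => φ u.length v.length (fun i => (u.get i).val) y fun i => (v.get i).val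
        map_add' := fun y z => by simp
        map_smul' := fun c y => by simp }
      (fun d => shiftExp (u.map HElt.sdeg ++ (d - 1) :: v.map HElt.sdeg) + c) fun y => ?_
    rw [hg]
    simp [HElt.sdeg]
  right u m us ws := by
    obtain ⟨L, hL⟩ := exists_linear_slot (fun n => φ u.length n (fun i => (u.get i).val) m.val) us ws
    refine .of_linear L (fun d => shiftExp (u.map HElt.sdeg ++
        m.sdeg :: (us.map HElt.sdeg ++ (d - 1) :: ws.map HElt.sdeg)) + c) fun y => ?_
    rw [hg, hL]
    simp [HElt.sdeg]

theorem BiOps.triAdditive {e : ℤ} (Φ : BiOps A M N e) :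
    TriAdditive fun u m v => (Φ.shifted u m v).val :=
  .of_map Φ.map _ 0 fun u m v => by simp [BiOps.shifted]

theorem TriAdditive.comp {G H : Type*} [AddCommGroup G] [AddCommGroup H]
    {g : List (HElt A) → HElt M → List (HElt A) → G} (hg : TriAdditive g) (L : G →+ H) :
    TriAdditive fun u m v => L (g u m v) where
  left us ws m v := (hg.left us ws m v).comp L
  mid u v := (hg.mid u v).comp L
  right u m us ws := (hg.right u m us ws).comp L

theorem PairOps.triAdditive {e : ℤ} (I : PairOps A M e) (n : HElt M) :
    TriAdditive fun u m v => I.shifted u m v n := by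
  let g : List (HElt A) → HElt M → List (HElt A) → Module.Dual R M := fun u m v =>
    (shiftExp (u.map HElt.sdeg ++ m.sdeg :: v.map HElt.sdeg) + n.deg).negOnePow •
      I.map u.length v.length (fun i => (u.get i).val) m.val (fun i => (v.get i).val)
  exact (TriAdditive.of_map I.map g n.deg fun _ _ _ => rfl).comp
    (LinearMap.applyₗ n.val).toAddMonoidHom

theorem PairOps.hAdditive {e : ℤ} (I : PairOps A M e) (u : List (HElt A)) (m : HElt M)
    (v : List (HElt A)) : HAdditive fun n => I.shifted u m v n :=
  .of_linear (I.map u.length v.length (fun i => (u.get i).val) m.val (fun i => (v.get i).val))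
    (fun d => shiftExp (u.map HElt.sdeg ++ m.sdeg :: v.map HElt.sdeg) + d) fun _ => rfl

end Additivity

/-! ## Systems of cells and their curvature -/

/-- The total weight of a list of letters. -/
def wt {α : Type*} (s : α → ℤ) (l : List α) : ℤ := (l.map s).sum

section Weights

variable {α : Type*} (s : α → ℤ)

@[simp] theorem wt_nil : wt s [] = 0 := rfl

@[simp] theorem wt_cons (a : α) (l : List α) : wt s (a :: l) = s a + wt s l := by simp [wt]

@[simp] theorem wt_append (l l' : List α) : wt s (l ++ l') = wt s l + wt s l' := by simp [wt]

/-- The weight with the letter `i` lowered by one. -/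
def lower [DecidableEq α] (i : α) : α → ℤ := Function.update s i (s i - 1)

theorem wt_lower [DecidableEq α] (i : α) (l : List α) :
    wt (lower s i) l = wt s l - l.count i := by
  induction l with
  | nil => simp
  | cons a l ih =>
    rw [wt_cons, wt_cons, ih, List.count_cons, lower, Function.update_apply]
    by_cases h : a = i
    · subst h
      simp
      ring
    · simp [h]
      ring

/-- The weight of the letters which precede `i`. -/
def wtBefore [DecidableEq α] (i : α) (l : List α) : ℤ := wt s (l.takeWhile (· ≠ i))

theorem wtBefore_append_right [DecidableEq α] {i : α} {l : List α} (h : i ∉ l) (l' : List α) :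
    wtBefore s i (l ++ l') = wt s l + wtBefore s i l' := by
  unfold wtBefore
  rw [List.takeWhile_append_of_pos, wt_append]
  intro a ha
  simpa using fun hai : a = i => h (hai ▸ ha)

theorem wtBefore_append_left [DecidableEq α] {i : α} {l : List α} (h : i ∈ l) (l' : List α) :
    wtBefore s i (l ++ l') = wtBefore s i l := by
  obtain ⟨p, q, rfl, hp⟩ := List.eq_append_cons_of_mem h
  rw [List.append_assoc, wtBefore_append_right s hp, wtBefore_append_right s hp]
  simp [wtBefore]

end Weights

section Cells

variable {R : Type*} [CommRing R] {A M : GrModule R} {α : Type*} {G : Type*} [AddCommGroup G]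

/-- Elements of `A` indexed by blocks of letters, with shifted degrees given by the weights. -/
structure ACells (A : GrModule R) (s : α → ℤ) where
  cell : List α → HElt A
  sdeg_cell : ∀ w, (cell w).sdeg = wt s w

/-- Elements of `M` indexed by blocks `u ++ K :: v` of letters around the letter `K`, with shifted
degrees given by the weights. -/
structure MCells (M : GrModule R) (s : α → ℤ) (K : α) where
  cell : List α → List α → HElt M
  sdeg_cell : ∀ u v, (cell u v).sdeg = wt s u + s K + wt s v

variable {s : α → ℤ} {K : α}

theorem ACells.sdegs_map (a : ACells A s) (ws : List (List α)) :
    sdegs (ws.map a.cell) = wt s ws.flatten := by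
  induction ws with
  | nil => rfl
  | cons w ws ih =>
    rw [List.map_cons, List.flatten_cons, wt_append, ← ih, ← a.sdeg_cell]
    simp [sdegs]

/-- The sum of all products over a block which does not contain the module letter. -/
def curvA (μ : Ops A A 2) (a : ACells A s) (l : List α) : HElt A where
  deg := 2 + wt s l
  val := sumParts l fun ws => (μ.shifted (ws.map a.cell)).val
  mem := sumParts_mem _ _ _ fun ws hws => by
    have h := (μ.shifted (ws.map a.cell)).mem
    rwa [show (μ.shifted (ws.map a.cell)).deg = 2 + wt s l by
      simp [Ops.shifted, a.sdegs_map, hws]] at h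

/-- The sum of `g` over all ways to cut the block `u ++ K :: v` into smaller blocks. -/
def stairM (a : ACells A s) (m : MCells M s K) (g : List (HElt A) → HElt M → List (HElt A) → G)
    (u v : List α) : G :=
  sumSplit u fun u₁ u₂ => sumSplit v fun v₁ v₂ => sumParts u₁ fun ws => sumParts v₂ fun zs =>
    g (ws.map a.cell) (m.cell u₂ v₁) (zs.map a.cell)

/-- The sum of all products over a block which contains the module letter. -/
def curvM (β : BiOps A M M 1) (a : ACells A s) (m : MCells M s K) (u v : List α) : HElt M where
  deg := 2 + wt s u + s K + wt s v
  val := stairM a m (fun u m v => (β.shifted u m v).val) u v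
  mem := sumSplit_mem _ _ _ fun u₁ u₂ hu => sumSplit_mem _ _ _ fun v₁ v₂ hv =>
    sumParts_mem _ _ _ fun ws hws => sumParts_mem _ _ _ fun zs hzs => by
      have h := (β.shifted (ws.map a.cell) (m.cell u₂ v₁) (zs.map a.cell)).mem
      have hm := m.sdeg_cell u₂ v₁
      rw [HElt.sdeg] at hm
      rwa [show (β.shifted (ws.map a.cell) (m.cell u₂ v₁) (zs.map a.cell)).deg =
        2 + wt s u + s K + wt s v by
          simp [BiOps.shifted, a.sdegs_map, hws, hzs, ← hu, ← hv]
          linarith] at h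

/-- The composition of `h` with the operator which applies `μ` to consecutive arguments. -/
def barA (μ : Ops A A 2) (h : List (HElt A) → G) (l : List (HElt A)) : G :=
  sumSplit l fun u r => sumSplit r fun v w => (sdegs u).negOnePow • h (u ++ μ.shifted v :: w)

/-- Cutting `l` and then multiplying some consecutive blocks amounts to choosing the subword `l₂`
they cover, cutting the two sides, and summing over the cuts of `l₂`. By additivity the last sum
puts the curvature of `l₂` into the slot. -/
theorem sumParts_barA (μ : Ops A A 2) (a : ACells A s) {h : List (HElt A) → G}
    (hh : ∀ us ws, HAdditive fun y => h (us ++ y :: ws)) (l : List α) :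
    (sumParts l fun ws => barA μ h (ws.map a.cell)) =
      sumSplit l fun l₁ r => sumSplit r fun l₂ l₃ => sumParts l₁ fun us => sumParts l₃ fun ws =>
        (wt s l₁).negOnePow • h (us.map a.cell ++ curvA μ a l₂ :: ws.map a.cell) := by
  simp only [barA, sumSplit_map]
  rw [sumParts_sumSplit l fun us r => sumSplit r fun vs ws =>
    (sdegs (us.map a.cell)).negOnePow •
      h (us.map a.cell ++ μ.shifted (vs.map a.cell) :: ws.map a.cell)]
  refine sumSplit_congr fun l₁ r _ => ?_
  rw [← sumParts_sumSplit_comm]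
  refine sumParts_congr fun us hus _ => ?_
  rw [sumParts_sumSplit]
  refine sumSplit_congr fun l₂ l₃ _ => ?_
  rw [sumParts_comm]
  refine sumParts_congr fun ws _ _ => ?_
  rw [a.sdegs_map, hus, ← sumParts_smul]
  congr 1
  refine (hh (us.map a.cell) (ws.map a.cell)).sumParts l₂ (fun vs => μ.shifted (vs.map a.cell))
    (curvA μ a l₂) (fun vs hvs => ?_) rfl
  simp [Ops.shifted, curvA, a.sdegs_map, hvs]

theorem ACells.deg_cell (a : ACells A s) (w : List α) : (a.cell w).deg = wt s w + 1 := by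
  have := a.sdeg_cell w
  rw [HElt.sdeg] at this
  linarith

theorem MCells.deg_cell (m : MCells M s K) (u v : List α) :
    (m.cell u v).deg = wt s u + s K + wt s v + 1 := by
  have := m.sdeg_cell u v
  rw [HElt.sdeg] at this
  linarith

theorem map_cell_congr {β : Type*} {i : α} {f g : List α → β}
    (h : ∀ w, i ∉ w → f w = g w) {ws : List (List α)} (hw : i ∉ ws.flatten) :
    ws.map f = ws.map g :=
  List.map_congr_left fun w hws => h w fun hi => hw (List.mem_flatten.2 ⟨w, hws, hi⟩)

section Gauge

variable [DecidableEq α]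

/-- The cells `a` changed by the curvature of cells `a'` in which the degree of the letter `i` is
lowered by one. -/
def ACells.gauge (μ : Ops A A 2) (a : ACells A s) {i : α} (a' : ACells A (lower s i)) :
    ACells A s where
  cell w := if h : w.count i = 1 then
    { deg := (a.cell w).deg
      val := (a.cell w).val + (wtBefore s i w).negOnePow • (curvA μ a' w).val
      mem := by
        have h1 := (curvA μ a' w).mem
        have h2 := a.sdeg_cell w
        rw [HElt.sdeg] at h2
        rw [show (curvA μ a' w).deg = (a.cell w).deg by
          simp only [curvA, wt_lower, h]; push_cast; linarith] at h1
        exact add_mem (a.cell w).mem (zsmul_mem h1 _) }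
    else a.cell w
  sdeg_cell w := by
    split_ifs
    · exact a.sdeg_cell w
    · exact a.sdeg_cell w

theorem ACells.gauge_of_notMem (μ : Ops A A 2) (a : ACells A s) {i : α}
    (a' : ACells A (lower s i)) {w : List α} (h : i ∉ w) :
    (a.gauge μ a').cell w = a.cell w := by
  simp [gauge, List.count_eq_zero_of_not_mem h]

theorem ACells.gauge_val (μ : Ops A A 2) (a : ACells A s) {i : α}
    (a' : ACells A (lower s i)) {w : List α} (h : w.count i = 1) :
    ((a.gauge μ a').cell w).val =
      (a.cell w).val + (wtBefore s i w).negOnePow • (curvA μ a' w).val := by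
  simp [gauge, h]

/-- For a fixed cut at most one block contains `i`, so at most one argument changes and additivity
in that argument suffices. The prefix `p` collects the blocks already passed in the induction. -/
theorem gauge_expand (μ : Ops A A 2) (a : ACells A s) {i : α} (a' : ACells A (lower s i))
    (haa' : ∀ w, i ∉ w → a'.cell w = a.cell w) {h : List (HElt A) → G}
    (hh : ∀ us ws, HAdditive fun y => h (us ++ y :: ws)) (ws : List (List α))
    (hws : ws.flatten.count i ≤ 1) (p : List (HElt A)) :
    h (p ++ ws.map (a.gauge μ a').cell) = h (p ++ ws.map a.cell) +
      sumSplit ws fun us r => headSum (fun w vs => if i ∈ w then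
          (wtBefore s i w).negOnePow • h (p ++ (us.map a'.cell ++ curvA μ a' w :: vs.map a'.cell))
        else 0) r := by
  induction ws generalizing p with
  | nil => simp [sumSplit_nil, headSum]
  | cons w ws ih =>
    rw [sumSplit_cons, headSum]
    rw [List.flatten_cons, List.count_append] at hws
    by_cases hi : i ∈ w
    · have hw1 : w.count i = 1 := by
        have := List.count_pos_iff.2 hi
        omega
      have hr : i ∉ ws.flatten := List.count_eq_zero.1 (by omega)
      rw [sumSplit_eq_zero, add_zero, if_pos hi, List.map_cons, List.map_cons,
        map_cell_congr (fun w hw => a.gauge_of_notMem μ a' hw) hr, map_cell_congr haa' hr]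
      · refine (hh p (ws.map a.cell)).add_smul ?_ ?_ _ (a.gauge_val μ a' hw1)
        · rw [a.deg_cell]
          simp only [curvA, wt_lower, hw1]
          push_cast
          ring
        · rw [a.deg_cell, ACells.deg_cell]
      · rintro us (_ | ⟨x, vs⟩) hur
        · rfl
        · refine if_neg fun hx => hr (List.mem_flatten.2 ⟨x, ?_, hx⟩)
          simp [← hur]
    · rw [if_neg hi, zero_add, List.map_cons, a.gauge_of_notMem μ a' hi, List.map_cons]
      have := ih (by omega) (p ++ [a.cell w])
      simp only [List.append_assoc, List.singleton_append] at this
      rw [this]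
      simp only [List.map_cons, haa' w hi, List.cons_append]

omit [DecidableEq α] in
-- Away from `i` the auxiliary cells are the flat ones, so the unwanted terms of the gauge formula
-- vanish.
theorem curvA_congr (μ : Ops A A 2) {s' : α → ℤ} {a : ACells A s} {a' : ACells A s'} {i : α}
    (haa' : ∀ w, i ∉ w → a'.cell w = a.cell w) {l : List α} (hl : i ∉ l) :
    (curvA μ a' l).val = (curvA μ a l).val :=
  sumParts_congr fun ws hws _ => by rw [map_cell_congr haa' (hws.symm ▸ hl)]

/-- The gauge formula for words in the algebra. -/
theorem sumParts_gauge (μ : Ops A A 2) (a : ACells A s) {i : α} (a' : ACells A (lower s i))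
    (haa' : ∀ w, i ∉ w → a'.cell w = a.cell w) {h : List (HElt A) → G}
    (hh : ∀ us ws, HAdditive fun y => h (us ++ y :: ws)) (l : List α) (hl : l.count i ≤ 1)
    (flat : ∀ w, w <:+: l → (curvA μ a w).val = 0) :
    (sumParts l fun ws => h (ws.map (a.gauge μ a').cell)) =
      (sumParts l fun ws => h (ws.map a.cell)) +
        (wtBefore s i l).negOnePow • sumParts l fun ws => barA μ h (ws.map a'.cell) := by
  have h1 := fun ws hws => gauge_expand μ a a' haa' hh ws hws []
  simp only [List.nil_append] at h1
  rw [sumParts_congr fun ws hws _ => h1 ws (by rwa [hws]), sumParts_add, sumParts_sumSplit,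
    sumParts_barA μ a' hh, sumSplit_smul]
  congr 1
  refine sumSplit_congr fun l₁ r hr => ?_
  rw [sumSplit_smul, sumParts_congr fun us _ _ => sumParts_headSum r _ fun ws => by simp,
    sumParts_sumSplit_comm]
  refine sumSplit_congr fun l₂ l₃ hl₂ => ?_
  subst hl₂ hr
  simp only [sumParts_smul]
  refine sumParts_congr fun us _ _ => sumParts_congr fun ws _ _ => ?_
  -- If the multiplied subword contains `i`, the terms match: the weight of `l₁` enters once through
  -- `wtBefore` and once through the bar sign, and cancels modulo two. If not, only the bar side has
  -- a term, which flatness kills.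
  split_ifs with hi
  · have hi₁ : i ∉ l₁ := by
      have := List.count_pos_iff.2 hi
      simp only [List.count_append] at hl
      exact List.count_eq_zero.1 (by omega)
    rw [wtBefore_append_right s hi₁, wtBefore_append_left s hi, smul_smul, ← Int.negOnePow_add,
      wt_lower, List.count_eq_zero.2 hi₁]
    congr 1
    rw [Int.negOnePow_eq_iff]
    exact ⟨-wt s l₁, by push_cast; ring⟩
  · rw [(hh _ _).eq_zero, smul_zero, smul_zero]
    rw [curvA_congr μ haa' hi]
    exact flat l₂ ⟨l₁, l₃, by simp⟩

omit [DecidableEq α] in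
theorem sumParts_barA_eq_zero (μ : Ops A A 2) (a : ACells A s) {h : List (HElt A) → G}
    (hh : ∀ us ws, HAdditive fun y => h (us ++ y :: ws)) (l : List α)
    (flat : ∀ w, w <:+: l → (curvA μ a w).val = 0) :
    (sumParts l fun ws => barA μ h (ws.map a.cell)) = 0 := by
  rw [sumParts_barA μ a hh]
  refine sumSplit_eq_zero fun l₁ r hr => sumSplit_eq_zero fun l₂ l₃ hl₂ =>
    sumParts_eq_zero fun us _ _ => sumParts_eq_zero fun ws _ _ => ?_
  rw [(hh _ _).eq_zero (flat l₂ ⟨l₁, l₃, by simp [hl₂, hr]⟩), smul_zero]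

end Gauge

end Cells

/-! ### Regrouping of nested cuts -/

section Rearrangement

variable {α G : Type*} [AddCommMonoid G]

theorem sumSplit_sumParts_sumSplit_left (u : List α)
    (F : List (List α) → List (List α) → List α → G) :
    (sumSplit u fun u₁ u₂ => sumParts u₁ fun ws => sumSplit ws fun ws₁ ws₂ => F ws₁ ws₂ u₂) =
      sumSplit u fun p r => sumParts p fun ws₁ => sumSplit r fun r₁ u₂ => sumParts r₁ fun ws₂ =>
        F ws₁ ws₂ u₂ := by
  simp only [sumParts_sumSplit, sumParts_sumSplit_comm]
  exact sumSplit_assoc u fun p r₁ u₂ => sumParts p fun ws₁ => sumParts r₁ fun ws₂ => F ws₁ ws₂ u₂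

theorem sumSplit_sumParts_sumSplit_right (v : List α)
    (F : List α → List (List α) → List (List α) → G) :
    (sumSplit v fun v₁ v₂ => sumParts v₂ fun zs => sumSplit zs fun zs₁ zs₂ => F v₁ zs₁ zs₂) =
      sumSplit v fun q t => sumParts t fun zs₂ => sumSplit q fun v₁ t₁ => sumParts t₁ fun zs₁ =>
        F v₁ zs₁ zs₂ := by
  simp only [sumParts_sumSplit, sumParts_sumSplit_comm]
  rw [sumSplit_assoc v fun v₁ t₁ t => sumParts t fun zs₂ => sumParts t₁ fun zs₁ => F v₁ zs₁ zs₂]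
  refine sumSplit_congr fun v₁ v₂ _ => sumSplit_congr fun t₁ t _ => ?_
  exact sumParts_comm _ _ _

/-- Two-sided version: on the left one cuts around the inner block and then chooses which
neighbouring blocks to absorb; on the right the absorbed region, with sides `r` and `q`, is chosen
first and then cut. -/
theorem sumSplit_rearrange (u v : List α)
    (F : List (List α) → List (List α) → List α → List α → List (List α) → List (List α) → G) :
    (sumSplit u fun u₁ u₂ => sumSplit v fun v₁ v₂ => sumParts u₁ fun ws => sumParts v₂ fun zs =>
      sumSplit ws fun ws₁ ws₂ => sumSplit zs fun zs₁ zs₂ => F ws₁ ws₂ u₂ v₁ zs₁ zs₂) =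
    sumSplit u fun p r => sumSplit v fun q t => sumParts p fun ws₁ => sumParts t fun zs₂ =>
      sumSplit r fun r₁ u₂ => sumSplit q fun v₁ t₁ => sumParts r₁ fun ws₂ => sumParts t₁ fun zs₁ =>
        F ws₁ ws₂ u₂ v₁ zs₁ zs₂ := by
  have h1 : ∀ u₁ u₂ : List α,
      (sumSplit v fun v₁ v₂ => sumParts u₁ fun ws => sumParts v₂ fun zs =>
        sumSplit ws fun ws₁ ws₂ => sumSplit zs fun zs₁ zs₂ => F ws₁ ws₂ u₂ v₁ zs₁ zs₂) =
      sumParts u₁ fun ws => sumSplit ws fun ws₁ ws₂ => sumSplit v fun v₁ v₂ =>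
        sumParts v₂ fun zs => sumSplit zs fun zs₁ zs₂ => F ws₁ ws₂ u₂ v₁ zs₁ zs₂ := by
    intro u₁ u₂
    rw [← sumParts_sumSplit_comm]
    refine sumParts_congr fun ws _ _ => ?_
    rw [sumSplit_comm ws]
    refine sumSplit_congr fun v₁ v₂ _ => ?_
    rw [sumParts_sumSplit_comm]
  simp only [h1]
  rw [sumSplit_sumParts_sumSplit_left u fun ws₁ ws₂ u₂ => sumSplit v fun v₁ v₂ =>
        sumParts v₂ fun zs => sumSplit zs fun zs₁ zs₂ => F ws₁ ws₂ u₂ v₁ zs₁ zs₂]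
  refine sumSplit_congr fun p r _ => ?_
  rw [← sumParts_sumSplit_comm]
  refine sumParts_congr fun ws₁ _ _ => ?_
  have h2 : ∀ (ws₂ : List (List α)) (u₂ : List α), (sumSplit v fun v₁ v₂ =>
        sumParts v₂ fun zs => sumSplit zs fun zs₁ zs₂ => F ws₁ ws₂ u₂ v₁ zs₁ zs₂) =
      sumSplit v fun q t => sumParts t fun zs₂ => sumSplit q fun v₁ t₁ => sumParts t₁ fun zs₁ =>
        F ws₁ ws₂ u₂ v₁ zs₁ zs₂ := fun ws₂ u₂ =>
    sumSplit_sumParts_sumSplit_right v fun v₁ zs₁ zs₂ => F ws₁ ws₂ u₂ v₁ zs₁ zs₂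
  simp only [h2]
  have h3 : ∀ r₁ u₂ : List α, (sumParts r₁ fun ws₂ => sumSplit v fun q t => sumParts t fun zs₂ =>
        sumSplit q fun v₁ t₁ => sumParts t₁ fun zs₁ => F ws₁ ws₂ u₂ v₁ zs₁ zs₂) =
      sumSplit v fun q t => sumParts t fun zs₂ => sumSplit q fun v₁ t₁ => sumParts r₁ fun ws₂ =>
        sumParts t₁ fun zs₁ => F ws₁ ws₂ u₂ v₁ zs₁ zs₂ := by
    intro r₁ u₂
    rw [sumParts_sumSplit_comm]
    refine sumSplit_congr fun q t _ => ?_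
    rw [sumParts_comm]
    refine sumParts_congr fun zs₂ _ _ => ?_
    rw [sumParts_sumSplit_comm]
  simp only [h3]
  rw [sumSplit_comm]
  refine sumSplit_congr fun q t _ => ?_
  rw [← sumParts_sumSplit_comm]

end Rearrangement

/-! ### Words with one module letter -/

section Modules

variable {R : Type*} [CommRing R] {A M : GrModule R} {α : Type*} {G : Type*} [AddCommGroup G]
  {s : α → ℤ} {K : α}

theorem stairM_congr {a : ACells A s} {m : MCells M s K}
    {g g' : List (HElt A) → HElt M → List (HElt A) → G} {u v : List α}
    (h : ∀ (ws : List (List α)) u₂ v₁ (zs : List (List α)), ws.flatten ++ u₂ = u → v₁ ++ zs.flatten = v →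
      g (ws.map a.cell) (m.cell u₂ v₁) (zs.map a.cell) =
        g' (ws.map a.cell) (m.cell u₂ v₁) (zs.map a.cell)) :
    stairM a m g u v = stairM a m g' u v :=
  sumSplit_congr fun _ _ hu => sumSplit_congr fun _ _ hv => sumParts_congr fun _ hws _ =>
    sumParts_congr fun _ hzs _ => h _ _ _ _ (by rw [hws, hu]) (by rw [hzs, hv])

theorem stairM_add (a : ACells A s) (m : MCells M s K)
    (g g' : List (HElt A) → HElt M → List (HElt A) → G) (u v : List α) :
    stairM a m (fun x y z => g x y z + g' x y z) u v = stairM a m g u v + stairM a m g' u v := by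
  simp only [stairM, sumParts_add, sumSplit_add]

theorem stairM_smul (a : ACells A s) (m : MCells M s K) (ε : ℤˣ)
    (g : List (HElt A) → HElt M → List (HElt A) → G) (u v : List α) :
    stairM a m (fun x y z => ε • g x y z) u v = ε • stairM a m g u v := by
  simp only [stairM, sumParts_smul, sumSplit_smul]

/-- All products over one block have the degree of its curvature, so a function additive in each
degree commutes with their sum. -/
theorem stairM_curvM (β : BiOps A M M 1) (a : ACells A s) (m : MCells M s K) {γ : HElt M → G}
    (hγ : HAdditive γ) (u v : List α) :
    stairM a m (fun u m v => γ (β.shifted u m v)) u v = γ (curvM β a m u v) := by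
  obtain ⟨L, hL⟩ := hγ (curvM β a m u v).deg
  rw [hL _ rfl, curvM]
  simp only [stairM, map_sumSplit, map_sumParts]
  refine sumSplit_congr fun r₁ u₂ hr => sumSplit_congr fun v₁ t₁ hq =>
    sumParts_congr fun ws₂ hws₂ _ => sumParts_congr fun zs₁ hzs₁ _ => hL _ ?_
  simp [BiOps.shifted, curvM, a.sdegs_map, hws₂, hzs₁, m.deg_cell, ← hr, ← hq]
  ring

/-- The sum over all ways to cut `u ++ K :: v` of `precomp μ β g`, in terms of the curvature. -/
theorem stairM_precomp (μ : Ops A A 2) (β : BiOps A M M 1) (a : ACells A s) (m : MCells M s K)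
    {g : List (HElt A) → HElt M → List (HElt A) → G} (hg : TriAdditive g) (u v : List α) :
    stairM a m (precomp μ β g) u v = sumSplit u fun u₁ u₂ => sumSplit v fun v₁ v₂ =>
      ((sumParts v₂ fun zs => sumParts u₁ fun ws =>
          barA μ (fun L => g L (m.cell u₂ v₁) (zs.map a.cell)) (ws.map a.cell)) +
        (sumParts u₁ fun ws => sumParts v₂ fun zs =>
          (wt s u₁).negOnePow • g (ws.map a.cell) (curvM β a m u₂ v₁) (zs.map a.cell))) +
        (wt s u₁ + (wt s u₂ + s K + wt s v₁)).negOnePow • sumParts u₁ fun ws => sumParts v₂ fun zs =>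
          barA μ (g (ws.map a.cell) (m.cell u₂ v₁)) (zs.map a.cell) := by
  have e1 : stairM a m (precomp μ β g) u v = stairM a m (fun u m v =>
      (barA μ (fun L => g L m v) u + sumSplit u fun u₁ u₂ => sumSplit v fun v₁ v₂ =>
        (sdegs u₁).negOnePow • g u₁ (β.shifted u₂ m v₁) v₂) +
      (sdegs u + m.sdeg).negOnePow • barA μ (g u m) v) u v := by
    refine stairM_congr fun ws u₂ v₁ zs _ _ => ?_
    simp only [precomp, barA, sumSplit_smul, smul_smul, ← Int.negOnePow_add]
  rw [e1, stairM_add, stairM_add]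
  simp only [sumSplit_add]
  congr 1
  · congr 1
    · refine sumSplit_congr fun u₁ u₂ _ => sumSplit_congr fun v₁ v₂ _ => sumParts_comm _ _ _
    · simp only [stairM, sumSplit_map]
      -- After regrouping, the inner sum runs over all cuts of the region swallowed by `β`, and is
      -- therefore its curvature.
      rw [sumSplit_rearrange u v fun ws₁ ws₂ u₂ v₁ zs₁ zs₂ => (sdegs (ws₁.map a.cell)).negOnePow •
        g (ws₁.map a.cell) (β.shifted (ws₂.map a.cell) (m.cell u₂ v₁) (zs₁.map a.cell))
          (zs₂.map a.cell)]
      refine sumSplit_congr fun p r _ => sumSplit_congr fun q t _ => sumParts_congr fun ws₁ hws₁ _ =>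
        sumParts_congr fun zs₂ _ _ => ?_
      rw [a.sdegs_map, hws₁]
      simp only [← sumSplit_smul, ← sumParts_smul]
      congr 1
      exact stairM_curvM β a m (hg.mid (ws₁.map a.cell) (zs₂.map a.cell)) r q
  · refine sumSplit_congr fun u₁ u₂ _ => sumSplit_congr fun v₁ v₂ _ => ?_
    rw [sumParts_smul]
    refine sumParts_congr fun ws hws _ => ?_
    simp only [a.sdegs_map, hws, m.sdeg_cell, sumParts_smul]

end Modules

/-! ### Gauge formula for words with one module letter -/

section ModuleGauge

variable {R : Type*} [CommRing R] {A M : GrModule R} {α : Type*} {G : Type*} [AddCommGroup G]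
  {s : α → ℤ} {K : α} [DecidableEq α]

omit [DecidableEq α] in
theorem stairM_cells_congr {s' : α → ℤ} {a : ACells A s} {a' : ACells A s'} {m : MCells M s K}
    {m' : MCells M s' K} {i : α} (haa' : ∀ w, i ∉ w → a'.cell w = a.cell w)
    (hmm' : ∀ u v, i ∉ u ++ K :: v → m'.cell u v = m.cell u v)
    (g : List (HElt A) → HElt M → List (HElt A) → G) {u v : List α} (hi : i ∉ u ++ K :: v) :
    stairM a' m' g u v = stairM a m g u v := by
  refine sumSplit_congr fun u₁ u₂ hu => sumSplit_congr fun v₁ v₂ hv =>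
    sumParts_congr fun ws hws _ => sumParts_congr fun zs hzs _ => ?_
  subst hu hv
  simp only [List.mem_append, List.mem_cons, not_or] at hi
  rw [map_cell_congr haa' (hws.symm ▸ hi.1.1), map_cell_congr haa' (hzs.symm ▸ hi.2.2.2),
    hmm' u₂ v₁ (by simp [hi])]

omit [DecidableEq α] in
theorem curvM_congr (β : BiOps A M M 1) {s' : α → ℤ} {a : ACells A s} {a' : ACells A s'}
    {m : MCells M s K} {m' : MCells M s' K} {i : α} (haa' : ∀ w, i ∉ w → a'.cell w = a.cell w)
    (hmm' : ∀ u v, i ∉ u ++ K :: v → m'.cell u v = m.cell u v) {u v : List α}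
    (hi : i ∉ u ++ K :: v) : (curvM β a' m' u v).val = (curvM β a m u v).val :=
  stairM_cells_congr haa' hmm' (fun u m v => (β.shifted u m v).val) hi

/-- The cells `m` changed by the curvature of cells in which the degree of the letter `i` is
lowered by one. -/
def MCells.gauge (β : BiOps A M M 1) {i : α} (a' : ACells A (lower s i)) (m : MCells M s K)
    (m' : MCells M (lower s i) K) : MCells M s K where
  cell u v := if h : (u ++ K :: v).count i = 1 then
    { deg := (m.cell u v).deg
      val := (m.cell u v).val + (wtBefore s i (u ++ K :: v)).negOnePow • (curvM β a' m' u v).val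
      mem := by
        have h1 := (curvM β a' m' u v).mem
        have h3 := wt_lower s i (u ++ K :: v)
        rw [h] at h3
        simp only [wt_append, wt_cons] at h3
        rw [show (curvM β a' m' u v).deg = (m.cell u v).deg by
          rw [m.deg_cell]
          simp only [curvM]
          push_cast at h3
          linarith] at h1
        exact add_mem (m.cell u v).mem (zsmul_mem h1 _) }
    else m.cell u v
  sdeg_cell u v := by
    split_ifs
    · exact m.sdeg_cell u v
    · exact m.sdeg_cell u v

theorem MCells.gauge_of_notMem (β : BiOps A M M 1) {i : α} (a' : ACells A (lower s i))
    (m : MCells M s K) (m' : MCells M (lower s i) K) {u v : List α} (h : i ∉ u ++ K :: v) :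
    (m.gauge β a' m').cell u v = m.cell u v := by
  have h0 : (u ++ K :: v).count i ≠ 1 := by
    rw [List.count_eq_zero_of_not_mem h]
    exact zero_ne_one
  simp only [gauge, dif_neg h0]

theorem MCells.gauge_val (β : BiOps A M M 1) {i : α} (a' : ACells A (lower s i))
    (m : MCells M s K) (m' : MCells M (lower s i) K) {u v : List α}
    (h : (u ++ K :: v).count i = 1) :
    ((m.gauge β a' m').cell u v).val = (m.cell u v).val +
      (wtBefore s i (u ++ K :: v)).negOnePow • (curvM β a' m' u v).val := by
  simp only [gauge, dif_pos h]

/-- Valid whether or not the block contains `i`: if it does not, the cell is unchanged and flatness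
makes the correction term zero too. -/
theorem HAdditive.gauge {g : HElt M → G} (hg : HAdditive g) (β : BiOps A M M 1) {i : α}
    (a : ACells A s) (a' : ACells A (lower s i)) (m : MCells M s K) (m' : MCells M (lower s i) K)
    (haa' : ∀ w, i ∉ w → a'.cell w = a.cell w)
    (hmm' : ∀ u v, i ∉ u ++ K :: v → m'.cell u v = m.cell u v) {u v : List α}
    (hl : (u ++ K :: v).count i ≤ 1) (flat : (curvM β a m u v).val = 0) :
    g ((m.gauge β a' m').cell u v) = g (m.cell u v) +
      (wtBefore s i (u ++ K :: v)).negOnePow • g (curvM β a' m' u v) := by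
  by_cases hi : i ∈ u ++ K :: v
  · have h1 : (u ++ K :: v).count i = 1 := le_antisymm hl (List.count_pos_iff.2 hi)
    refine hg.add_smul ?_ ?_ _ (m.gauge_val β a' m' h1)
    · have h3 := wt_lower s i (u ++ K :: v)
      rw [h1] at h3
      simp only [wt_append, wt_cons] at h3
      rw [m.deg_cell]
      simp only [curvM]
      push_cast at h3
      linarith
    · rw [m.deg_cell, MCells.deg_cell]
  · rw [m.gauge_of_notMem β a' m' hi, hg.eq_zero (x := curvM β a' m' u v), smul_zero, add_zero]
    exact (curvM_congr β haa' hmm' hi).trans flat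

/-- The gauge formula for words with one module letter. -/
theorem stairM_gauge (μ : Ops A A 2) (β : BiOps A M M 1) {i : α} (a : ACells A s)
    (a' : ACells A (lower s i)) (m : MCells M s K) (m' : MCells M (lower s i) K)
    (haa' : ∀ w, i ∉ w → a'.cell w = a.cell w)
    (hmm' : ∀ u v, i ∉ u ++ K :: v → m'.cell u v = m.cell u v)
    {g : List (HElt A) → HElt M → List (HElt A) → G} (hg : TriAdditive g) {u v : List α}
    (hl : (u ++ K :: v).count i ≤ 1)
    (flatu : ∀ w, w <:+: u → (curvA μ a w).val = 0)
    (flatv : ∀ w, w <:+: v → (curvA μ a w).val = 0)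
    (flatm : ∀ u' v', u' <:+ u → v' <+: v → (curvM β a m u' v').val = 0) :
    stairM (a.gauge μ a') (m.gauge β a' m') g u v = stairM a m g u v +
      (wtBefore s i (u ++ K :: v)).negOnePow • stairM a' m' (precomp μ β g) u v := by
  rw [stairM_precomp μ β a' m' hg, stairM, stairM]
  simp only [sumSplit_smul]
  rw [← sumSplit_add]
  refine sumSplit_congr fun u₁ u₂ hu => ?_
  rw [← sumSplit_add]
  refine sumSplit_congr fun v₁ v₂ hv => ?_
  have hfu : ∀ w, w <:+: u₁ → (curvA μ a w).val = 0 := fun w hw =>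
    flatu w (hw.trans (hu ▸ (List.prefix_append u₁ u₂).isInfix))
  have hfv : ∀ w, w <:+: v₂ → (curvA μ a w).val = 0 := fun w hw =>
    flatv w (hw.trans (hv ▸ (List.suffix_append v₁ v₂).isInfix))
  have hfm : (curvM β a m u₂ v₁).val = 0 :=
    flatm _ _ (hu ▸ List.suffix_append u₁ u₂) (hv ▸ List.prefix_append v₁ v₂)
  subst hu hv
  have hcount : (u₁ ++ u₂ ++ K :: (v₁ ++ v₂)).count i =
      u₁.count i + (u₂ ++ K :: v₁).count i + v₂.count i := by
    simp only [List.count_append, List.count_cons]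
    ring
  rw [hcount] at hl
  have hword : u₁ ++ u₂ ++ K :: (v₁ ++ v₂) = u₁ ++ ((u₂ ++ K :: v₁) ++ v₂) := by simp
  rw [hword]
  have gaugeA : ∀ {ws : List (List α)} {l : List α}, ws.flatten = l → i ∉ l →
      ws.map (a.gauge μ a').cell = ws.map a.cell := fun hws hi =>
    map_cell_congr (fun w hw => a.gauge_of_notMem μ a' hw) (hws.symm ▸ hi)
  have primeA : ∀ {ws : List (List α)} {l : List α}, ws.flatten = l → i ∉ l →
      ws.map a'.cell = ws.map a.cell := fun hws hi => map_cell_congr haa' (hws.symm ▸ hi)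
  -- The next four facts discard the parts of the bar differential acting on a region without `i`,
  -- where the cells `a'` and `m'` are the old flat ones.
  have bar_zero : ∀ {l : List α} {h : List (HElt A) → G},
      (∀ us ws, HAdditive fun y => h (us ++ y :: ws)) → i ∉ l →
      (∀ w, w <:+: l → (curvA μ a w).val = 0) →
      (sumParts l fun ws => barA μ h (ws.map a'.cell)) = 0 := fun hh hi hf => by
    rw [← sumParts_barA_eq_zero μ a hh _ hf]
    exact sumParts_congr fun ws hws _ => by rw [primeA hws hi]
  have mid_zero : i ∉ u₂ ++ K :: v₁ → (sumParts u₁ fun ws => sumParts v₂ fun zs =>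
      (wt (lower s i) u₁).negOnePow •
        g (ws.map a'.cell) (curvM β a' m' u₂ v₁) (zs.map a'.cell)) = 0 := fun hi =>
    sumParts_eq_zero fun ws _ _ => sumParts_eq_zero fun zs _ _ => by
      rw [(hg.mid _ _).eq_zero ((curvM_congr β haa' hmm' hi).trans hfm), smul_zero]
  have left_zero : i ∉ u₁ → (sumParts v₂ fun zs => sumParts u₁ fun ws =>
      barA μ (fun L => g L (m'.cell u₂ v₁) (zs.map a'.cell)) (ws.map a'.cell)) = 0 := fun h1 =>
    sumParts_eq_zero fun zs _ _ => bar_zero (fun us ws => hg.left us ws _ _) h1 hfu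
  have right_zero : i ∉ v₂ → (sumParts u₁ fun ws => sumParts v₂ fun zs =>
      barA μ (g (ws.map a'.cell) (m'.cell u₂ v₁)) (zs.map a'.cell)) = 0 := fun h3 =>
    sumParts_eq_zero fun ws _ _ => bar_zero (hg.right _ _) h3 hfv
  -- The letter `i` occurs at most once: left of the module block, right of it, inside it, or
  -- nowhere. Each case leaves at most one of the three kinds of terms, and the sign is checked
  -- there.
  by_cases h1 : i ∈ u₁
  · have c1 := List.count_pos_iff.2 h1
    have h2 : i ∉ u₂ ++ K :: v₁ := List.count_eq_zero.1 (by omega)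
    have h3 : i ∉ v₂ := List.count_eq_zero.1 (by omega)
    rw [mid_zero h2, right_zero h3, smul_zero, add_zero, add_zero, sumParts_comm,
      sumParts_comm u₁ v₂ fun ws zs => g (ws.map a.cell) (m.cell u₂ v₁) (zs.map a.cell),
      wtBefore_append_left s h1, sumParts_smul, ← sumParts_add]
    refine sumParts_congr fun zs hzs _ => ?_
    rw [gaugeA hzs h3, primeA hzs h3, m.gauge_of_notMem β a' m' h2, hmm' _ _ h2]
    exact sumParts_gauge μ a a' haa' (h := fun L => g L (m.cell u₂ v₁) (zs.map a.cell))
      (fun us ws => hg.left us ws _ _) u₁ (by omega) hfu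
  rw [wtBefore_append_right s h1, left_zero h1, zero_add]
  by_cases h3 : i ∈ v₂
  · have c3 := List.count_pos_iff.2 h3
    have h2 : i ∉ u₂ ++ K :: v₁ := List.count_eq_zero.1 (by omega)
    rw [mid_zero h2, zero_add, sumParts_smul, sumParts_smul, ← sumParts_add]
    refine sumParts_congr fun ws hws _ => ?_
    rw [gaugeA hws h1, primeA hws h1, m.gauge_of_notMem β a' m' h2, hmm' _ _ h2,
      wtBefore_append_right s h2,
      sumParts_gauge μ a a' haa' (hg.right (ws.map a.cell) (m.cell u₂ v₁)) v₂ (by omega) hfv,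
      smul_smul, ← Int.negOnePow_add]
    congr 2
    rw [Int.negOnePow_eq_iff]
    have e1 := wt_lower s i (u₂ ++ K :: v₁)
    rw [List.count_eq_zero.2 h2] at e1
    simp only [wt_append, wt_cons] at e1 ⊢
    rw [wt_lower s i u₁, List.count_eq_zero.2 h1]
    refine ⟨-(wt s u₁ + (wt s u₂ + s K + wt s v₁)), ?_⟩
    push_cast at e1 ⊢
    linarith
  · rw [right_zero h3, smul_zero, add_zero, sumParts_smul, ← sumParts_add]
    refine sumParts_congr fun ws hws _ => ?_
    rw [sumParts_smul, ← sumParts_add]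
    refine sumParts_congr fun zs hzs _ => ?_
    rw [gaugeA hws h1, primeA hws h1, gaugeA hzs h3, primeA hzs h3,
      (hg.mid _ _).gauge β a a' m m' haa' hmm' (by omega) hfm, smul_smul, ← Int.negOnePow_add]
    by_cases h2 : i ∈ u₂ ++ K :: v₁
    · rw [wtBefore_append_left s h2]
      congr 2
      rw [Int.negOnePow_eq_iff, wt_lower s i u₁, List.count_eq_zero.2 h1]
      exact ⟨-wt s u₁, by push_cast; ring⟩
    · rw [(hg.mid _ _).eq_zero ((curvM_congr β haa' hmm' h2).trans hfm), smul_zero, smul_zero]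

end ModuleGauge

/-! ### Cyclic words and inner products -/

section InnerProducts

variable {R : Type u} [CommRing R] {𝔸 : AInfAlgebra.{u, v} R}

/-- Unfolding the dual structure maps turns `β' ∘ G` into operations around the last argument, so
that `δ` treats both module letters of the cyclic word alike. The two minus signs cancel, and so
does every contribution of `e` to the sign. -/
theorem AInfModule.delta_eq (𝕄 : AInfModule.{u, v, w} 𝔸) {e : ℤ} (G : PairOps 𝔸.A 𝕄.M e)
    (u : List (HElt 𝔸.A)) (m : HElt 𝕄.M) (v : List (HElt 𝔸.A)) (n : HElt 𝕄.M) :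
    𝕄.delta G u m v n = precomp 𝔸.μ 𝕄.β (fun u m v => G.shifted u m v n) u m v +
      sumSplit u fun u₁ u₂ => sumSplit v fun v₁ v₂ =>
        (sdegs u₁ * (sdegs u₂ + m.sdeg + sdegs v₁ + sdegs v₂ + n.sdeg) +
          (sdegs u₂ + m.sdeg + sdegs v₁)).negOnePow •
            G.shifted u₂ m v₁ (𝕄.β.shifted v₂ n u₁) := by
  rw [AInfModule.delta, sub_eq_add_neg]
  congr 1
  rw [sumSplit_smul, ← sumSplit_neg]
  refine sumSplit_congr fun u₁ u₂ _ => ?_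
  rw [sumSplit_smul, ← sumSplit_neg]
  refine sumSplit_congr fun v₁ v₂ _ => ?_
  rw [AInfModule.dualOp, smul_neg, smul_neg, neg_neg, smul_smul, smul_smul, ← Int.negOnePow_add,
    ← Int.negOnePow_add]
  congr 1
  rw [Int.negOnePow_eq_iff]
  exact ⟨e + e * sdegs u₁, by ring⟩

end InnerProducts

section Staircases

variable {R : Type*} [CommRing R] {A M : GrModule R} {α : Type*} {G : Type*} [AddCommGroup G]
  {s : α → ℤ} {K N : α}

theorem stairM_sumSplit {γ : Type*} (a : ACells A s) (m : MCells M s K) (l : List γ)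
    (F : List (HElt A) → HElt M → List (HElt A) → List γ → List γ → G) (u v : List α) :
    stairM a m (fun x y z => sumSplit l fun p q => F x y z p q) u v =
      sumSplit l fun p q => stairM a m (fun x y z => F x y z p q) u v := by
  simp only [stairM, sumParts_sumSplit_comm]
  rw [sumSplit_comm l]
  refine sumSplit_congr fun u₁ u₂ _ => ?_
  rw [sumSplit_comm l]

theorem stairM_sumParts {γ : Type*} (a : ACells A s) (m : MCells M s K) (l : List γ)
    (F : List (HElt A) → HElt M → List (HElt A) → List (List γ) → G) (u v : List α) :
    stairM a m (fun x y z => sumParts l fun ws => F x y z ws) u v =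
      sumParts l fun ws => stairM a m (fun x y z => F x y z ws) u v := by
  simp only [stairM, sumParts_sumSplit_comm]
  refine sumSplit_congr fun u₁ u₂ _ => sumSplit_congr fun v₁ v₂ _ => ?_
  rw [sumParts_comm l]
  refine sumParts_congr fun ws _ _ => ?_
  rw [sumParts_comm l]

/-- The sum over all ways to cut the cyclic word `U, K, V, N` into blocks, with `K` and `N` in
different blocks, and with the Koszul sign for moving to the end the letters of `U` which belong to
the block of `N`. -/
def stairI (a : ACells A s) (m : MCells M s K) (n : MCells M s N)
    (g : List (HElt A) → HElt M → List (HElt A) → HElt M → G) (U V : List α) : G :=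
  sumSplit U fun u₀ u' => sumSplit V fun v' v₀ =>
    (wt s u₀ * (wt s u' + s K + wt s V + s N)).negOnePow •
      stairM a m (fun x y z => g x y z (n.cell v₀ u₀)) u' v'

end Staircases

section StaircaseInner

variable {R : Type u} [CommRing R] {𝔸 : AInfAlgebra.{u, v} R} {α : Type*} {s : α → ℤ} {K N : α}

/-- The sum over all cyclic cuts of `δ(G)`, in terms of the curvature. -/
theorem stairI_delta (𝕄 : AInfModule.{u, v, w} 𝔸) {e : ℤ} (G : PairOps 𝔸.A 𝕄.M e)
    (a : ACells 𝔸.A s) (m : MCells 𝕄.M s K) (n : MCells 𝕄.M s N) (U V : List α) :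
    stairI a m n (𝕄.delta G) U V = sumSplit U fun u₀ u' => sumSplit V fun v' v₀ =>
      ((wt s u₀ * (wt s u' + s K + wt s V + s N)).negOnePow •
        stairM a m (precomp 𝔸.μ 𝕄.β fun x y z => G.shifted x y z (n.cell v₀ u₀)) u' v' +
      (wt s u₀ * (wt s u' + s K + wt s V + s N) + (wt s u' + s K + wt s v')).negOnePow •
        stairM a m (fun x y z => G.shifted x y z (curvM 𝕄.β a n v₀ u₀)) u' v') := by
  simp only [sumSplit_add]
  simp only [stairI, AInfModule.delta_eq, stairM_add, smul_add, sumSplit_add]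
  congr 1
  -- The operation around `N` absorbs blocks `p` and `t` next to its cell; they are separated here
  -- from the region `r`, `q` that stays with `K`.
  have e1 : ∀ u₀ u' v' v₀ : List α, u₀ ++ u' = U → v' ++ v₀ = V →
      (wt s u₀ * (wt s u' + s K + wt s V + s N)).negOnePow •
        stairM a m (fun x y z => sumSplit x fun u₁ u₂ => sumSplit z fun v₁ v₂ =>
          (sdegs u₁ * (sdegs u₂ + y.sdeg + sdegs v₁ + sdegs v₂ + (n.cell v₀ u₀).sdeg) +
            (sdegs u₂ + y.sdeg + sdegs v₁)).negOnePow •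
              G.shifted u₂ y v₁ (𝕄.β.shifted v₂ (n.cell v₀ u₀) u₁)) u' v' =
      sumSplit u' fun p r => sumSplit v' fun q t => sumParts p fun ws => sumParts t fun zs =>
        ((wt s u₀ + wt s p) * (wt s r + s K + wt s V + s N) +
          (wt s r + s K + wt s q)).negOnePow •
        stairM a m (fun x y z => G.shifted x y z
          (𝕄.β.shifted (zs.map a.cell) (n.cell v₀ u₀) (ws.map a.cell))) r q := by
    intro u₀ u' v' v₀ hU hV
    simp only [stairM, sumSplit_map]
    rw [sumSplit_rearrange u' v' fun ws₁ ws₂ u₂ v₁ zs₁ zs₂ =>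
      (sdegs (ws₁.map a.cell) * (sdegs (ws₂.map a.cell) + (m.cell u₂ v₁).sdeg +
        sdegs (zs₁.map a.cell) + sdegs (zs₂.map a.cell) + (n.cell v₀ u₀).sdeg) +
        (sdegs (ws₂.map a.cell) + (m.cell u₂ v₁).sdeg + sdegs (zs₁.map a.cell))).negOnePow •
        G.shifted (ws₂.map a.cell) (m.cell u₂ v₁) (zs₁.map a.cell)
          (𝕄.β.shifted (zs₂.map a.cell) (n.cell v₀ u₀) (ws₁.map a.cell))]
    simp only [sumSplit_smul, sumParts_smul]
    refine sumSplit_congr fun p r hu => sumSplit_congr fun q t hv => sumParts_congr fun ws hws _ =>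
      sumParts_congr fun zs hzs _ => sumSplit_congr fun r₁ u₂ hr => sumSplit_congr fun v₁ t₁ hq =>
      sumParts_congr fun ws₂ hws₂ _ => sumParts_congr fun zs₁ hzs₁ _ => ?_
    rw [smul_smul, ← Int.negOnePow_add]
    congr 1
    rw [Int.negOnePow_eq_iff]
    subst hU hV hu hv hr hq
    simp only [a.sdegs_map, hws, hzs, hws₂, hzs₁, m.sdeg_cell, n.sdeg_cell, wt_append]
    refine ⟨wt s u₀ * wt s p, by ring⟩
  rw [sumSplit_congr fun u₀ u' hU => sumSplit_congr fun v' v₀ hV => e1 u₀ u' v' v₀ hU hV]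
  simp only [sumSplit_comm V]
  -- Grouping `u₀` with `p`, and below `t` with `v₀`, makes the block of `N` after the operation
  -- visible. The sum over its cuts is the curvature of `n`.
  rw [← sumSplit_assoc U fun u₀ p r => sumSplit V fun v' v₀ => sumSplit v' fun q t =>
    sumParts p fun ws => sumParts t fun zs =>
      ((wt s u₀ + wt s p) * (wt s r + s K + wt s V + s N) + (wt s r + s K + wt s q)).negOnePow •
        stairM a m (fun x y z => G.shifted x y z
          (𝕄.β.shifted (zs.map a.cell) (n.cell v₀ u₀) (ws.map a.cell))) r q]
  refine sumSplit_congr fun w r _ => ?_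
  have e2 : ∀ u₀ p : List α, (sumSplit V fun v' v₀ => sumSplit v' fun q t =>
      sumParts p fun ws => sumParts t fun zs =>
      ((wt s u₀ + wt s p) * (wt s r + s K + wt s V + s N) + (wt s r + s K + wt s q)).negOnePow •
        stairM a m (fun x y z => G.shifted x y z
          (𝕄.β.shifted (zs.map a.cell) (n.cell v₀ u₀) (ws.map a.cell))) r q) =
      sumSplit V fun q v => sumSplit v fun t v₀ => sumParts p fun ws => sumParts t fun zs =>
      ((wt s u₀ + wt s p) * (wt s r + s K + wt s V + s N) + (wt s r + s K + wt s q)).negOnePow •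
        stairM a m (fun x y z => G.shifted x y z
          (𝕄.β.shifted (zs.map a.cell) (n.cell v₀ u₀) (ws.map a.cell))) r q := fun u₀ p =>
    sumSplit_assoc V fun q t v₀ => sumParts p fun ws => sumParts t fun zs =>
      ((wt s u₀ + wt s p) * (wt s r + s K + wt s V + s N) + (wt s r + s K + wt s q)).negOnePow •
        stairM a m (fun x y z => G.shifted x y z
          (𝕄.β.shifted (zs.map a.cell) (n.cell v₀ u₀) (ws.map a.cell))) r q
  simp only [e2]
  rw [sumSplit_comm w]
  refine sumSplit_congr fun q v _ => ?_
  have e3 : ∀ (x : List (HElt 𝔸.A)) (y : HElt 𝕄.M) (z : List (HElt 𝔸.A)),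
      G.shifted x y z (curvM 𝕄.β a n v w) = sumSplit v fun t v₀ => sumSplit w fun u₀ p =>
        sumParts t fun zs => sumParts p fun ws => G.shifted x y z
          (𝕄.β.shifted (zs.map a.cell) (n.cell v₀ u₀) (ws.map a.cell)) := fun x y z =>
    (stairM_curvM 𝕄.β a n (G.hAdditive x y z) v w).symm
  simp only [e3, stairM_sumSplit, stairM_sumParts, sumSplit_smul, sumParts_smul]
  rw [sumSplit_comm w]
  refine sumSplit_congr fun t v₀ _ => sumSplit_congr fun u₀ p hw => ?_
  rw [sumParts_comm]
  subst hw
  simp only [wt_append]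

end StaircaseInner

section InnerGauge

variable {R : Type u} [CommRing R] {𝔸 : AInfAlgebra.{u, v} R} {α : Type*} {s : α → ℤ} {K N : α}
  [DecidableEq α]

/-- The gauge formula for cyclic words. -/
theorem stairI_gauge (𝕄 : AInfModule.{u, v, w} 𝔸) {e : ℤ} (G : PairOps 𝔸.A 𝕄.M e) {i : α}
    (a : ACells 𝔸.A s) (a' : ACells 𝔸.A (lower s i)) (m : MCells 𝕄.M s K)
    (m' : MCells 𝕄.M (lower s i) K) (n : MCells 𝕄.M s N) (n' : MCells 𝕄.M (lower s i) N)
    (haa' : ∀ w, i ∉ w → a'.cell w = a.cell w)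
    (hmm' : ∀ u v, i ∉ u ++ K :: v → m'.cell u v = m.cell u v)
    (hnn' : ∀ v u, i ∉ v ++ N :: u → n'.cell v u = n.cell v u) {U V : List α}
    (hl : (U ++ K :: (V ++ [N])).count i ≤ 1)
    (flatU : ∀ w, w <:+: U → (curvA 𝔸.μ a w).val = 0)
    (flatV : ∀ w, w <:+: V → (curvA 𝔸.μ a w).val = 0)
    (flatm : ∀ u v, u <:+ U → v <+: V → (curvM 𝕄.β a m u v).val = 0)
    (flatn : ∀ v u, v <:+ V → u <+: U → (curvM 𝕄.β a n v u).val = 0) :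
    stairI (a.gauge 𝔸.μ a') (m.gauge 𝕄.β a' m') (n.gauge 𝕄.β a' n')
        (fun x y z t => G.shifted x y z t) U V =
      stairI a m n (fun x y z t => G.shifted x y z t) U V +
        (wtBefore s i (U ++ K :: (V ++ [N]))).negOnePow • stairI a' m' n' (𝕄.delta G) U V := by
  rw [stairI_delta, stairI, stairI, sumSplit_smul, ← sumSplit_add]
  refine sumSplit_congr fun u₀ u' hU => ?_
  rw [sumSplit_smul, ← sumSplit_add]
  refine sumSplit_congr fun v' v₀ hV => ?_
  subst hU hV
  have hcount : (u₀ ++ u' ++ K :: (v' ++ v₀ ++ [N])).count i =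
      u₀.count i + (u' ++ K :: v').count i + (v₀ ++ [N]).count i := by
    simp only [List.count_append, List.count_cons]
    ring
  rw [hcount] at hl
  have hword : u₀ ++ u' ++ K :: (v' ++ v₀ ++ [N]) = u₀ ++ ((u' ++ K :: v') ++ (v₀ ++ [N])) := by
    simp
  have hblock : v₀ ++ N :: u₀ = (v₀ ++ [N]) ++ u₀ := by simp
  have hbcount : (v₀ ++ N :: u₀).count i = (v₀ ++ [N]).count i + u₀.count i := by
    rw [hblock, List.count_append]
  have hfu : ∀ w, w <:+: u' → (curvA 𝔸.μ a w).val = 0 := fun w hw =>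
    flatU w (hw.trans (List.suffix_append u₀ u').isInfix)
  have hfv : ∀ w, w <:+: v' → (curvA 𝔸.μ a w).val = 0 := fun w hw =>
    flatV w (hw.trans (List.prefix_append v' v₀).isInfix)
  have hfm : ∀ p q, p <:+ u' → q <+: v' → (curvM 𝕄.β a m p q).val = 0 := fun p q hp hq =>
    flatm p q (hp.trans (List.suffix_append u₀ u')) (hq.trans (List.prefix_append v' v₀))
  have hfn : (curvM 𝕄.β a n v₀ u₀).val = 0 :=
    flatn _ _ (List.suffix_append v' v₀) (List.prefix_append u₀ u')
  have gM := fun (t : HElt 𝕄.M) => stairM_gauge 𝔸.μ 𝕄.β a a' m m' haa' hmm' (G.triAdditive t)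
    (u := u') (v := v') (by omega) hfu hfv hfm
  have cM : i ∉ u' ++ K :: v' → ∀ g : List (HElt 𝔸.A) → HElt 𝕄.M → List (HElt 𝔸.A) → R,
      stairM (a.gauge 𝔸.μ a') (m.gauge 𝕄.β a' m') g u' v' = stairM a m g u' v' := fun hi g =>
    stairM_cells_congr (fun w hw => a.gauge_of_notMem 𝔸.μ a' hw)
      (fun p q hw => m.gauge_of_notMem 𝕄.β a' m' hw) g hi
  -- If `i` is not in this region, the gauge move changes nothing there, so the gauge formula itself
  -- forces its correction term to be zero.
  have pM : i ∉ u' ++ K :: v' → ∀ t : HElt 𝕄.M,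
      stairM a' m' (precomp 𝔸.μ 𝕄.β fun x y z => G.shifted x y z t) u' v' = 0 := fun hi t => by
    have h := gM t
    rw [cM hi, left_eq_add] at h
    exact (smul_eq_zero_iff_eq _).1 h
  have hX := wt_lower s i u₀
  have hY := wt_lower s i (u' ++ K :: v')
  have hZ := wt_lower s i (v₀ ++ [N])
  set X := wt s u₀
  set Y := wt s (u' ++ K :: v') with hYdef
  set Z := wt s (v₀ ++ [N]) with hZdef
  set X' := wt (lower s i) u₀
  set Y' := wt (lower s i) (u' ++ K :: v') with hYdef'
  set Z' := wt (lower s i) (v₀ ++ [N]) with hZdef'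
  have s1 : X * (wt s u' + s K + wt s (v' ++ v₀) + s N) = X * (Y + Z) := by
    rw [hYdef, hZdef]; simp only [wt_append, wt_cons, wt_nil]; ring
  have s2 : X' * (wt (lower s i) u' + lower s i K + wt (lower s i) (v' ++ v₀) + lower s i N) =
      X' * (Y' + Z') := by
    rw [hYdef', hZdef']; simp only [wt_append, wt_cons, wt_nil]; ring
  have s3 : wt (lower s i) u' + lower s i K + wt (lower s i) v' = Y' := by
    rw [hYdef']; simp only [wt_append, wt_cons]; ring
  rw [s1, s2, s3, hword]
  -- Either `i` lies in the block of `N`, and only the last argument changes, or that block is fixed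
  -- and the formula for one module letter applies. In the first case `i` may lie in `u₀` or in `v₀
  -- ++ [N]`: the linear order of the cyclic word and that of the block differ by moving `u₀` to the
  -- end, which the rotation sign compensates.
  by_cases hb : i ∈ v₀ ++ N :: u₀
  · have hi : i ∉ u' ++ K :: v' := by
      have := List.count_pos_iff.2 hb
      exact List.count_eq_zero.1 (by omega)
    have hY0 : Y' = Y := by rw [hY, List.count_eq_zero.2 hi]; simp
    have e1 : ∀ x y z, G.shifted x y z ((n.gauge 𝕄.β a' n').cell v₀ u₀) =
        G.shifted x y z (n.cell v₀ u₀) + (wtBefore s i (v₀ ++ N :: u₀)).negOnePow •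
          G.shifted x y z (curvM 𝕄.β a' n' v₀ u₀) := fun x y z =>
      (G.hAdditive x y z).gauge 𝕄.β a a' n n' haa' hnn' (by omega) hfn
    rw [cM hi, pM hi, smul_zero, zero_add, stairM_cells_congr haa' hmm' _ hi]
    simp only [e1, stairM_add, stairM_smul, smul_add, smul_smul, ← Int.negOnePow_add]
    congr 2
    rw [Int.negOnePow_eq_iff, hY0, hblock]
    by_cases h0 : i ∈ u₀
    · have h1 : i ∉ v₀ ++ [N] := by
        have := List.count_pos_iff.2 h0
        exact List.count_eq_zero.1 (by omega)
      have h2 : u₀.count i = 1 := by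
        have := List.count_pos_iff.2 h0
        omega
      rw [wtBefore_append_left s h0, wtBefore_append_right s h1, ← hZdef, hX, hZ,
        List.count_eq_zero.2 h1, h2]
      exact ⟨Z, by push_cast; ring⟩
    · have h1 : i ∈ v₀ ++ [N] := by
        rw [hblock, List.mem_append] at hb
        exact hb.resolve_right h0
      have h2 : (v₀ ++ [N]).count i = 1 := by
        have := List.count_pos_iff.2 h1
        omega
      rw [wtBefore_append_left s h1, wtBefore_append_right s h0, wtBefore_append_right s hi, hX, hZ,
        List.count_eq_zero.2 h0, h2]
      exact ⟨-Y, by push_cast; ring⟩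
  · have h0 : i ∉ u₀ := fun h => hb (by simp [h])
    have h1 : i ∉ v₀ ++ [N] := fun h => hb (by rw [hblock]; exact List.mem_append_left _ h)
    have e2 : stairM a' m' (fun x y z => G.shifted x y z (curvM 𝕄.β a' n' v₀ u₀)) u' v' = 0 :=
      sumSplit_eq_zero fun _ _ _ => sumSplit_eq_zero fun _ _ _ => sumParts_eq_zero fun _ _ _ =>
        sumParts_eq_zero fun _ _ _ => (G.hAdditive _ _ _).eq_zero
          ((curvM_congr 𝕄.β haa' hnn' hb).trans hfn)
    rw [e2, smul_zero, add_zero, n.gauge_of_notMem 𝕄.β a' n' hb, hnn' _ _ hb, gM, smul_add,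
      smul_smul, smul_smul, ← Int.negOnePow_add, ← Int.negOnePow_add]
    by_cases hi : i ∈ u' ++ K :: v'
    · have h2 : (u' ++ K :: v').count i = 1 := by
        have := List.count_pos_iff.2 hi
        omega
      congr 2
      rw [Int.negOnePow_eq_iff, wtBefore_append_right s h0, wtBefore_append_left s hi, hX, hY, hZ,
        List.count_eq_zero.2 h0, List.count_eq_zero.2 h1, h2]
      exact ⟨0, by push_cast; ring⟩
    · rw [pM hi, smul_zero, smul_zero]

end InnerGauge

/-! ### Gauge moves on cyclic defining systems -/

section Lowered

variable {R : Type*} [CommRing R] {A M : GrModule R} {α : Type*} [DecidableEq α]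
  {s : α → ℤ} {K : α}

theorem wt_lower_of_notMem {i : α} {w : List α} (h : i ∉ w) : wt (lower s i) w = wt s w := by
  simp [wt_lower, List.count_eq_zero.2 h]

omit [DecidableEq α] in
theorem stairM_eq_zero {G : Type*} [AddCommGroup G] (a : ACells A s) (m : MCells M s K)
    {g : List (HElt A) → HElt M → List (HElt A) → G} (hg : ∀ x y z, g x y z = 0) (u v : List α) :
    stairM a m g u v = 0 :=
  sumSplit_eq_zero fun _ _ _ => sumSplit_eq_zero fun _ _ _ => sumParts_eq_zero fun _ _ _ =>
    sumParts_eq_zero fun _ _ _ => hg _ _ _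

/-- The cells which agree with `a` away from the letter `i`, are `z` on the block `[i]`, and vanish
on all larger blocks with the letter `i`. -/
def ACells.replace (a : ACells A s) (i : α) (z : HElt A) (hz : z.sdeg = s i - 1) :
    ACells A (lower s i) where
  cell w := if i ∈ w then if w = [i] then z else ⟨wt (lower s i) w + 1, 0, zero_mem _⟩
    else a.cell w
  sdeg_cell w := by
    split_ifs with h1 h2
    · simp [h2, hz, lower]
    · rw [HElt.sdeg, add_sub_cancel_right]
    · rw [a.sdeg_cell, wt_lower_of_notMem h1]

/-- The cells which agree with `m` away from the letter `i`, are `z` on the block of `K` only if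
`i = K`, and vanish on all larger blocks with the letter `i`. -/
def MCells.replace (m : MCells M s K) (i : α) (z : HElt M) (hz : z.sdeg = s i - 1) :
    MCells M (lower s i) K where
  cell u v := if i ∈ u ++ K :: v then
      if u = [] ∧ v = [] then z else
        ⟨wt (lower s i) u + lower s i K + wt (lower s i) v + 1, 0, zero_mem _⟩
    else m.cell u v
  sdeg_cell u v := by
    split_ifs with h1 h2
    · obtain ⟨rfl, rfl⟩ := h2
      simp only [List.nil_append, List.mem_singleton] at h1
      subst h1
      simp [hz, lower]
    · rw [HElt.sdeg, add_sub_cancel_right]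
    · have := wt_lower_of_notMem (s := s) h1
      simp only [wt_append, wt_cons] at this
      rw [m.sdeg_cell]
      linarith

theorem ACells.replace_of_notMem (a : ACells A s) (i : α) (z : HElt A) (hz : z.sdeg = s i - 1)
    {w : List α} (h : i ∉ w) : (a.replace i z hz).cell w = a.cell w :=
  if_neg h

theorem MCells.replace_of_notMem (m : MCells M s K) (i : α) (z : HElt M) (hz : z.sdeg = s i - 1)
    {u v : List α} (h : i ∉ u ++ K :: v) : (m.replace i z hz).cell u v = m.cell u v :=
  if_neg h

end Lowered

section CyclicCells

variable {R : Type u} [CommRing R]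

theorem AInfAlgebra.shifted_singleton (𝔸 : AInfAlgebra.{u, v} R) (x : HElt 𝔸.A) :
    (𝔸.μ.shifted [x]).val = 𝔸.d x.val := by
  simp only [Ops.shifted, AInfAlgebra.d, List.map_cons, List.map_nil, shiftExp]
  simp only [List.length_nil, Nat.cast_zero, mul_zero, add_zero, Int.negOnePow_zero, one_smul]
  congr 1
  funext i
  fin_cases i
  rfl

theorem AInfModule.shifted_nil {𝔸 : AInfAlgebra.{u, v} R} (𝕄 : AInfModule.{u, v, w} 𝔸)
    (x : HElt 𝕄.M) : (𝕄.β.shifted [] x []).val = 𝕄.d x.val := by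
  simp only [BiOps.shifted, AInfModule.d, List.map_nil, List.nil_append, shiftExp]
  simp only [List.length_nil, Nat.cast_zero, mul_zero, add_zero, Int.negOnePow_zero, one_smul]
  rw [Subsingleton.elim (fun i : Fin 0 => (([] : List (HElt 𝔸.A)).get i).val) ![]]

/-- A cyclic defining system: cells on the blocks of the cyclic word `U, K, V, N` which do not
contain both module letters `K` and `N`, with vanishing curvature. -/
structure CyclicCells (X : AInfTriple.{u, v, w} R) {α : Type*} (s : α → ℤ) (K N : α)
    (U V : List α) where
  a : ACells X.alg.A s
  m : MCells X.mod.M s K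
  n : MCells X.mod.M s N
  flatU : ∀ w, w <:+: U → (curvA X.alg.μ a w).val = 0
  flatV : ∀ w, w <:+: V → (curvA X.alg.μ a w).val = 0
  flatm : ∀ u v, u <:+ U → v <+: V → (curvM X.mod.β a m u v).val = 0
  flatn : ∀ v u, v <:+ V → u <+: U → (curvM X.mod.β a n v u).val = 0

namespace CyclicCells

variable {X : AInfTriple.{u, v, w} R} {α : Type*} {s : α → ℤ} {K N : α} {U V : List α}

/-- The staircase inner product of a cyclic defining system. -/
def inner (c : CyclicCells X s K N U V) : R :=
  stairI c.a c.m c.n (fun x y z t => X.ip.I.shifted x y z t) U V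

/-- One gauge move at the letter `i`. The correction terms are the relations for `μ`, for `β`, and
`δ(I) = 0`, evaluated on the auxiliary cells, so flatness and the inner product survive. All three
primitives are supplied at once, so that the kind of the letter `i` need not be distinguished. -/
theorem exists_gauge [DecidableEq α] (c : CyclicCells X s K N U V)
    (hnd : (U ++ K :: (V ++ [N])).Nodup) (i : α) (z : HElt X.alg.A) (zm zn : HElt X.mod.M)
    (hz : z.sdeg = s i - 1) (hzm : zm.sdeg = s i - 1) (hzn : zn.sdeg = s i - 1) :
    ∃ c' : CyclicCells X s K N U V, c'.inner = c.inner ∧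
      (∀ j, j ≠ i → (c'.a.cell [j]).val = (c.a.cell [j]).val) ∧
      (c'.a.cell [i]).val = (c.a.cell [i]).val + X.alg.d z.val ∧
      (K ≠ i → (c'.m.cell [] []).val = (c.m.cell [] []).val) ∧
      (K = i → (c'.m.cell [] []).val = (c.m.cell [] []).val + X.mod.d zm.val) ∧
      (N ≠ i → (c'.n.cell [] []).val = (c.n.cell [] []).val) ∧
      (N = i → (c'.n.cell [] []).val = (c.n.cell [] []).val + X.mod.d zn.val) := by
  let a' := c.a.replace i z hz
  let m' := c.m.replace i zm hzm
  let n' := c.n.replace i zn hzn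
  have haa' : ∀ w, i ∉ w → a'.cell w = c.a.cell w := fun w h => c.a.replace_of_notMem i z hz h
  have hmm' : ∀ u v, i ∉ u ++ K :: v → m'.cell u v = c.m.cell u v := fun u v h =>
    c.m.replace_of_notMem i zm hzm h
  have hnn' : ∀ v u, i ∉ v ++ N :: u → n'.cell v u = c.n.cell v u := fun v u h =>
    c.n.replace_of_notMem i zn hzn h
  have hl : (U ++ K :: (V ++ [N])).count i ≤ 1 := List.nodup_iff_count_le_one.1 hnd i
  have hcount : (U ++ K :: (V ++ [N])).count i =
      U.count i + V.count i + [K].count i + [N].count i := by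
    simp only [List.count_append, List.count_cons, List.count_nil]
    ring
  have hcount2 : ∀ (W W' : List α) (L : α),
      (W ++ L :: W').count i = W.count i + W'.count i + [L].count i := by
    intro W W' L
    simp only [List.count_append, List.count_cons, List.count_nil]
    ring
  rw [hcount] at hl
  have flatA : ∀ W w : List α, W.count i ≤ 1 → (∀ w, w <:+: W → (curvA X.alg.μ c.a w).val = 0) →
      w <:+: W → (curvA X.alg.μ (c.a.gauge X.alg.μ a') w).val = 0 := by
    intro W w hW hf hw
    have h := sumParts_gauge X.alg.μ c.a a' haa' (h := fun l => (X.alg.μ.shifted l).val) X.alg.μ.hAdditive w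
      ((hw.sublist.count_le i).trans hW) fun w' hw' => hf w' (hw'.trans hw)
    refine h.trans ?_
    rw [show (sumParts w fun ws => (X.alg.μ.shifted (ws.map c.a.cell)).val) = 0 from hf w hw,
      zero_add, sumParts_eq_zero fun ws _ _ => ?_, smul_zero]
    exact X.alg.rel (ws.map a'.cell)
  have flatM : ∀ (L : α) (p : MCells X.mod.M s L) (p' : MCells X.mod.M (lower s i) L)
      (W W' : List α), (∀ u v, i ∉ u ++ L :: v → p'.cell u v = p.cell u v) →
      (∀ w, w <:+: W → (curvA X.alg.μ c.a w).val = 0) →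
      (∀ w, w <:+: W' → (curvA X.alg.μ c.a w).val = 0) →
      (∀ u v, u <:+ W → v <+: W' → (curvM X.mod.β c.a p u v).val = 0) →
      (W ++ L :: W').count i ≤ 1 →
      ∀ u v, u <:+ W → v <+: W' → (curvM X.mod.β (c.a.gauge X.alg.μ a')
        (p.gauge X.mod.β a' p') u v).val = 0 := by
    intro L p p' W W' hp hW hW' hf hc u v hu hv
    have hc' : (u ++ L :: v).count i ≤ 1 :=
      ((hu.sublist.append (hv.sublist.cons_cons L)).count_le i).trans hc
    have h := stairM_gauge X.alg.μ X.mod.β c.a a' p p' haa' hp X.mod.β.triAdditive hc'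
      (fun w hw => hW w (hw.trans hu.isInfix)) (fun w hw => hW' w (hw.trans hv.isInfix))
      fun u' v' hu' hv' => hf u' v' (hu'.trans hu) (hv'.trans hv)
    refine h.trans ?_
    rw [show stairM c.a p (fun u m v => (X.mod.β.shifted u m v).val) u v = 0 from hf u v hu hv,
      zero_add]
    have h0 : stairM a' p' (precomp X.alg.μ X.mod.β fun u m v => (X.mod.β.shifted u m v).val)
        u v = 0 :=
      stairM_eq_zero _ _ X.mod.rel _ _
    rw [h0, smul_zero]
  have diagM : ∀ (L : α) (p : MCells X.mod.M s L) (ζ : HElt X.mod.M) (hζ : ζ.sdeg = s i - 1),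
      (L ≠ i → ((p.gauge X.mod.β a' (p.replace i ζ hζ)).cell [] []).val = (p.cell [] []).val) ∧
      (L = i → ((p.gauge X.mod.β a' (p.replace i ζ hζ)).cell [] []).val =
        (p.cell [] []).val + X.mod.d ζ.val) := by
    intro L p ζ hζ
    constructor
    · intro h
      rw [p.gauge_of_notMem X.mod.β a' _ (by simpa using Ne.symm h)]
    · rintro rfl
      rw [p.gauge_val X.mod.β a' _ (by simp)]
      congr 1
      rw [← X.mod.shifted_nil]
      -- The one-letter block has only the trivial cut and nothing precedes its letter, so the
      -- correction is the differential with sign `+1`.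
      simp [wtBefore, curvM, stairM, sumSplit_nil, sumParts_nil, MCells.replace]
  refine ⟨⟨c.a.gauge X.alg.μ a', c.m.gauge X.mod.β a' m', c.n.gauge X.mod.β a' n',
    fun w => flatA U w (by omega) c.flatU, fun w => flatA V w (by omega) c.flatV,
    flatM K c.m m' U V hmm' c.flatU c.flatV c.flatm ?_,
    flatM N c.n n' V U hnn' c.flatV c.flatU c.flatn ?_⟩, ?_, ?_, ?_,
    (diagM K c.m zm hzm).1, (diagM K c.m zm hzm).2, (diagM N c.n zn hzn).1,
    (diagM N c.n zn hzn).2⟩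
  · rw [hcount2]
    omega
  · rw [hcount2]
    omega
  · rw [inner, stairI_gauge X.mod X.ip.I c.a a' c.m m' c.n n' haa' hmm' hnn' (by omega)
      c.flatU c.flatV c.flatm c.flatn]
    have h0 : stairI a' m' n' (X.mod.delta X.ip.I) U V = 0 :=
      sumSplit_eq_zero fun _ _ _ => sumSplit_eq_zero fun _ _ _ => by
        rw [stairM_eq_zero a' m' (fun _ _ _ => X.ip.rel _ _ _ _), smul_zero]
    rw [h0, smul_zero, add_zero, inner]
  · intro j hj
    rw [c.a.gauge_of_notMem X.alg.μ a' (by simpa using Ne.symm hj)]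
  · rw [c.a.gauge_val X.alg.μ a' (by simp), ← X.alg.shifted_singleton]
    congr 1
    simp [wtBefore, curvA, sumParts_cons, sumSplit_nil, sumParts_nil, a', ACells.replace]

end CyclicCells

end CyclicCells

section Differentials

variable {R : Type u} [CommRing R]

theorem AInfAlgebra.d_zero (𝔸 : AInfAlgebra.{u, v} R) : 𝔸.d 0 = 0 :=
  MultilinearMap.map_coord_zero _ 0 rfl

theorem AInfModule.d_zero {𝔸 : AInfAlgebra.{u, v} R} (𝕄 : AInfModule.{u, v, w} 𝔸) : 𝕄.d 0 = 0 := by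
  simp [AInfModule.d]

end Differentials

namespace CyclicCells

variable {R : Type u} [CommRing R] {X : AInfTriple.{u, v, w} R} {α : Type*} {s : α → ℤ} {K N : α}
  {U V : List α}

/-- The diagonal entries of a cyclic defining system may be replaced by cohomologous ones. -/
theorem exists_of_cohomologous [DecidableEq α] (c : CyclicCells X s K N U V)
    (hnd : (U ++ K :: (V ++ [N])).Nodup) (x : α → HElt X.alg.A) (m n : HElt X.mod.M)
    (hx : ∀ j ∈ U ++ V, ∃ z : HElt X.alg.A, z.sdeg = s j - 1 ∧
      (x j).val = (c.a.cell [j]).val + X.alg.d z.val)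
    (hm : ∃ z : HElt X.mod.M, z.sdeg = s K - 1 ∧ m.val = (c.m.cell [] []).val + X.mod.d z.val)
    (hn : ∃ z : HElt X.mod.M, z.sdeg = s N - 1 ∧ n.val = (c.n.cell [] []).val + X.mod.d z.val) :
    ∃ c' : CyclicCells X s K N U V, c'.inner = c.inner ∧
      (∀ j ∈ U ++ V, (c'.a.cell [j]).val = (x j).val) ∧
      (c'.m.cell [] []).val = m.val ∧ (c'.n.cell [] []).val = n.val := by
  -- The letters are corrected one by one, with `P` those already treated. Every diagonal entry
  -- stays cohomologous to its target, and a move at `i` leaves the other diagonal entries alone.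
  suffices h : ∀ P : List α, ∃ c' : CyclicCells X s K N U V, c'.inner = c.inner ∧
      (∀ j ∈ U ++ V, ∃ z : HElt X.alg.A, z.sdeg = s j - 1 ∧
        (x j).val = (c'.a.cell [j]).val + X.alg.d z.val) ∧
      (∃ z : HElt X.mod.M, z.sdeg = s K - 1 ∧ m.val = (c'.m.cell [] []).val + X.mod.d z.val) ∧
      (∃ z : HElt X.mod.M, z.sdeg = s N - 1 ∧ n.val = (c'.n.cell [] []).val + X.mod.d z.val) ∧
      (∀ j ∈ U ++ V, j ∈ P → (c'.a.cell [j]).val = (x j).val) ∧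
      (K ∈ P → (c'.m.cell [] []).val = m.val) ∧ (N ∈ P → (c'.n.cell [] []).val = n.val) by
    obtain ⟨c', h1, -, -, -, h2, h3, h4⟩ := h (U ++ V ++ [K, N])
    exact ⟨c', h1, fun j hj => h2 j hj (List.mem_append_left _ hj), h3 (by simp), h4 (by simp)⟩
  intro P
  induction P with
  | nil => exact ⟨c, rfl, hx, hm, hn, by simp, by simp, by simp⟩
  | cons i P ih =>
    obtain ⟨c₁, h1, hx₁, hm₁, hn₁, hxP, hmP, hnP⟩ := ih
    have ez : ∃ z : HElt X.alg.A, z.sdeg = s i - 1 ∧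
        (i ∈ U ++ V → (x i).val = (c₁.a.cell [i]).val + X.alg.d z.val) := by
      by_cases hi : i ∈ U ++ V
      · obtain ⟨z, hz, hz'⟩ := hx₁ i hi
        exact ⟨z, hz, fun _ => hz'⟩
      · exact ⟨⟨s i, 0, zero_mem _⟩, rfl, fun h => absurd h hi⟩
    -- If `i` is not the module letter in question, a zero of shifted degree `s i - 1` serves as the
    -- unused primitive.
    have em : ∀ (L : α) (t p : HElt X.mod.M), (∃ z : HElt X.mod.M, z.sdeg = s L - 1 ∧
        t.val = p.val + X.mod.d z.val) → ∃ z : HElt X.mod.M, z.sdeg = s i - 1 ∧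
        (L = i → t.val = p.val + X.mod.d z.val) := by
      rintro L t p ⟨z, hz, hz'⟩
      by_cases hi : L = i
      · subst hi
        exact ⟨z, hz, fun _ => hz'⟩
      · exact ⟨⟨s i, 0, zero_mem _⟩, rfl, fun h => absurd h hi⟩
    obtain ⟨z, hz, hz'⟩ := ez
    obtain ⟨zm, hzm, hzm'⟩ := em K m _ hm₁
    obtain ⟨zn, hzn, hzn'⟩ := em N n _ hn₁
    obtain ⟨c₂, g1, g2, g3, g4, g5, g6, g7⟩ := c₁.exists_gauge hnd i z zm zn hz hzm hzn
    have kx : ∀ j ∈ U ++ V, j = i → (c₂.a.cell [j]).val = (x j).val := by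
      rintro j hj rfl
      rw [g3, hz' hj]
    have km : K = i → (c₂.m.cell [] []).val = m.val := fun h => by rw [g5 h, hzm' h]
    have kn : N = i → (c₂.n.cell [] []).val = n.val := fun h => by rw [g7 h, hzn' h]
    refine ⟨c₂, g1.trans h1, fun j hj => ?_, ?_, ?_, fun j hj hjP => ?_, fun hP => ?_, fun hP => ?_⟩
    · by_cases h : j = i
      · exact ⟨⟨s j, 0, zero_mem _⟩, rfl, by rw [X.alg.d_zero, add_zero, kx j hj h]⟩
      · rw [g2 j h]
        exact hx₁ j hj
    · by_cases h : K = i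
      · exact ⟨⟨s K, 0, zero_mem _⟩, rfl, by rw [X.mod.d_zero, add_zero, km h]⟩
      · rw [g4 h]
        exact hm₁
    · by_cases h : N = i
      · exact ⟨⟨s N, 0, zero_mem _⟩, rfl, by rw [X.mod.d_zero, add_zero, kn h]⟩
      · rw [g6 h]
        exact hn₁
    · by_cases h : j = i
      · exact kx j hj h
      · rw [g2 j h]
        exact hxP j hj ((List.mem_cons.1 hjP).resolve_left h)
    · by_cases h : K = i
      · exact km h
      · rw [g4 h]
        exact hmP ((List.mem_cons.1 hP).resolve_left h)
    · by_cases h : N = i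
      · exact kn h
      · rw [g6 h]
        exact hnP ((List.mem_cons.1 hP).resolve_left h)

end CyclicCells

/-! ### Pushing words with zero products forward along morphisms -/

section Pushforward

variable {R : Type*} [CommRing R]

/-- A homogeneous element multiplied by a sign. -/
def HElt.sign {X : GrModule R} (ε : ℤˣ) (x : HElt X) : HElt X :=
  ⟨x.deg, ε • x.val, zsmul_mem x.mem _⟩

theorem HAdditive.sign {X : GrModule R} {G : Type*} [AddCommGroup G] {g : HElt X → G}
    (hg : HAdditive g) (ε : ℤˣ) (x : HElt X) : g (x.sign ε) = ε • g x :=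
  hg.smul_val (x := x) (y := x.sign ε) rfl ε rfl

theorem sdegs_map_eq {X : GrModule R} {α : Type*} {s : α → ℤ} {x : α → HElt X}
    (hx : ∀ j, (x j).sdeg = s j) (l : List α) : sdegs (l.map x) = wt s l := by
  simp only [sdegs, wt, List.map_map]
  congr 2
  funext j
  exact hx j

theorem precomp_eq_zero {A M : GrModule R} {G : Type*} [AddCommGroup G] (μ : Ops A A 2)
    (β : BiOps A M M 1) {g : List (HElt A) → HElt M → List (HElt A) → G} (hg : TriAdditive g)
    {u : List (HElt A)} {m : HElt M} {v : List (HElt A)}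
    (hu : ∀ w, w <:+: u → (μ.shifted w).val = 0) (hv : ∀ w, w <:+: v → (μ.shifted w).val = 0)
    (hm : ∀ p q, p <:+ u → q <+: v → (β.shifted p m q).val = 0) :
    precomp μ β g u m v = 0 := by
  rw [precomp, sumSplit_eq_zero, sumSplit_eq_zero, sumSplit_eq_zero, add_zero, add_zero]
  · rintro v₁ r rfl
    refine sumSplit_eq_zero ?_
    rintro p v₂ rfl
    rw [(hg.right _ _ _ _).eq_zero (hv p ⟨v₁, v₂, by simp⟩), smul_zero]
  · rintro u₁ u₂ rfl
    refine sumSplit_eq_zero ?_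
    rintro v₁ v₂ rfl
    rw [(hg.mid _ _).eq_zero (hm u₂ v₁ (List.suffix_append _ _) (List.prefix_append _ _)),
      smul_zero]
  · rintro u₁ r rfl
    refine sumSplit_eq_zero ?_
    rintro p u₂ rfl
    rw [(hg.left _ _ _ _).eq_zero (hu p ⟨u₁, u₂, by simp⟩), smul_zero]

variable {α : Type*} {s : α → ℤ} {K : α}

/-- The cells `f(y_p, …, y_q)`. -/
def ACells.ofMorphism {𝔸 𝔹 : AInfAlgebra R} (f : AInfMorphism 𝔸 𝔹) (y : α → HElt 𝔸.A)
    (hy : ∀ j, (y j).sdeg = s j) : ACells 𝔹.A s where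
  cell w := f.f.shifted (w.map y)
  sdeg_cell w := by
    simp [HElt.sdeg, Ops.shifted, sdegs_map_eq hy]

/-- The cells `± F(y_p, …, y_K, …, y_q)`. -/
def MCells.ofMorphism {𝔸 𝔹 : AInfAlgebra R} {f : AInfMorphism 𝔸 𝔹} {𝕄 : AInfModule 𝔸}
    {𝕃 : AInfModule 𝔹} (F : AInfModuleMorphism f 𝕄 𝕃) (y : α → HElt 𝔸.A)
    (hy : ∀ j, (y j).sdeg = s j) (m : HElt 𝕄.M) (hm : F.deg + m.sdeg = s K) :
    MCells 𝕃.M s K where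
  cell u v := (F.F.shifted (u.map y) m (v.map y)).sign (F.deg * wt s u).negOnePow
  sdeg_cell u v := by
    rw [← hm]
    simp [HElt.sdeg, HElt.sign, BiOps.shifted, sdegs_map_eq hy]
    ring

/-- The curvature is the side `ν ∘ f` of the morphism equation. Each term on the side `f ∘ μ`
contains an operation on a subword of the `y`'s, which is zero. -/
theorem curvA_ofMorphism {𝔸 𝔹 : AInfAlgebra R} (f : AInfMorphism 𝔸 𝔹) (y : α → HElt 𝔸.A)
    (hy : ∀ j, (y j).sdeg = s j) {l : List α}
    (hl : ∀ w, w <:+: l → (𝔸.μ.shifted (w.map y)).val = 0) :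
    (curvA 𝔹.μ (.ofMorphism f y hy) l).val = 0 := by
  have h := f.rel (l.map y)
  rw [sumParts_map] at h
  have e : (curvA 𝔹.μ (.ofMorphism f y hy) l).val =
      sumParts l fun ws => (𝔹.μ.shifted ((ws.map (List.map y)).map f.f.shifted)).val :=
    sumParts_congr fun ws _ _ => by rw [List.map_map]; rfl
  rw [e, ← h, sumSplit_map]
  refine sumSplit_eq_zero ?_
  rintro u r rfl
  rw [sumSplit_map]
  refine sumSplit_eq_zero ?_
  rintro v w rfl
  rw [(f.f.hAdditive _ _).eq_zero (hl v ⟨u, w, by simp⟩), smul_zero]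

theorem infix_map {β : Type*} {P : List β → Prop} {y : α → β} {l : List α}
    (h : ∀ w, w <:+: l → P (w.map y)) : ∀ w, w <:+: l.map y → P w := by
  rintro w ⟨p, q, e⟩
  obtain ⟨pw, q', rfl, e1, -⟩ := List.map_eq_append_iff.1 e.symm
  obtain ⟨p', w', rfl, -, rfl⟩ := List.map_eq_append_iff.1 e1
  exact h w' ⟨p', q', rfl⟩

theorem affix_map {β : Type*} {P : List β → List β → Prop} {y : α → β} {l : List α} {l' : List α}
    (h : ∀ u v, u <:+ l → v <+: l' → P (u.map y) (v.map y)) :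
    ∀ u v, u <:+ l.map y → v <+: l'.map y → P u v := by
  rintro u v ⟨p, e⟩ ⟨q, e'⟩
  obtain ⟨p', u', rfl, -, rfl⟩ := List.map_eq_append_iff.1 e.symm
  obtain ⟨v', q', rfl, rfl, -⟩ := List.map_eq_append_iff.1 e'.symm
  exact h _ _ (List.suffix_append _ _) (List.prefix_append _ _)

theorem stairM_ofMorphism {𝔸 𝔹 : AInfAlgebra R} {f : AInfMorphism 𝔸 𝔹} {𝕄 : AInfModule 𝔸}
    {𝕃 : AInfModule 𝔹} (F : AInfModuleMorphism f 𝕄 𝕃) (y : α → HElt 𝔸.A)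
    (hy : ∀ j, (y j).sdeg = s j) (m : HElt 𝕄.M) (hm : F.deg + m.sdeg = s K) {G : Type*}
    [AddCommGroup G] {g : List (HElt 𝔹.A) → HElt 𝕃.M → List (HElt 𝔹.A) → G} (hg : TriAdditive g)
    (u v : List α) :
    stairM (.ofMorphism f y hy) (.ofMorphism (K := K) F y hy m hm) g u v =
      sumSplit (u.map y) fun u₁ u₂ => sumSplit (v.map y) fun v₁ v₂ =>
        sumParts u₁ fun ws => sumParts v₂ fun zs => (F.deg * sdegs u₂).negOnePow •
          g (ws.map f.f.shifted) (F.F.shifted u₂ m v₁) (zs.map f.f.shifted) := by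
  simp only [sumSplit_map, sumParts_map, stairM, ACells.ofMorphism, MCells.ofMorphism,
    (hg.mid _ _).sign, sdegs_map_eq hy, List.map_map, Function.comp_def]

theorem curvM_ofMorphism {𝔸 𝔹 : AInfAlgebra R} {f : AInfMorphism 𝔸 𝔹} {𝕄 : AInfModule 𝔸}
    {𝕃 : AInfModule 𝔹} (F : AInfModuleMorphism f 𝕄 𝕃) (y : α → HElt 𝔸.A)
    (hy : ∀ j, (y j).sdeg = s j) (m : HElt 𝕄.M) (hm : F.deg + m.sdeg = s K) {u v : List α}
    (hu : ∀ w, w <:+: u → (𝔸.μ.shifted (w.map y)).val = 0)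
    (hv : ∀ w, w <:+: v → (𝔸.μ.shifted (w.map y)).val = 0)
    (h : ∀ p q, p <:+ u → q <+: v → (𝕄.β.shifted (p.map y) m (q.map y)).val = 0) :
    (curvM 𝕃.β (.ofMorphism f y hy) (.ofMorphism (K := K) F y hy m hm) u v).val = 0 := by
  have h1 := F.rel (u.map y) m (v.map y)
  rw [precomp_eq_zero 𝔸.μ 𝕄.β F.F.triAdditive (infix_map hu) (infix_map hv)
    (affix_map h), eq_comm, smul_eq_zero_iff_eq] at h1
  refine (stairM_ofMorphism F y hy m hm 𝕃.β.triAdditive u v).trans ?_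
  -- The cells carry the sign of moving `F` past `u₂`, the morphism equation that of moving it past
  -- `u₁`. They differ by the sign for all of `u`, which does not depend on the cut.
  rw [← (smul_eq_zero_iff_eq (F.deg * sdegs (u.map y)).negOnePow), ← h1, sumSplit_smul]
  refine sumSplit_congr fun u₁ u₂ e => ?_
  simp only [sumSplit_smul, sumParts_smul, smul_smul, ← Int.negOnePow_add]
  refine sumSplit_congr fun v₁ v₂ _ => sumParts_congr fun ws _ _ => sumParts_congr fun zs _ _ => ?_
  congr 1
  rw [Int.negOnePow_eq_iff, ← e]
  simp only [sdegs, List.map_append, List.sum_append]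
  exact ⟨F.deg * (u₂.map HElt.sdeg).sum, by ring⟩

end Pushforward

section ZeroCells

variable {R : Type*} [CommRing R] {A M : GrModule R} {α : Type*} {s : α → ℤ} {K : α}

/-- The cells which are all zero. -/
def MCells.zero (M : GrModule R) (s : α → ℤ) (K : α) : MCells M s K where
  cell u v := ⟨wt s u + s K + wt s v + 1, 0, zero_mem _⟩
  sdeg_cell _ _ := add_sub_cancel_right _ _

theorem stairM_zero (a : ACells A s) {G : Type*} [AddCommGroup G]
    {g : List (HElt A) → HElt M → List (HElt A) → G} (hg : TriAdditive g) (u v : List α) :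
    stairM a (MCells.zero M s K) g u v = 0 :=
  sumSplit_eq_zero fun _ _ _ => sumSplit_eq_zero fun _ _ _ => sumParts_eq_zero fun _ _ _ =>
    sumParts_eq_zero fun _ _ _ => (hg.mid _ _).eq_zero rfl

end ZeroCells

namespace CyclicCells

variable {R : Type u} [CommRing R] {X : AInfTriple.{u, v, w} R} {α : Type*} {s : α → ℤ} {K N : α}
  {U V : List α}

/-- The cyclic defining system with the entries `f(y_p, …, y_q)` and `0` in the module. -/
def ofAlgebraMorphism {𝔸 : AInfAlgebra R} (f : AInfMorphism 𝔸 X.alg) (y : α → HElt 𝔸.A)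
    (hy : ∀ j, (y j).sdeg = s j)
    (hU : ∀ w, w <:+: U → (𝔸.μ.shifted (w.map y)).val = 0)
    (hV : ∀ w, w <:+: V → (𝔸.μ.shifted (w.map y)).val = 0) : CyclicCells X s K N U V where
  a := .ofMorphism f y hy
  m := .zero _ _ _
  n := .zero _ _ _
  flatU _ hw := curvA_ofMorphism f y hy fun w' hw' => hU w' (hw'.trans hw)
  flatV _ hw := curvA_ofMorphism f y hy fun w' hw' => hV w' (hw'.trans hw)
  flatm _ _ _ _ := stairM_zero _ X.mod.β.triAdditive _ _
  flatn _ _ _ _ := stairM_zero _ X.mod.β.triAdditive _ _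

theorem inner_ofAlgebraMorphism {𝔸 : AInfAlgebra R} (f : AInfMorphism 𝔸 X.alg) (y : α → HElt 𝔸.A)
    (hy : ∀ j, (y j).sdeg = s j)
    (hU : ∀ w, w <:+: U → (𝔸.μ.shifted (w.map y)).val = 0)
    (hV : ∀ w, w <:+: V → (𝔸.μ.shifted (w.map y)).val = 0) :
    (ofAlgebraMorphism (K := K) (N := N) f y hy hU hV).inner = 0 := by
  rw [inner, stairI]
  exact sumSplit_eq_zero fun _ _ _ => sumSplit_eq_zero fun _ _ _ => by
    simp only [ofAlgebraMorphism]
    rw [stairM_zero _ (X.ip.I.triAdditive _), smul_zero]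

variable {Y : AInfTriple R} (ψ : AInfTripleMorphism Y X) (y : α → HElt Y.alg.A)
  (hy : ∀ j, (y j).sdeg = s j) (m n : HElt Y.mod.M) (hm : ψ.F.deg + m.sdeg = s K)
  (hn : ψ.F.deg + n.sdeg = s N)
  (hU : ∀ w, w <:+: U → (Y.alg.μ.shifted (w.map y)).val = 0)
  (hV : ∀ w, w <:+: V → (Y.alg.μ.shifted (w.map y)).val = 0)
  (hM : ∀ p q, p <:+ U → q <+: V → (Y.mod.β.shifted (p.map y) m (q.map y)).val = 0)
  (hN : ∀ q p, q <:+ V → p <+: U → (Y.mod.β.shifted (q.map y) n (p.map y)).val = 0)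

/-- The cyclic defining system with the entries `f(y_p, …, y_q)` and `± F(y_p, …, y_q)`. -/
def ofMorphism : CyclicCells X s K N U V where
  a := .ofMorphism ψ.f y hy
  m := .ofMorphism ψ.F y hy m hm
  n := .ofMorphism ψ.F y hy n hn
  flatU _ hw := curvA_ofMorphism ψ.f y hy fun w' hw' => hU w' (hw'.trans hw)
  flatV _ hw := curvA_ofMorphism ψ.f y hy fun w' hw' => hV w' (hw'.trans hw)
  flatm _ _ hu hv := curvM_ofMorphism ψ.F y hy m hm (fun w hw => hU w (hw.trans hu.isInfix))
    (fun w hw => hV w (hw.trans hv.isInfix)) fun p q hp hq => hM p q (hp.trans hu) (hq.trans hv)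
  flatn _ _ hv hu := curvM_ofMorphism ψ.F y hy n hn (fun w hw => hV w (hw.trans hv.isInfix))
    (fun w hw => hU w (hw.trans hu.isInfix)) fun q p hq hp => hN q p (hq.trans hv) (hp.trans hu)

/-- The staircase inner product of the pushed forward cells is, up to sign, the pullback of the
inner product of `X` evaluated on the letters. This equals the inner product of `Y` plus `δ(G)`, and
`δ(G)` vanishes on letters all of whose products are zero. -/
theorem inner_ofMorphism (h : Y.ip.I.shifted (U.map y) m (V.map y) n = 0) :
    (ofMorphism ψ y hy m n hm hn hU hV hM hN).inner = 0 := by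
  obtain ⟨e, G, hG⟩ := ψ.exact
  have hd : Y.mod.delta G (U.map y) m (V.map y) n = 0 := by
    rw [AInfModule.delta_eq, precomp_eq_zero _ _ (G.triAdditive n) (infix_map hU) (infix_map hV)
      (affix_map (P := fun p q => (Y.mod.β.shifted p m q).val = 0) hM), zero_add]
    refine sumSplit_eq_zero ?_
    intro u₁ u₂ hu
    refine sumSplit_eq_zero fun v₁ v₂ hv => ?_
    rw [(G.hAdditive _ _ _).eq_zero, smul_zero]
    exact affix_map (P := fun p q => (Y.mod.β.shifted p n q).val = 0) hN v₂ u₁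
      (hv ▸ List.suffix_append _ _) (hu ▸ List.prefix_append _ _)
  have hp : ψ.F.pullback X.ip (U.map y) m (V.map y) n = 0 := by
    have := hG (U.map y) m (V.map y) n
    rwa [hd, h, sub_zero] at this
  -- This global sign is the discrepancy between the Koszul signs of the pullback and those carried
  -- by the two kinds of module cells.
  rw [← smul_eq_zero_iff_eq (ψ.F.deg * (m.sdeg + wt s V)).negOnePow, ← hp]
  simp only [inner, stairI, ofMorphism]
  rw [AInfModuleMorphism.pullback, sumSplit_map, sumSplit_smul]
  refine sumSplit_congr fun u₀ u' hu => ?_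
  rw [sumSplit_smul, sumSplit_comm, sumSplit_map y V]
  refine sumSplit_congr fun v' v₀ hv => ?_
  rw [stairM_ofMorphism ψ.F y hy m hm (X.ip.I.triAdditive _)]
  simp only [sumSplit_smul, sumParts_smul, smul_smul]
  refine sumSplit_congr fun u₁ u₂ hu' => sumSplit_congr fun v₁ v₂ hv' => sumParts_congr fun ws _ _ =>
    sumParts_congr fun zs _ _ => ?_
  simp only [MCells.ofMorphism]
  rw [(X.ip.I.hAdditive _ _ _).sign, smul_smul, ← Int.negOnePow_add, ← Int.negOnePow_add,
    ← Int.negOnePow_add]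
  congr 1
  rw [Int.negOnePow_eq_iff, ← hm, ← hn]
  have e1 : wt s u' = sdegs u₁ + sdegs u₂ := by
    rw [← sdegs_map_eq hy u', ← hu']
    simp [sdegs]
  simp only [sdegs_map_eq hy, e1, ← hv, wt_append]
  exact ⟨wt s u₀ * ψ.F.deg - ψ.F.deg * sdegs u₁ + ψ.F.deg * wt s v₀, by ring⟩

end CyclicCells

/-! ### Exact products become zero when the target has no differential -/

section Products

variable {R : Type*} [CommRing R]

theorem Ops.shifted_nil {X Y : GrModule R} {e : ℤ} (φ : Ops X Y e) :
    (φ.shifted []).val = 0 := by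
  simp only [Ops.shifted, List.length_nil, φ.map_zero]
  exact smul_zero _

theorem AInfMorphism.map_differential {𝔸 𝔹 : AInfAlgebra R} (f : AInfMorphism 𝔸 𝔹)
    (x : HElt 𝔸.A) : (f.f.shifted [𝔸.μ.shifted [x]]).val = (𝔹.μ.shifted [f.f.shifted [x]]).val := by
  have h := f.rel [x]
  simp only [sumSplit_cons, sumSplit_nil, sumParts_cons, sumParts_nil, List.nil_append,
    List.map_cons, List.map_nil] at h
  have e1 : (f.f.shifted (𝔸.μ.shifted [] :: [x])).val = 0 :=
    (f.f.hAdditive [] [x]).eq_zero 𝔸.μ.shifted_nil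
  have e2 : (f.f.shifted ([x] ++ [𝔸.μ.shifted []])).val = 0 :=
    (f.f.hAdditive [x] []).eq_zero 𝔸.μ.shifted_nil
  rw [e1, e2] at h
  simpa [sdegs] using h

/-- A morphism to an algebra without differential kills the products which are boundaries. -/
theorem AInfMorphism.product_eq_zero {𝔸 𝔹 : AInfAlgebra R} (f : AInfMorphism 𝔸 𝔹)
    (hd : ∀ x, (𝔹.μ.shifted [x]).val = 0) {p q c : HElt 𝔸.A} (hp : (𝔸.μ.shifted [p]).val = 0)
    (hq : (𝔸.μ.shifted [q]).val = 0) (hc : c.sdeg = p.sdeg + q.sdeg)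
    (h : (𝔸.μ.shifted [c]).val = -(𝔸.μ.shifted [p, q]).val) :
    (𝔹.μ.shifted [f.f.shifted [p], f.f.shifted [q]]).val = 0 := by
  have h1 := f.rel [p, q]
  simp only [sumSplit_cons, sumSplit_nil, sumParts_cons, sumParts_nil, List.nil_append,
    List.map_cons, List.map_nil] at h1
  have e1 : (f.f.shifted (𝔸.μ.shifted [] :: [p, q])).val = 0 :=
    (f.f.hAdditive [] [p, q]).eq_zero 𝔸.μ.shifted_nil
  have e2 : (f.f.shifted ([p] ++ 𝔸.μ.shifted [] :: [q])).val = 0 :=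
    (f.f.hAdditive [p] [q]).eq_zero 𝔸.μ.shifted_nil
  have e3 : (f.f.shifted ([p, q] ++ [𝔸.μ.shifted []])).val = 0 :=
    (f.f.hAdditive [p, q] []).eq_zero 𝔸.μ.shifted_nil
  have e4 : (f.f.shifted (𝔸.μ.shifted [p] :: [q])).val = 0 := (f.f.hAdditive [] [q]).eq_zero hp
  have e5 : (f.f.shifted ([p] ++ [𝔸.μ.shifted [q]])).val = 0 := (f.f.hAdditive [p] []).eq_zero hq
  -- The product is minus the differential of `c`, and `f₁` is a chain map into an algebra without
  -- differential.
  have e6 : (f.f.shifted [𝔸.μ.shifted [p, q]]).val = 0 := by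
    have h2 := (f.f.hAdditive [] []).smul_val (x := 𝔸.μ.shifted [c]) (y := 𝔸.μ.shifted [p, q])
      (by simp [Ops.shifted, sdegs, hc]) (-1) (by rw [h]; simp)
    simp only [List.nil_append] at h2
    rw [h2, f.map_differential, hd, smul_zero]
  rw [e1, e2, e3, e4, e5, e6, hd] at h1
  simpa using h1.symm

variable {𝔸 𝔹 : AInfAlgebra R} {f : AInfMorphism 𝔸 𝔹} {𝕄 : AInfModule 𝔸} {𝕃 : AInfModule 𝔹}

theorem AInfModuleMorphism.map_differential (F : AInfModuleMorphism f 𝕄 𝕃)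
    (hd : ∀ x, (𝕃.β.shifted [] x []).val = 0) (x : HElt 𝕄.M) :
    (F.F.shifted [] (𝕄.β.shifted [] x []) []).val = 0 := by
  have h := F.rel [] x []
  simp only [precomp, sumSplit_nil, sumParts_nil, List.nil_append, List.map_nil, hd] at h
  have e1 : (F.F.shifted [𝔸.μ.shifted []] x []).val = 0 :=
    (F.F.triAdditive.left [] [] x []).eq_zero 𝔸.μ.shifted_nil
  have e2 : (F.F.shifted [] x [𝔸.μ.shifted []]).val = 0 :=
    (F.F.triAdditive.right [] x [] []).eq_zero 𝔸.μ.shifted_nil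
  rw [e1, e2] at h
  simpa [sdegs] using h

/-- In the morphism equation on `p` and `m`, terms with `d p` or `d m` vanish since both are
cocycles, and terms with the differential of the target vanish by `hd`. The image of the action is
that of a boundary, hence zero, so only the action of the images is left. -/
theorem AInfModuleMorphism.left_product_eq_zero (F : AInfModuleMorphism f 𝕄 𝕃)
    (hd : ∀ x, (𝕃.β.shifted [] x []).val = 0) {p : HElt 𝔸.A} {m c : HElt 𝕄.M}
    (hp : (𝔸.μ.shifted [p]).val = 0) (hm : (𝕄.β.shifted [] m []).val = 0)
    (hc : c.sdeg = p.sdeg + m.sdeg)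
    (h : (𝕄.β.shifted [] c []).val = -(𝕄.β.shifted [p] m []).val) :
    (𝕃.β.shifted [f.f.shifted [p]] (F.F.shifted [] m []) []).val = 0 := by
  have h1 := F.rel [p] m []
  simp only [precomp, sumSplit_cons, sumSplit_nil, sumParts_cons, sumParts_nil, List.nil_append,
    List.map_cons, List.map_nil, hd] at h1
  have e1 : (F.F.shifted (𝔸.μ.shifted [] :: [p]) m []).val = 0 :=
    (F.F.triAdditive.left [] [p] m []).eq_zero 𝔸.μ.shifted_nil
  have e2 : (F.F.shifted ([p] ++ [𝔸.μ.shifted []]) m []).val = 0 :=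
    (F.F.triAdditive.left [p] [] m []).eq_zero 𝔸.μ.shifted_nil
  have e3 : (F.F.shifted [𝔸.μ.shifted [p]] m []).val = 0 :=
    (F.F.triAdditive.left [] [] m []).eq_zero hp
  have e4 : (F.F.shifted [p] m [𝔸.μ.shifted []]).val = 0 :=
    (F.F.triAdditive.right [p] m [] []).eq_zero 𝔸.μ.shifted_nil
  have e5 : (F.F.shifted [p] (𝕄.β.shifted [] m []) []).val = 0 :=
    (F.F.triAdditive.mid [p] []).eq_zero hm
  have e6 : (F.F.shifted [] (𝕄.β.shifted [p] m []) []).val = 0 := by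
    have h2 := (F.F.triAdditive.mid [] []).smul_val (x := 𝕄.β.shifted [] c [])
      (y := 𝕄.β.shifted [p] m []) (by
        simp only [HElt.sdeg] at hc
        simp [BiOps.shifted, sdegs, HElt.sdeg]
        linarith) (-1) (by rw [h]; simp)
    rw [h2, F.map_differential hd, smul_zero]
  rw [e1, e2, e3, e4, e5, e6] at h1
  simp only [smul_zero, add_zero, zero_add] at h1
  rw [eq_comm, smul_eq_zero_iff_eq, smul_eq_zero_iff_eq] at h1
  exact h1

theorem AInfModuleMorphism.right_product_eq_zero (F : AInfModuleMorphism f 𝕄 𝕃)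
    (hd : ∀ x, (𝕃.β.shifted [] x []).val = 0) {p : HElt 𝔸.A} {m c : HElt 𝕄.M}
    (hp : (𝔸.μ.shifted [p]).val = 0) (hm : (𝕄.β.shifted [] m []).val = 0)
    (hc : c.sdeg = m.sdeg + p.sdeg)
    (h : (𝕄.β.shifted [] c []).val = -(𝕄.β.shifted [] m [p]).val) :
    (𝕃.β.shifted [] (F.F.shifted [] m []) [f.f.shifted [p]]).val = 0 := by
  have h1 := F.rel [] m [p]
  simp only [precomp, sumSplit_cons, sumSplit_nil, sumParts_cons, sumParts_nil, List.nil_append,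
    List.map_cons, List.map_nil, hd] at h1
  have e1 : (F.F.shifted [] m (𝔸.μ.shifted [] :: [p])).val = 0 :=
    (F.F.triAdditive.right [] m [] [p]).eq_zero 𝔸.μ.shifted_nil
  have e2 : (F.F.shifted [] m ([p] ++ [𝔸.μ.shifted []])).val = 0 :=
    (F.F.triAdditive.right [] m [p] []).eq_zero 𝔸.μ.shifted_nil
  have e3 : (F.F.shifted [] m [𝔸.μ.shifted [p]]).val = 0 :=
    (F.F.triAdditive.right [] m [] []).eq_zero hp
  have e4 : (F.F.shifted [𝔸.μ.shifted []] m [p]).val = 0 :=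
    (F.F.triAdditive.left [] [] m [p]).eq_zero 𝔸.μ.shifted_nil
  have e5 : (F.F.shifted [] (𝕄.β.shifted [] m []) [p]).val = 0 :=
    (F.F.triAdditive.mid [] [p]).eq_zero hm
  have e6 : (F.F.shifted [] (𝕄.β.shifted [] m [p]) []).val = 0 := by
    have h2 := (F.F.triAdditive.mid [] []).smul_val (x := 𝕄.β.shifted [] c [])
      (y := 𝕄.β.shifted [] m [p]) (by
        simp only [HElt.sdeg] at hc
        simp [BiOps.shifted, sdegs, HElt.sdeg]
        linarith) (-1) (by rw [h]; simp)
    rw [h2, F.map_differential hd, smul_zero]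
  rw [e1, e2, e3, e4, e5, e6] at h1
  simp only [smul_zero, add_zero] at h1
  rw [eq_comm, smul_eq_zero_iff_eq, smul_eq_zero_iff_eq] at h1
  exact h1

end Products

/-! ### Homogeneous primitives -/

section Homogeneous

variable {R : Type*} [CommRing R]

/-- The component in one degree of the equation `w - x = D z` between homogeneous elements `w` and
`x` and the image of `z` under a map `D` of degree `1`. -/
theorem exists_homogeneous_preimage {X : GrModule R} (D : X →+ X)
    (hD : ∀ i x, x ∈ X.gr i → D x ∈ X.gr (i + 1)) {d d' : ℤ} {x w z : X} (hx : x ∈ X.gr d)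
    (hw : w ∈ X.gr d') (h : w - x = D z) :
    ∃ z₀ ∈ X.gr (d - 1), x = (if d' = d then w else 0) + D z₀ := by
  classical
  let _ := X.isInternal.chooseDecomposition
  -- Having degree `1`, `D` intertwines the projections to the degrees `d - 1` and `d`. It is enough
  -- to check this on homogeneous elements.
  have key : ∀ z : X, ((DirectSum.decompose X.gr (D z) d : X.gr d) : X) =
      D (DirectSum.decompose X.gr z (d - 1) : X.gr (d - 1)) := by
    intro z
    refine DirectSum.Decomposition.inductionOn X.gr ?_ ?_ ?_ z
    · simp
    · intro i m
      by_cases hi : i = d - 1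
      · subst hi
        rw [DirectSum.decompose_of_mem_same _ (by simpa using hD _ _ m.2),
          DirectSum.decompose_of_mem_same _ m.2]
      · rw [DirectSum.decompose_of_mem_ne _ (hD _ _ m.2) (by omega),
          DirectSum.decompose_of_mem_ne _ m.2 hi, map_zero]
    · intro a b ha hb
      simp [DirectSum.decompose_add, ha, hb]
  refine ⟨-(DirectSum.decompose X.gr z (d - 1) : X.gr (d - 1)), neg_mem (SetLike.coe_mem _), ?_⟩
  rw [map_neg, ← key, ← h, DirectSum.decompose_sub, DirectSum.sub_apply, AddSubgroupClass.coe_sub,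
    DirectSum.decompose_of_mem_same _ hx]
  split_ifs with hd
  · subst hd
    rw [DirectSum.decompose_of_mem_same _ hw]
    abel
  · rw [DirectSum.decompose_of_mem_ne _ hw hd]
    abel

end Homogeneous

/-! ### Blocks as intervals of positions -/

section Intervals

theorem append_eq_range' {u v : List ℕ} {p n : ℕ} (h : u ++ v = List.range' p n) :
    u = List.range' p u.length ∧ v = List.range' (p + u.length) v.length ∧
      u.length + v.length = n := by
  obtain ⟨k, hk, rfl, rfl⟩ := List.range'_eq_append_iff.1 h.symm
  simp
  omega

theorem infix_range' {w : List ℕ} {p n : ℕ} (h : w <:+: List.range' p n) :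
    ∃ q, p ≤ q ∧ q + w.length ≤ p + n ∧ w = List.range' q w.length := by
  obtain ⟨u, v, h⟩ := h
  obtain ⟨h1, -, h3⟩ := append_eq_range' h
  obtain ⟨h4, h5, h6⟩ := append_eq_range' h1
  refine ⟨p + u.length, by omega, ?_, h5⟩
  rw [← h3, List.length_append]
  omega

theorem range'_ends {q n : ℕ} (hn : n ≠ 0) :
    (List.range' q n).headD 0 = q ∧ (List.range' q n).getLastD 0 = q + n - 1 := by
  obtain ⟨n, rfl⟩ := Nat.exists_eq_succ_of_ne_zero hn
  refine ⟨by simp [List.range'_succ], ?_⟩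
  rw [Nat.succ_eq_add_one, List.range'_concat]
  simp

theorem wt_range' (s : ℕ → ℤ) (p n : ℕ) :
    wt s (List.range' p n) = ∑ t ∈ Finset.Ico p (p + n), s t := by
  induction n with
  | zero => simp
  | succ n ih =>
    rw [List.range'_concat, wt_append, ih, ← add_assoc, Finset.sum_Ico_succ_top (by omega)]
    simp

end Intervals

/-! ### Flatness as the defining equations -/

section DefiningEquations

variable {R : Type u} [CommRing R] {α : Type*} {s : α → ℤ} {K : α}

theorem AInfAlgebra.d_cell (𝔸 : AInfAlgebra.{u, v} R) (a : ACells 𝔸.A s) {l : List α} (hl : l ≠ [])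
    (flat : (curvA 𝔸.μ a l).val = 0) :
    𝔸.d (a.cell l).val = -sumParts l fun ws =>
      if 2 ≤ ws.length then (𝔸.μ.shifted (ws.map a.cell)).val else 0 := by
  have e : (curvA 𝔸.μ a l).val = _ := sumParts_single_add l hl _
  rw [flat] at e
  rw [eq_neg_iff_add_eq_zero, ← 𝔸.shifted_singleton]
  exact e.symm

/-- The only staircase without algebra blocks is the single module block, and it contributes the
differential of its cell. Zero curvature therefore expresses this differential by all the others. -/
theorem AInfModule.d_cell {𝔸 : AInfAlgebra.{u, v} R} (𝕄 : AInfModule.{u, v, w} 𝔸)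
    (a : ACells 𝔸.A s) (m : MCells 𝕄.M s K) {u v : List α}
    (flat : (curvM 𝕄.β a m u v).val = 0) :
    𝕄.d (m.cell u v).val = -sumSplit u fun u₁ u₂ => sumSplit v fun v₁ v₂ =>
      sumParts u₁ fun ws => sumParts v₂ fun zs => if 1 ≤ ws.length + zs.length then
        (𝕄.β.shifted (ws.map a.cell) (m.cell u₂ v₁) (zs.map a.cell)).val else 0 := by
  rw [eq_neg_iff_add_eq_zero]
  refine Eq.trans ?_ flat
  have h : (sumSplit u fun u₁ u₂ => sumSplit v fun v₁ v₂ => sumParts u₁ fun ws =>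
      sumParts v₂ fun zs => if ws.length + zs.length < 1 then
        (𝕄.β.shifted (ws.map a.cell) (m.cell u₂ v₁) (zs.map a.cell)).val else 0) =
      𝕄.d (m.cell u v).val := by
    rw [sumSplit_left_nil, sumSplit_right_nil]
    · simp [sumParts_nil, 𝕄.shifted_nil]
    · intro v₁ v₂ hv
      refine sumParts_eq_zero fun ws _ _ => sumParts_eq_zero fun zs hzs _ => if_neg fun hlt => hv ?_
      have : zs = [] := List.length_eq_zero_iff.1 (by omega)
      simpa [this] using hzs.symm
    · intro u₁ u₂ hu
      refine sumSplit_eq_zero fun v₁ v₂ _ => sumParts_eq_zero fun ws hws _ =>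
        sumParts_eq_zero fun zs _ _ => if_neg fun hlt => hu ?_
      have : ws = [] := List.length_eq_zero_iff.1 (by omega)
      simpa [this] using hws.symm
  rw [← h, curvM]
  simp only [stairM, ← sumSplit_add, ← sumParts_add]
  refine sumSplit_congr fun u₁ u₂ _ => sumSplit_congr fun v₁ v₂ _ => sumParts_congr fun ws _ _ =>
    sumParts_congr fun zs _ _ => ?_
  rcases lt_or_ge (ws.length + zs.length) 1 with h | h
  · rw [if_pos h, if_neg (not_le.2 h), add_zero]
  · rw [if_neg (not_lt.2 h), if_pos h, zero_add]

end DefiningEquations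

/-! ### From cells on blocks to systems indexed by endpoints -/

namespace CyclicCells

variable {R : Type u} [CommRing R] {X : AInfTriple.{u, v, w} R} {s : ℕ → ℤ} {k ℓ : ℕ}

/-- The triangular system around the position `k + 1`. -/
def system {A M : GrModule R} {K : ℕ} (a : ACells A s) (m : MCells M s K) : ModSystem A M where
  a i j := a.cell (List.range' i (j + 1 - i))
  m i j := m.cell (List.range' i (K - i)) (List.range' (K + 1) (j - K))

/-- The triangular system around the position `N`, with the position `N + i` in place of `i`. -/
def system' {A M : GrModule R} {N : ℕ} (a : ACells A s) (n : MCells M s N) : ModSystem A M where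
  a i j := if i ≤ N then a.cell (List.range' i (j + 1 - i)) else
    a.cell (List.range' (i - N) (j + 1 - i))
  m i j := n.cell (List.range' i (N - i)) (List.range' 1 (j - N))

section

variable {A M : GrModule R} {K : ℕ} (a : ACells A s) (m : MCells M s K)

/-- A system only sees the endpoints of a block, and these determine it since a non-empty infix of
an interval is an interval. -/
theorem system_cell {w : List ℕ} {p n : ℕ} (hw : w <:+: List.range' p n) (h0 : w ≠ []) :
    (system a m).cell w = a.cell w := by
  obtain ⟨q, -, -, h⟩ := infix_range' hw
  have hl : w.length ≠ 0 := fun h => h0 (List.length_eq_zero_iff.1 h)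
  obtain ⟨h1, h2⟩ := range'_ends (q := q) hl
  rw [← h] at h1 h2
  rw [ModSystem.cell, h1, h2]
  simp only [system]
  rw [show q + w.length - 1 + 1 - q = w.length by omega, ← h]

theorem system'_cell {w : List ℕ} {p n : ℕ} (hw : w <:+: List.range' p n) (h0 : w ≠ [])
    (hp : p + n ≤ K) : (system' a m).cell w = a.cell w := by
  obtain ⟨q, hq, hq', h⟩ := infix_range' hw
  have hl : w.length ≠ 0 := fun h => h0 (List.length_eq_zero_iff.1 h)
  obtain ⟨h1, h2⟩ := range'_ends (q := q) hl
  rw [← h] at h1 h2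
  rw [ModSystem.cell, h1, h2]
  simp only [system']
  rw [if_pos (by omega), show q + w.length - 1 + 1 - q = w.length by omega, ← h]

/-- The positions after `N` in the second system. The bound `1 ≤ p` puts every shifted index
strictly above `N`, where entries are read with `N` subtracted. -/
theorem system'_cell_shift {w : List ℕ} {p n : ℕ} (hw : w <:+: List.range' p n) (h0 : w ≠ [])
    (hp : 1 ≤ p) : (system' a m).cell (w.map (K + ·)) = a.cell w := by
  obtain ⟨q, hq, hq', h⟩ := infix_range' hw
  have hl : w.length ≠ 0 := fun h => h0 (List.length_eq_zero_iff.1 h)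
  have h' : w.map (K + ·) = List.range' (K + q) w.length := by
    conv_lhs => rw [h]
    rw [List.map_add_range']
  obtain ⟨h1, h2⟩ := range'_ends (q := K + q) hl
  rw [← h'] at h1 h2
  rw [ModSystem.cell, h1, h2]
  simp only [system']
  rw [if_neg (by omega), show K + q + w.length - 1 + 1 - (K + q) = w.length by omega,
    Nat.add_sub_cancel_left, ← h]

theorem system_m {u v u' v' : List ℕ} {p n n' : ℕ} (hu : u' ++ u = List.range' p n)
    (hK : p + n = K) (hv : v ++ v' = List.range' (K + 1) n') :
    (system a m).m (K - u.length) (K + v.length) = m.cell u v := by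
  obtain ⟨-, h1, h2⟩ := append_eq_range' hu
  obtain ⟨h3, -, -⟩ := append_eq_range' hv
  simp only [system]
  rw [show K - (K - u.length) = u.length by omega, show K - u.length = p + u'.length by omega,
    ← h1, Nat.add_sub_cancel_left, ← h3]

theorem system'_m {u v u' v' : List ℕ} {p n n' : ℕ} (hu : u' ++ u = List.range' p n)
    (hK : p + n = K) (hv : v ++ v' = List.range' 1 n') :
    (system' a m).m (K - u.length) (K + v.length) = m.cell u v := by
  obtain ⟨-, h1, h2⟩ := append_eq_range' hu
  obtain ⟨h3, -, -⟩ := append_eq_range' hv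
  simp only [system']
  rw [show K - (K - u.length) = u.length by omega, show K - u.length = p + u'.length by omega,
    ← h1, Nat.add_sub_cancel_left, ← h3]

theorem map_cell_eq {β : Type*} {f g : List ℕ → β} {ws : List (List ℕ)} {l : List ℕ}
    (hws : ws.flatten = l) (h0 : ∀ w ∈ ws, w ≠ []) (h : ∀ w, w <:+: l → w ≠ [] → f w = g w) :
    ws.map f = ws.map g :=
  List.map_congr_left fun w hw => h w (hws ▸ List.infix_of_mem_flatten hw) (h0 w hw)

end

end CyclicCells

section Intervals

theorem suffix_range' {p n i : ℕ} (h1 : p ≤ i) (h2 : i ≤ p + n) :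
    List.range' i (p + n - i) <:+ List.range' p n := by
  obtain ⟨d, rfl⟩ := Nat.exists_eq_add_of_le h1
  obtain ⟨e, rfl⟩ := Nat.exists_eq_add_of_le (show d ≤ n by omega)
  exact ⟨List.range' p d, by rw [show p + (d + e) - (p + d) = e by omega, List.range'_append_1]⟩

theorem prefix_range' {p n m : ℕ} (h : m ≤ n) : List.range' p m <+: List.range' p n := by
  obtain ⟨e, rfl⟩ := Nat.exists_eq_add_of_le h
  exact ⟨List.range' (p + m) e, List.range'_append_1⟩

theorem interval_infix_range' {p n i m : ℕ} (h1 : p ≤ i) (h2 : i + m ≤ p + n) :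
    List.range' i m <:+: List.range' p n :=
  (prefix_range' (by omega)).isInfix.trans (suffix_range' h1 (by omega)).isInfix

theorem wt_range'_shift (s : ℕ → ℤ) (N p n : ℕ) :
    wt s (List.range' p n) = ∑ t ∈ Finset.Ico (N + p) (N + p + n), s (t - N) := by
  rw [← wt_range' (fun t => s (t - N)), ← List.map_add_range']
  simp only [wt, List.map_map]
  congr 2
  funext t
  simp

end Intervals

namespace CyclicCells

section Systems

variable {R : Type u} [CommRing R] {s : ℕ → ℤ}

theorem system_diag {A M : GrModule R} {K : ℕ} (a : ACells A s) (m : MCells M s K) (t : ℕ) :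
    (system a m).a t t = a.cell [t] := by
  simp [system]

theorem system'_diag {A M : GrModule R} {N : ℕ} (a : ACells A s) (n : MCells M s N) (t : ℕ) :
    (system' a n).a t t = a.cell [if t ≤ N then t else t - N] := by
  simp only [system']
  split_ifs <;> simp

theorem system_triangular {A M : GrModule R} {K : ℕ} (a : ACells A s) (m : MCells M s K)
    (p q : ℕ) : (system a m).IsTriangular p K q := by
  constructor
  · intro i j _ hij _ _
    simp only [system_diag, a.sdeg_cell, wt_cons, wt_nil, add_zero]
    simp only [system]
    rw [a.sdeg_cell, wt_range', show i + (j + 1 - i) = j + 1 by omega]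
    rfl
  · intro i j _ hi hj _
    simp only [system_diag, a.sdeg_cell, wt_cons, wt_nil, add_zero]
    simp only [system]
    rw [m.sdeg_cell, m.sdeg_cell, wt_range', wt_range', show i + (K - i) = K by omega,
      show K + 1 + (j - K) = j + 1 by omega]
    congr 1
    · simp
    · exact Finset.sum_congr (by ext; simp) fun _ _ => rfl

theorem system'_triangular {A M : GrModule R} {N : ℕ} (a : ACells A s) (n : MCells M s N)
    (p q : ℕ) : (system' a n).IsTriangular p N q := by
  have h1 : ∀ i, i ≤ N → ((system' a n).a i i).sdeg = s i := fun i hi => by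
    rw [system'_diag, a.sdeg_cell, if_pos hi]
    simp
  have h2 : ∀ i, N < i → ((system' a n).a i i).sdeg = s (i - N) := fun i hi => by
    rw [system'_diag, a.sdeg_cell, if_neg (not_le.2 hi)]
    simp
  constructor
  · intro i j _ hij _ h
    rcases h with h | h
    · rw [Finset.sum_congr rfl fun t ht => h1 t (by rw [Finset.mem_Icc] at ht; omega)]
      simp only [system']
      rw [if_pos (by omega), a.sdeg_cell, wt_range', show i + (j + 1 - i) = j + 1 by omega]
      rfl
    · rw [Finset.sum_congr rfl fun t ht => h2 t (by rw [Finset.mem_Icc] at ht; omega)]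
      simp only [system']
      rw [if_neg (by omega), a.sdeg_cell, wt_range'_shift s N,
        show N + (i - N) + (j + 1 - i) = j + 1 by omega, show N + (i - N) = i by omega]
      rfl
  · intro i j _ hi hj _
    rw [Finset.sum_congr rfl fun t ht => h1 t (by rw [Finset.mem_Ico] at ht; omega),
      Finset.sum_congr (s₁ := Finset.Ioc N j) rfl fun t ht =>
        h2 t (by rw [Finset.mem_Ioc] at ht; omega)]
    simp only [system']
    rw [n.sdeg_cell, n.sdeg_cell, wt_range', wt_range'_shift s N, show i + (N - i) = N by omega,
      show N + 1 + (j - N) = j + 1 by omega]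
    congr 1
    · simp
    · exact Finset.sum_congr (by ext; simp) fun _ _ => rfl

end Systems

variable {R : Type u} [CommRing R] {X : AInfTriple.{u, v, w} R} {s : ℕ → ℤ} {k ℓ : ℕ}

theorem system_defining (c : CyclicCells X s (k + 1) (k + ℓ + 2) (List.range' 1 k)
    (List.range' (k + 2) ℓ)) : (system c.a c.m).IsDefining 1 (k + 1) (k + ℓ + 1) := by
  constructor
  · intro i j hi hij hj h
    have hl : List.range' i (j + 1 - i) ≠ [] := by simp; omega
    have flat : (curvA X.alg.μ c.a (List.range' i (j + 1 - i))).val = 0 := by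
      rcases h with h | h
      · exact c.flatU _ (interval_infix_range' (by omega) (by omega))
      · exact c.flatV _ (interval_infix_range' (by omega) (by omega))
    refine (X.alg.d_cell c.a hl flat).trans (congrArg _ (sumParts_congr fun ws hws h0 => ?_))
    rw [map_cell_eq hws h0 fun w hw hw0 => (system_cell c.a c.m hw hw0).symm]
  · intro i j hi hiK hj hjq
    have hu : List.range' i (k + 1 - i) <:+ List.range' 1 k := by
      rw [show k + 1 - i = 1 + k - i by omega]
      exact suffix_range' (by omega) (by omega)
    have hv : List.range' (k + 1 + 1) (j - (k + 1)) <+: List.range' (k + 2) ℓ :=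
      prefix_range' (by omega)
    refine (X.mod.d_cell c.a c.m (c.flatm _ _ hu hv)).trans (congrArg _ ?_)
    refine sumSplit_congr fun u₁ u₂ hu => sumSplit_congr fun v₁ v₂ hv =>
      sumParts_congr fun ws hws h0 => sumParts_congr fun zs hzs h0' => ?_
    rw [system_m c.a c.m hu (by omega) hv,
      map_cell_eq hws h0 fun w hw hw0 => (system_cell c.a c.m
        (hw.trans (hu ▸ (List.prefix_append _ _).isInfix)) hw0).symm,
      map_cell_eq hzs h0' fun w hw hw0 => (system_cell c.a c.m
        (hw.trans (hv ▸ (List.suffix_append _ _).isInfix)) hw0).symm]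

theorem system'_defining (c : CyclicCells X s (k + 1) (k + ℓ + 2) (List.range' 1 k)
    (List.range' (k + 2) ℓ)) :
    (system' c.a c.n).IsDefining (k + 2) (k + ℓ + 2) (k + ℓ + 2 + k) := by
  constructor
  · intro i j hi hij hj h
    -- Blocks before `N` lie in `V` and are read as they are; those after `N` lie in `U`, with
    -- indices shifted by `N`.
    rcases h with h | h
    · have hl : List.range' i (j + 1 - i) ≠ [] := by simp; omega
      have e : (system' c.a c.n).a i j = c.a.cell (List.range' i (j + 1 - i)) := if_pos (by omega)
      rw [e, X.alg.d_cell c.a hl (c.flatV _ (interval_infix_range' (by omega) (by omega)))]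
      refine congrArg _ (sumParts_congr fun ws hws h0 => ?_)
      rw [map_cell_eq hws h0 fun w hw hw0 => (system'_cell c.a c.n hw hw0 (by omega)).symm]
    · obtain ⟨i, rfl⟩ := Nat.exists_eq_add_of_le h.le
      have e : (system' c.a c.n).a (k + ℓ + 2 + i) j =
          c.a.cell (List.range' i (j + 1 - (k + ℓ + 2 + i))) :=
        (if_neg (by omega)).trans (by rw [Nat.add_sub_cancel_left])
      have hl : List.range' i (j + 1 - (k + ℓ + 2 + i)) ≠ [] := by simp; omega
      rw [e, X.alg.d_cell c.a hl (c.flatU _ (interval_infix_range' (by omega) (by omega))),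
        ModSystem.staircaseA, show List.range' (k + ℓ + 2 + i) (j + 1 - (k + ℓ + 2 + i)) =
          (List.range' i (j + 1 - (k + ℓ + 2 + i))).map (k + ℓ + 2 + ·) by
            rw [List.map_add_range'], sumParts_map]
      refine congrArg _ (sumParts_congr fun ws hws h0 => ?_)
      rw [List.length_map, List.map_map, map_cell_eq hws h0 fun w hw hw0 =>
        (system'_cell_shift c.a c.n hw hw0 (by omega)).symm]
      rfl
  · intro i j hi hiK hj hjq
    have hu : List.range' i (k + ℓ + 2 - i) <:+ List.range' (k + 2) ℓ := by
      rw [show k + ℓ + 2 - i = k + 2 + ℓ - i by omega]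
      exact suffix_range' (by omega) (by omega)
    have hv : List.range' 1 (j - (k + ℓ + 2)) <+: List.range' 1 k := prefix_range' (by omega)
    refine (X.mod.d_cell c.a c.n (c.flatn _ _ hu hv)).trans (congrArg _ ?_)
    rw [ModSystem.staircaseM, show List.range' (k + ℓ + 2 + 1) (j - (k + ℓ + 2)) =
      (List.range' 1 (j - (k + ℓ + 2))).map (k + ℓ + 2 + ·) by rw [List.map_add_range']]
    simp only [sumSplit_map, sumParts_map]
    refine sumSplit_congr fun u₁ u₂ hu => sumSplit_congr fun v₁ v₂ hv =>
      sumParts_congr fun ws hws h0 => sumParts_congr fun zs hzs h0' => ?_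
    rw [List.length_map, List.length_map, system'_m c.a c.n hu (by omega) hv, List.map_map,
      map_cell_eq hws h0 fun w hw hw0 => (system'_cell c.a c.n
        (hw.trans (hu ▸ (List.prefix_append _ _).isInfix)) hw0 (by omega)).symm,
      map_cell_eq hzs h0' fun w hw hw0 => (system'_cell_shift c.a c.n
        (hw.trans (hv ▸ (List.suffix_append _ _).isInfix)) hw0 le_rfl).symm]
    rfl

theorem isCyclicDefiningSystem (c : CyclicCells X s (k + 1) (k + ℓ + 2) (List.range' 1 k)
    (List.range' (k + 2) ℓ)) {a : Fin k → HElt X.alg.A} {m : HElt X.mod.M}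
    {b : Fin ℓ → HElt X.alg.A} {n : HElt X.mod.M} (ha : ∀ i : Fin k, c.a.cell [i + 1] = a i)
    (hm : c.m.cell [] [] = m) (hb : ∀ i : Fin ℓ, c.a.cell [k + 2 + i] = b i)
    (hn : c.n.cell [] [] = n) :
    X.IsCyclicDefiningSystem a m b n (system c.a c.m) (system' c.a c.n) where
  diag_a i := by rw [system_diag, ha]
  diag_m := by simpa [system] using hm
  diag_b i := by rw [system_diag, hb]
  diag_n := by simpa [system'] using hn
  overlap_a i j hi hij hj := by
    simp only [system, system']
    rw [if_neg (by omega), Nat.add_sub_cancel_left,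
      show k + ℓ + 2 + j + 1 - (k + ℓ + 2 + i) = j + 1 - i by omega]
  overlap_b i j hi hij hj := if_pos (by omega)
  triangular := system_triangular _ _ _ _
  triangular' := system'_triangular _ _ _ _
  defining := c.system_defining
  defining' := c.system'_defining

/-- The two sums agree term by term once the splittings of `U` and `V` are put in the same order and
each interval is identified with its block. -/
theorem staircaseInner_system (c : CyclicCells X s (k + 1) (k + ℓ + 2) (List.range' 1 k)
    (List.range' (k + 2) ℓ)) :
    X.staircaseInner k ℓ (system c.a c.m) (system' c.a c.n) = c.inner := by
  have hs : ∀ t, ((system c.a c.m).a t t).sdeg = s t := fun t => by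
    rw [system_diag, c.a.sdeg_cell]
    simp
  have hK : ((system c.a c.m).m (k + 1) (k + 1)).sdeg = s (k + 1) := by
    simp [system, c.m.sdeg_cell]
  have hN : ((system' c.a c.n).m (k + ℓ + 2) (k + ℓ + 2)).sdeg = s (k + ℓ + 2) := by
    simp [system', c.n.sdeg_cell]
  have hV : ∑ t ∈ Finset.Icc (k + 2) (k + ℓ + 1), s t = wt s (List.range' (k + 2) ℓ) := by
    rw [wt_range', show k + 2 + ℓ = k + ℓ + 1 + 1 by omega]
    rfl
  simp only [AInfTriple.staircaseInner, hs, hK, hN, hV]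
  rw [inner, stairI]
  refine sumSplit_congr fun u₀ u' hu => ?_
  rw [sumSplit_comm]
  refine sumSplit_congr fun v' v₀ hv => ?_
  simp only [stairM, sumSplit_smul, sumParts_smul]
  refine sumSplit_congr fun u₁ u₂ hu' => sumSplit_congr fun v₁ v₂ hv' =>
    sumParts_congr fun ws hws h0 => sumParts_congr fun zs hzs h0' => ?_
  rw [system_m c.a c.m (u' := u₀ ++ u₁) (p := 1) (n := k) (by rw [List.append_assoc, hu', hu])
      (by omega) (v' := v₂ ++ v₀) (n' := ℓ) (by rw [← List.append_assoc, hv', hv]),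
    system'_m c.a c.n (u' := v') hv (by omega) hu,
    map_cell_eq hws h0 fun w hw hw0 => system_cell c.a c.m
      (hw.trans (show u₁ <:+: List.range' 1 k from ⟨u₀, u₂, by simp [hu', hu]⟩)) hw0,
    map_cell_eq hzs h0' fun w hw hw0 => system_cell c.a c.m
      (hw.trans (show v₂ <:+: List.range' (k + 2) ℓ from ⟨v₁, v₀, by simp [hv', hv]⟩)) hw0]
  rfl

end CyclicCells

/-! ### Differentials and lowest components -/

section Differentials

variable {R : Type u} [CommRing R]

/-- The differential of an `A_∞` algebra as a homomorphism. -/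
def AInfAlgebra.dHom (𝔸 : AInfAlgebra.{u, v} R) : 𝔸.A →+ 𝔸.A :=
  .mk' 𝔸.d fun x y => by
    have hu (z : 𝔸.A) : Function.update ![0] 0 z = ![z] := by
      ext i
      fin_cases i
      rfl
    have h := (𝔸.μ.map 1).map_update_add ![0] 0 x y
    rwa [hu, hu, hu] at h

theorem AInfAlgebra.d_mem (𝔸 : AInfAlgebra.{u, v} R) (i : ℤ) (x : 𝔸.A) (hx : x ∈ 𝔸.A.gr i) :
    𝔸.d x ∈ 𝔸.A.gr (i + 1) := by
  have h := (𝔸.μ.shifted [⟨i, x, hx⟩]).mem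
  rw [𝔸.shifted_singleton] at h
  convert h using 2
  simp [Ops.shifted, sdegs, HElt.sdeg]
  ring

/-- The differential of an `A_∞` module as a homomorphism. -/
def AInfModule.dHom {𝔸 : AInfAlgebra.{u, v} R} (𝕄 : AInfModule.{u, v, w} 𝔸) : 𝕄.M →+ 𝕄.M :=
  .mk' 𝕄.d fun x y => by simp [AInfModule.d]

theorem AInfModule.d_mem {𝔸 : AInfAlgebra.{u, v} R} (𝕄 : AInfModule.{u, v, w} 𝔸) (i : ℤ)
    (x : 𝕄.M) (hx : x ∈ 𝕄.M.gr i) : 𝕄.d x ∈ 𝕄.M.gr (i + 1) := by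
  have h := (𝕄.β.shifted [] ⟨i, x, hx⟩ []).mem
  rw [𝕄.shifted_nil] at h
  convert h using 2
  simp [BiOps.shifted, sdegs]
  ring

variable {X Y : AInfTriple R} (φ : AInfTripleMorphism X Y)

theorem AInfTripleMorphism.shifted_singleton (x : HElt X.alg.A) :
    (φ.f.f.shifted [x]).val = φ.algMap x.val := by
  simp only [Ops.shifted, AInfTripleMorphism.algMap, List.map_cons, List.map_nil, shiftExp]
  simp only [List.length_nil, Nat.cast_zero, mul_zero, add_zero, Int.negOnePow_zero, one_smul]
  congr 1
  funext i
  fin_cases i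
  rfl

theorem AInfTripleMorphism.shifted_nil (x : HElt X.mod.M) :
    (φ.F.F.shifted [] x []).val = φ.modMap x.val := by
  simp only [BiOps.shifted, AInfTripleMorphism.modMap, List.map_nil, List.nil_append, shiftExp]
  simp only [List.length_nil, Nat.cast_zero, mul_zero, add_zero, Int.negOnePow_zero, one_smul]
  rw [Subsingleton.elim (fun i : Fin 0 => (([] : List (HElt X.alg.A)).get i).val) ![]]

end Differentials

/-! ### Vanishing of all operations in a binary triple -/

section Vanishing

variable {R : Type*} [CommRing R]

theorem Ops.shifted_eq_zero {X Y : GrModule R} {e : ℤ} {φ : Ops X Y e} {l : List (HElt X)}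
    (h : φ.map l.length = 0) : (φ.shifted l).val = 0 := by
  simp only [Ops.shifted, h]
  exact smul_zero _

theorem BiOps.shifted_eq_zero {A M N : GrModule R} {e : ℤ} {Φ : BiOps A M N e}
    {u v : List (HElt A)} {m : HElt M} (h : Φ.map u.length v.length = 0) :
    (Φ.shifted u m v).val = 0 := by
  simp only [BiOps.shifted, h]
  exact smul_zero _

theorem PairOps.shifted_eq_zero {A M : GrModule R} {e : ℤ} {I : PairOps A M e}
    {u v : List (HElt A)} {m n : HElt M} (h : I.map u.length v.length = 0) :
    I.shifted u m v n = 0 := by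
  simp only [PairOps.shifted, h]
  exact smul_zero _

variable {Y : AInfTriple R} (hY : Y.OnlyBinary) {α : Type*} {y : α → HElt Y.alg.A}
include hY

theorem AInfTriple.OnlyBinary.product_eq_zero {U : List α}
    (h : ∀ i j, [i, j] <:+: U → (Y.alg.μ.shifted [y i, y j]).val = 0) (w : List α)
    (hw : w <:+: U) : (Y.alg.μ.shifted (w.map y)).val = 0 := by
  by_cases h2 : w.length = 2
  · obtain ⟨i, j, rfl⟩ := List.length_eq_two.1 h2
    exact h i j hw
  · exact Ops.shifted_eq_zero (hY.1 _ (by simpa using h2))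

theorem AInfTriple.OnlyBinary.action_eq_zero {U V : List α} {m : HElt Y.mod.M}
    (hl : ∀ i, [i] <:+ U → (Y.mod.β.shifted [y i] m []).val = 0)
    (hr : ∀ i, [i] <+: V → (Y.mod.β.shifted [] m [y i]).val = 0) (p q : List α)
    (hp : p <:+ U) (hq : q <+: V) : (Y.mod.β.shifted (p.map y) m (q.map y)).val = 0 := by
  by_cases h1 : (p.length, q.length) = (1, 0)
  · rw [Prod.mk.injEq] at h1
    obtain ⟨i, rfl⟩ := List.length_eq_one_iff.1 h1.1
    obtain rfl := List.length_eq_zero_iff.1 h1.2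
    exact hl i hp
  by_cases h2 : (p.length, q.length) = (0, 1)
  · rw [Prod.mk.injEq] at h2
    obtain ⟨i, rfl⟩ := List.length_eq_one_iff.1 h2.2
    obtain rfl := List.length_eq_zero_iff.1 h2.1
    exact hr i hq
  exact BiOps.shifted_eq_zero (hY.2.1 _ _ (by simpa using h1) (by simpa using h2))

end Vanishing

namespace CyclicCells

variable {R : Type u} [CommRing R] {X : AInfTriple.{u, v, w} R} {Y : AInfTriple.{u, y, z} R}
  {α : Type*} {s : α → ℤ} {K N : α} {U V : List α}

/-- If the images of the letters in `Y` multiply to zero, then there is a cyclic defining system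
for these letters with vanishing staircase inner product. -/
theorem exists_inner_eq_zero [DecidableEq α] (hnd : (U ++ K :: (V ++ [N])).Nodup)
    (hY : Y.OnlyBinary) (φ : AInfTripleMorphism X Y) (ψ : AInfTripleMorphism Y X)
    (hψ : ψ.IsLeftQuasiInverse φ) (hUV : 1 ≤ U.length + V.length) (x : α → HElt X.alg.A)
    (m n : HElt X.mod.M) (hx : ∀ j, (x j).sdeg = s j) (hm : m.sdeg = s K) (hn : n.sdeg = s N)
    (dx : ∀ j ∈ U ++ V, X.alg.d (x j).val = 0) (dm : X.mod.d m.val = 0) (dn : X.mod.d n.val = 0)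
    (hU : ∀ i j, [i, j] <:+: U →
      (Y.alg.μ.shifted [φ.f.f.shifted [x i], φ.f.f.shifted [x j]]).val = 0)
    (hV : ∀ i j, [i, j] <:+: V →
      (Y.alg.μ.shifted [φ.f.f.shifted [x i], φ.f.f.shifted [x j]]).val = 0)
    (hml : ∀ i, [i] <:+ U →
      (Y.mod.β.shifted [φ.f.f.shifted [x i]] (φ.F.F.shifted [] m []) []).val = 0)
    (hmr : ∀ i, [i] <+: V →
      (Y.mod.β.shifted [] (φ.F.F.shifted [] m []) [φ.f.f.shifted [x i]]).val = 0)
    (hnl : ∀ i, [i] <:+ V →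
      (Y.mod.β.shifted [φ.f.f.shifted [x i]] (φ.F.F.shifted [] n []) []).val = 0)
    (hnr : ∀ i, [i] <+: U →
      (Y.mod.β.shifted [] (φ.F.F.shifted [] n []) [φ.f.f.shifted [x i]]).val = 0) :
    ∃ c : CyclicCells X s K N U V, c.inner = 0 ∧
      (∀ j ∈ U ++ V, (c.a.cell [j]).val = (x j).val) ∧
      (c.m.cell [] []).val = m.val ∧ (c.n.cell [] []).val = n.val := by
  let y := fun j => φ.f.f.shifted [x j]
  have hy : ∀ j, (y j).sdeg = s j := fun j => by simp [y, Ops.shifted, HElt.sdeg, sdegs, ← hx]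
  have hyU := hY.product_eq_zero (y := y) hU
  have hyV := hY.product_eq_zero (y := y) hV
  have hyM := hY.action_eq_zero (y := y) hml hmr
  have hyN := hY.action_eq_zero (y := y) hnl hnr
  have hdeg : ∀ p : HElt X.mod.M, (ψ.F.F.shifted [] (φ.F.F.shifted [] p []) []).deg =
      ψ.F.deg + φ.F.deg + p.deg := fun p => by
    simp [BiOps.shifted, sdegs]
    ring
  obtain ⟨c, hc, ha, hcm, hcn⟩ : ∃ c : CyclicCells X s K N U V, c.inner = 0 ∧
      (∀ j, (c.a.cell [j]).val = (ψ.f.f.shifted [y j]).val) ∧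
      ((c.m.cell [] []).val = if (ψ.F.F.shifted [] (φ.F.F.shifted [] m []) []).deg = m.deg then
        (ψ.F.F.shifted [] (φ.F.F.shifted [] m []) []).val else 0) ∧
      ((c.n.cell [] []).val = if (ψ.F.F.shifted [] (φ.F.F.shifted [] n []) []).deg = n.deg then
        (ψ.F.F.shifted [] (φ.F.F.shifted [] n []) []).val else 0) := by
    -- The two module morphisms may have degrees which do not add up to zero. Then the composite of
    -- a homogeneous cocycle has the wrong degree, so being cohomologous to it forces the cocycle to
    -- be exact, and zero module cells can be used instead.
    by_cases h : ψ.F.deg + φ.F.deg = 0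
    · have hs : ∀ p : HElt X.mod.M, ψ.F.deg + (φ.F.F.shifted [] p []).sdeg = p.sdeg := fun p => by
        simp only [BiOps.shifted, HElt.sdeg, sdegs, List.map_nil, List.sum_nil]
        linarith
      refine ⟨.ofMorphism ψ y hy _ _ ((hs m).trans hm) ((hs n).trans hn) hyU hyV hyM hyN,
        inner_ofMorphism ψ y hy _ _ _ _ hyU hyV hyM hyN
          (PairOps.shifted_eq_zero (hY.2.2 _ _ ?_)), fun j => rfl, ?_, ?_⟩
      -- Here `k + ℓ ≥ 1` enters: the component of the inner product of `Y` in question is not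
      -- `I_{0,0}`.
      · simp only [List.length_map, ne_eq, Prod.mk.injEq]
        omega
      · rw [hdeg, h, zero_add, if_pos rfl]
        simp [ofMorphism, MCells.ofMorphism, HElt.sign]
      · rw [hdeg, h, zero_add, if_pos rfl]
        simp [ofMorphism, MCells.ofMorphism, HElt.sign]
    · refine ⟨.ofAlgebraMorphism ψ.f y hy hyU hyV, inner_ofAlgebraMorphism ψ.f y hy hyU hyV,
        fun j => rfl, ?_, ?_⟩
      · rw [hdeg, if_neg (by omega)]
        rfl
      · rw [hdeg, if_neg (by omega)]
        rfl
  -- Quasi-inverseness gives a possibly inhomogeneous primitive; its component in the right degree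
  -- suffices, and covers both cases for the degrees.
  have hmod : ∀ p : HElt X.mod.M, X.mod.d p.val = 0 → ∃ z : HElt X.mod.M, z.sdeg = p.sdeg - 1 ∧
      p.val = (if (ψ.F.F.shifted [] (φ.F.F.shifted [] p []) []).deg = p.deg then
        (ψ.F.F.shifted [] (φ.F.F.shifted [] p []) []).val else 0) + X.mod.d z.val := by
    intro p dp
    obtain ⟨z, hz⟩ := hψ.2 p.val dp
    rw [← φ.shifted_nil, ← ψ.shifted_nil] at hz
    obtain ⟨z₀, hz₀, e⟩ := exists_homogeneous_preimage X.mod.dHom X.mod.d_mem p.mem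
      (ψ.F.F.shifted [] (φ.F.F.shifted [] p []) []).mem hz
    exact ⟨⟨_, z₀, hz₀⟩, rfl, e⟩
  have halg : ∀ j ∈ U ++ V, ∃ z : HElt X.alg.A, z.sdeg = s j - 1 ∧
      (x j).val = (c.a.cell [j]).val + X.alg.d z.val := by
    intro j hj
    obtain ⟨z, hz⟩ := hψ.1 (x j).val (dx j hj)
    rw [← φ.shifted_singleton, ← ψ.shifted_singleton] at hz
    obtain ⟨z₀, hz₀, e⟩ := exists_homogeneous_preimage X.alg.dHom X.alg.d_mem (x j).mem
      (ψ.f.f.shifted [φ.f.f.shifted [x j]]).mem hz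
    rw [if_pos (by simp [Ops.shifted, HElt.sdeg, sdegs])] at e
    refine ⟨⟨_, z₀, hz₀⟩, ?_, by rw [ha]; exact e⟩
    rw [← hx]
    rfl
  obtain ⟨c', hc', h⟩ := c.exists_of_cohomologous hnd x m n halg
    (by rw [hcm, ← hm]; exact hmod m dm) (by rw [hcn, ← hn]; exact hmod n dn)
  exact ⟨c', hc'.trans hc, h⟩

end CyclicCells

/-! ### Entries of length one and two of a defining system -/

section LowStaircases

variable {R : Type u} [CommRing R] {𝔸 : AInfAlgebra.{u, v} R} {𝕄 : AInfModule.{u, v, w} 𝔸}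
  (x : ModSystem 𝔸.A 𝕄.M) {p K q : ℕ}

theorem ModSystem.staircaseA_self (i : ℕ) : x.staircaseA i i = 0 := by
  simp [staircaseA, sumParts_cons, sumParts_nil, sumSplit_nil]

theorem ModSystem.staircaseA_succ (i : ℕ) :
    x.staircaseA i (i + 1) = (𝔸.μ.shifted [x.a i i, x.a (i + 1) (i + 1)]).val := by
  rw [staircaseA, show i + 1 + 1 - i = 2 by omega]
  simp [List.range', sumParts_cons, sumParts_nil, sumSplit_cons, sumSplit_nil, cell]

theorem ModSystem.staircaseM_self (K : ℕ) : x.staircaseM K K K = 0 := by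
  simp [staircaseM, sumParts_nil, sumSplit_nil]

theorem ModSystem.staircaseM_left (K : ℕ) : x.staircaseM (K + 1) K (K + 1) =
    (𝕄.β.shifted [x.a K K] (x.m (K + 1) (K + 1)) []).val := by
  simp [staircaseM, sumParts_cons, sumParts_nil, sumSplit_cons, sumSplit_nil, cell]

theorem ModSystem.staircaseM_right (K : ℕ) : x.staircaseM K K (K + 1) =
    (𝕄.β.shifted [] (x.m K K) [x.a (K + 1) (K + 1)]).val := by
  simp [staircaseM, sumParts_cons, sumParts_nil, sumSplit_cons, sumSplit_nil, cell]

variable {x}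

theorem ModSystem.IsDefining.d_a_self (hx : x.IsDefining p K q) {i : ℕ} (hp : p ≤ i) (hq : i ≤ q)
    (hi : i < K ∨ K < i) : 𝔸.d (x.a i i).val = 0 := by
  rw [hx.1 i i hp le_rfl hq hi, x.staircaseA_self, neg_zero]

theorem ModSystem.IsDefining.d_m_self (hx : x.IsDefining p K q) (hp : p ≤ K) (hq : K ≤ q) :
    𝕄.d (x.m K K).val = 0 := by
  rw [hx.2 K K hp le_rfl le_rfl hq, x.staircaseM_self, neg_zero]

variable {𝔹 : AInfAlgebra R} {f : AInfMorphism 𝔸 𝔹} {𝕃 : AInfModule 𝔹}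

/-- The entry `x_{i,i+1}` is the primitive which makes the product of its two diagonal neighbours
exact. -/
theorem ModSystem.IsDefining.product_eq_zero (hx : x.IsDefining p K q) (ht : x.IsTriangular p K q)
    (hd : ∀ x, (𝔹.μ.shifted [x]).val = 0) {i : ℕ} (hp : p ≤ i) (hq : i + 1 ≤ q)
    (hi : i + 1 < K ∨ K < i) :
    (𝔹.μ.shifted [f.f.shifted [x.a i i], f.f.shifted [x.a (i + 1) (i + 1)]]).val = 0 := by
  refine f.product_eq_zero hd (c := x.a i (i + 1)) ?_ ?_ ?_ ?_
  · rw [𝔸.shifted_singleton, hx.d_a_self hp (by omega) (by omega)]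
  · rw [𝔸.shifted_singleton, hx.d_a_self (by omega) hq (by omega)]
  · rw [ht.1 i (i + 1) hp (by omega) hq hi, Finset.sum_Icc_succ_top (by omega)]
    simp
  · rw [𝔸.shifted_singleton, hx.1 i (i + 1) hp (by omega) hq hi, x.staircaseA_succ]

theorem ModSystem.IsDefining.left_product_eq_zero (F : AInfModuleMorphism f 𝕄 𝕃)
    (hx : x.IsDefining p (K + 1) q) (ht : x.IsTriangular p (K + 1) q)
    (hd : ∀ x, (𝕃.β.shifted [] x []).val = 0) (hp : p ≤ K) (hq : K + 1 ≤ q) :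
    (𝕃.β.shifted [f.f.shifted [x.a K K]] (F.F.shifted [] (x.m (K + 1) (K + 1)) []) []).val =
      0 := by
  refine F.left_product_eq_zero hd (c := x.m K (K + 1)) ?_ ?_ ?_ ?_
  · rw [𝔸.shifted_singleton, hx.d_a_self hp (by omega) (by omega)]
  · rw [𝕄.shifted_nil, hx.d_m_self (by omega) hq]
  · rw [ht.2 K (K + 1) hp (by omega) le_rfl hq]
    simp
  · rw [𝕄.shifted_nil, hx.2 K (K + 1) hp (by omega) le_rfl hq, x.staircaseM_left]

theorem ModSystem.IsDefining.right_product_eq_zero (F : AInfModuleMorphism f 𝕄 𝕃)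
    (hx : x.IsDefining p K q) (ht : x.IsTriangular p K q)
    (hd : ∀ x, (𝕃.β.shifted [] x []).val = 0) (hp : p ≤ K) (hq : K + 1 ≤ q) :
    (𝕃.β.shifted [] (F.F.shifted [] (x.m K K) []) [f.f.shifted [x.a (K + 1) (K + 1)]]).val =
      0 := by
  refine F.right_product_eq_zero hd (c := x.m K (K + 1)) ?_ ?_ ?_ ?_
  · rw [𝔸.shifted_singleton, hx.d_a_self (by omega) hq (by omega)]
  · rw [𝕄.shifted_nil, hx.d_m_self hp (by omega)]
  · rw [ht.2 K (K + 1) hp le_rfl (by omega) hq, ← Finset.Icc_add_one_left_eq_Ioc]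
    simp
  · rw [𝕄.shifted_nil, hx.2 K (K + 1) hp le_rfl (by omega) hq, x.staircaseM_right]

end LowStaircases

section LowIntervals

theorem pair_infix_range' {i j p n : ℕ} (h : [i, j] <:+: List.range' p n) :
    j = i + 1 ∧ p ≤ i ∧ i + 2 ≤ p + n := by
  obtain ⟨q, h1, h2, h3⟩ := infix_range' h
  simp [List.range'] at h2 h3
  omega

theorem singleton_suffix_range' {i p n : ℕ} (h : [i] <:+ List.range' p n) :
    i + 1 = p + n ∧ 1 ≤ n := by
  obtain ⟨u, h⟩ := h
  obtain ⟨-, h2, h3⟩ := append_eq_range' h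
  simp at h2 h3
  omega

theorem singleton_prefix_range' {i p n : ℕ} (h : [i] <+: List.range' p n) : i = p ∧ 1 ≤ n := by
  obtain ⟨v, h⟩ := h
  obtain ⟨h1, -, h3⟩ := append_eq_range' h
  simp at h1 h3
  omega

end LowIntervals

/-! ### Triviality of the Massey inner products -/

theorem mainTheorem5 {R : Type u} [CommRing R] (X : AInfTriple.{u, v, w} R)
    (hX : AInfTriple.IsFormal.{u, v, w, y, z} X) (k ℓ : ℕ) (hkℓ : 1 ≤ k + ℓ)
    (a : Fin k → HElt X.alg.A) (m : HElt X.mod.M) (b : Fin ℓ → HElt X.alg.A) (n : HElt X.mod.M) :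
    IsTrivialMassey (X.masseyInner a m b n) := by
  obtain ⟨Y, ⟨φ, ψ, hψ, -⟩, hY⟩ := hX
  rcases (X.masseyInner a m b n).eq_empty_or_nonempty with he | ⟨-, x, x', hx, -⟩
  · exact Or.inl he
  refine Or.inr ?_
  have hμ : ∀ x, (Y.alg.μ.shifted [x]).val = 0 := fun x =>
    Ops.shifted_eq_zero (hY.1 _ (by simp))
  have hβ : ∀ x, (Y.mod.β.shifted [] x []).val = 0 := fun x =>
    BiOps.shifted_eq_zero (hY.2.1 _ _ (by simp) (by simp))
  let s : ℕ → ℤ := fun t => if t = k + 1 then m.sdeg else if t = k + ℓ + 2 then n.sdeg else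
    (x.a t t).sdeg
  let y : ℕ → HElt X.alg.A := fun t => if t = k + 1 ∨ t = k + ℓ + 2 then ⟨s t + 1, 0, zero_mem _⟩
    else x.a t t
  have hs : ∀ t, (y t).sdeg = s t := by
    intro t
    simp only [y]
    split_ifs with h
    · exact add_sub_cancel_right _ _
    · rw [not_or] at h
      simp only [s]
      rw [if_neg h.1, if_neg h.2]
  have hyx : ∀ t, t < k + 1 ∨ k + 1 < t ∧ t < k + ℓ + 2 → y t = x.a t t := fun t ht =>
    if_neg (by omega)
  -- Products with `n` are controlled by the second system, so its diagonal has to be identified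
  -- with that of the first.
  have hay : ∀ t, k + 1 < t → t < k + ℓ + 2 → y t = x'.a t t := fun t h1 h2 => by
    rw [hyx t (by omega), hx.overlap_b t t h1 le_rfl (by omega)]
  have key : ∃ c : CyclicCells X s (k + 1) (k + ℓ + 2) (List.range' 1 k) (List.range' (k + 2) ℓ),
      c.inner = 0 ∧
      (∀ j ∈ List.range' 1 k ++ List.range' (k + 2) ℓ, (c.a.cell [j]).val = (y j).val) ∧
      (c.m.cell [] []).val = m.val ∧ (c.n.cell [] []).val = n.val := by
    refine CyclicCells.exists_inner_eq_zero ?_ hY φ ψ hψ (by simpa using hkℓ) y m n hs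
      (by simp [s]) (by simp [s]; omega) ?_ ?_ ?_ ?_ ?_ ?_ ?_ ?_ ?_
    · rw [show List.range' 1 k ++ (k + 1) :: (List.range' (k + 2) ℓ ++ [k + ℓ + 2]) =
        List.range' 1 (k + (ℓ + 1 + 1)) by
          rw [← List.range'_append_1, List.range'_succ, List.range'_concat]
          simp [add_comm, add_left_comm]
          omega]
      exact List.nodup_range'
    · intro j hj
      simp only [List.mem_append, List.mem_range'_1] at hj
      rw [hyx j (by omega)]
      exact hx.defining.d_a_self (by omega) (by omega) (by omega)
    · rw [← hx.diag_m]
      exact hx.defining.d_m_self (by omega) (by omega)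
    · rw [← hx.diag_n]
      exact hx.defining'.d_m_self (by omega) (by omega)
    · intro i j hij
      obtain ⟨rfl, h1, h2⟩ := pair_infix_range' hij
      rw [hyx i (by omega), hyx (i + 1) (by omega)]
      exact hx.defining.product_eq_zero hx.triangular hμ (by omega) (by omega) (by omega)
    · intro i j hij
      obtain ⟨rfl, h1, h2⟩ := pair_infix_range' hij
      rw [hyx i (by omega), hyx (i + 1) (by omega)]
      exact hx.defining.product_eq_zero hx.triangular hμ (by omega) (by omega) (by omega)
    · intro i hi
      obtain ⟨h1, h2⟩ := singleton_suffix_range' hi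
      obtain rfl : i = k := by omega
      rw [hyx i (by omega), ← hx.diag_m]
      exact hx.defining.left_product_eq_zero φ.F hx.triangular hβ (by omega) (by omega)
    · intro i hi
      obtain ⟨rfl, h2⟩ := singleton_prefix_range' hi
      rw [hyx _ (by omega), ← hx.diag_m]
      exact hx.defining.right_product_eq_zero φ.F hx.triangular hβ (by omega) (by omega)
    · intro i hi
      obtain ⟨h1, h2⟩ := singleton_suffix_range' hi
      obtain rfl : i = k + ℓ + 1 := by omega
      rw [hay _ (by omega) (by omega), ← hx.diag_n]
      exact hx.defining'.left_product_eq_zero φ.F hx.triangular' hβ (by omega) (by omega)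
    · intro i hi
      obtain ⟨rfl, h2⟩ := singleton_prefix_range' hi
      rw [hyx 1 (by omega), ← hx.overlap_a 1 1 le_rfl le_rfl h2, ← hx.diag_n]
      exact hx.defining'.right_product_eq_zero φ.F hx.triangular' hβ (by omega) (by omega)
  obtain ⟨c, hc, hca, hcm, hcn⟩ := key
  -- A homogeneous element carries its degree as data; here the weights force the degrees to agree,
  -- so equal values suffice.
  have hcell : ∀ j ∈ List.range' 1 k ++ List.range' (k + 2) ℓ, c.a.cell [j] = y j := by
    intro j hj
    refine HElt.ext ?_ (hca j hj)
    have := hs j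
    rw [HElt.sdeg] at this
    rw [c.a.deg_cell, wt_cons, wt_nil, ← this]
    ring
  refine ⟨_, _, c.isCyclicDefiningSystem (fun i => ?_) (HElt.ext ?_ hcm) (fun i => ?_)
    (HElt.ext ?_ hcn), c.staircaseInner_system.trans hc⟩
  · rw [hcell _ (by simp; omega), hyx _ (by omega), hx.diag_a]
  · rw [c.m.deg_cell]
    simp [s, HElt.sdeg]
  · rw [hcell _ (by simp), hyx _ (by omega), hx.diag_b]
  · rw [c.n.deg_cell]
    simp [s, HElt.sdeg]
    rw [if_neg (by omega), sub_add_cancel]
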